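/- **Setting.** Let $(\Omega,\mathcal A,P)$ be a probability space. A functional time series $(Z_t)_{t\in\mathbb Z}$ in $L^2([0,1])$ is a sequence of jointly measurable maps $Z_t:[0,1]\times\Omega\to\mathbb R$ with $Z_t(\cdot,\omega)\in L^2([0,1])$ almost surely; it is strictly stationary if $(Z_{t_1+h},\dots,Z_{t_q+h})$ and $(Z_{t_1},\dots,Z_{t_q})$ have the same law in $L^2([0,1])^q$ for all $q,h,t_1,\dots,t_q$. Let $(X_{t,T})_{t\in\mathbb Z}$, $T\ge 1$, be functional time series and $(X_t^{(u)})_{t\in\mathbb Z}$, $u\in[0,1]$, strictly stationary functional time series. Assume: 1. (Local stationarity of order 4.) There are random variables $P_{t,T}^{(u)}$ with $\sup_{u\in[0,1],\,T\ge1,\,1\le t\le T}E|P_{t,T}^{(u)}|^4<\infty$ and, for all $u\in[0,1]$, $T\ge1$ and $1\le t\le T$, $\|X_{t,T}-X_t^{(u)}\|_2\le\big(|t/T-u|+1/T\big)P_{t,T}^{(u)}$ almost surely. 2. (Moments.) For every $k\in\mathbb N$ there is $C_k<\infty$ with $E\|X_{t,T}\|_2^k\le C_k$ and $E\|X_0^{(u)}\|_2^k\le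 C_k$ for all $t\in\mathbb Z$, $T\ge1$, $u\in[0,1]$. 3. (Exponential strong mixing.) For σ-fields put $\alpha(\mathcal F,\mathcal G)=\sup\{|P(A\cap B)-P(A)P(B)|:A\in\mathcal F,B\in\mathcal G\}$, and for a series $Z$ put $\alpha_Z(k)=\sup_{t\in\mathbb Z}\alpha\big(\sigma(Z_s(\tau):s\le t,\tau\in[0,1]),\,\sigma(Z_s(\tau):s\ge t+k,\tau\in[0,1])\big)$. There are $c>0$ and $a\in(0,1)$ such that $\alpha_Z(k)\le c\,a^k$ for all $k\ge0$ when $Z$ is any of the series $(X_{t,T})_t$, $T\ge1$, or $(X_t^{(u)})_t$, $u\in[0,1]$. 4. $m=m(T)$ is a sequence of non-negative integers with $m\to\infty$ and $m^2/T\to0$ as $T\to\infty$. Covariance kernels $\operatorname{cov}(X_0^{(w)},X_k^{(w)})$, that is $(\tau,\phi)\mapsto\operatorname{cov}(X_0^{(w)}(\tau),X_k^{(w)}(\phi))$, and their sums over $k$ and integrals over $w$ are taken in $L^2([0,1]^2)$, whose norm is $\|\cdot\|_{2,2}$. Put $$\tilde\sigma_T(\tau,\phi)=\frac1T\sum_{i=1}^T\frac1m\Big(\sum_{t=i}^{(i+m-1)\wedge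 T}X_{t,T}(\tau)-E X_{t,T}(\tau)\Big)\Big(\sum_{t=i}^{(i+m-1)\wedge T}X_{t,T}(\phi)-E X_{t,T}(\phi)\Big),$$ $$\sigma_c=\sum_{k\in\mathbb Z}\int_0^1\operatorname{cov}(X_0^{(w)},X_k^{(w)})\,dw,\qquad \Delta=\Big\|\sum_{k\in\mathbb Z}|k|\int_0^1\operatorname{cov}(X_0^{(w)},X_k^{(w)})\,dw\Big\|_{2,2}^2,$$ $$\Gamma=\frac23\int_0^1\bigg\{\Big(\sum_{k\in\mathbb Z}\int_0^1\operatorname{cov}\big(X_0^{(w)}(\tau),X_k^{(w)}(\tau)\big)\,d\tau\Big)^2+\Big\|\sum_{k\in\mathbb Z}\operatorname{cov}(X_0^{(w)},X_k^{(w)})\Big\|_{2,2}^2\bigg\}\,dw.$$ Here $\sigma_c(\tau,\phi)=\operatorname{cov}(B(1,\tau),B(1,\phi))$ is the value at $u=v=1$ of the covariance kernel $\sum_{k}\int_0^{u\wedge v}\operatorname{cov}(X_0^{(w)},X_k^{(w)})\,dw$ of the centred Gaussian limit $B$ of $T^{-1/2}\sum_{t\le uT}(X_{t,T}-EX_{t,T})$.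 **Lemma.** All series and integrals that define $\sigma_c$, $\Delta$ and $\Gamma$ converge. For every $T\ge1$, $\tilde\sigma_T(\tau,\phi)$ is square integrable for almost every $(\tau,\phi)$, and its squared bias, its variance and its mean squared error are integrable over $[0,1]^2$. If $R_1,R_2,\dots$ are independent standard normal random variables that are independent of the process $(X_{t,T})_{t\in\mathbb Z,T\ge1}$, and $$\tilde B_T^{(1)}(u,\tau)=\frac1{\sqrt T}\sum_{i=1}^{\lfloor uT\rfloor}\frac{R_i}{\sqrt m}\sum_{t=i}^{(i+m-1)\wedge T}\big(X_{t,T}(\tau)-EX_{t,T}(\tau)\big),$$ then for all $T\ge1$ and almost every $(\tau,\phi)$, almost surely, $\tilde\sigma_T(\tau,\phi)=\operatorname{cov}\big(\tilde B_T^{(1)}(1,\tau),\tilde B_T^{(1)}(1,\phi)\,\big|\,X_{1,T},\dots,X_{T,T}\big)$. As $T\to\infty$, $$\int_{[0,1]^2}\big(E[\tilde\sigma_T(\tau,\phi)]-\sigma_c(\tau,\phi)\big)^2\,d(\tau,\phi)=\frac1{m^2}\Delta+o(m^{-2}),$$ $$\int_{[0,1]^2}\operatorname{Var}\big(\tilde\sigma_T(\tau,\phi)\big)\,d(\tau,\phi)=\frac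 mT\Gamma+o(m/T),$$ and consequently $$\int_{[0,1]^2}E\big[(\tilde\sigma_T(\tau,\phi)-\sigma_c(\tau,\phi))^2\big]\,d(\tau,\phi)=\frac mT\Gamma+\frac1{m^2}\Delta+o\big(m^{-2}+m/T\big).$$ If $\Delta>0$ and $\Gamma>0$, then for every $T\ge1$ the leading term $x\mapsto\frac xT\Gamma+\frac1{x^2}\Delta$ has on $(0,\infty)$ the unique minimiser $x_0=(2\Delta T/\Gamma)^{1/3}$. -/

import Mathlib

open MeasureTheory ProbabilityTheory Filter Topology Asymptotics
open scoped ENNReal NNReal unitInterval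

noncomputable section

namespace BlockBootstrap

/-! ### Random elements of `L²([0,1])` and functional time series

A random function is a jointly measurable map `[0,1] × Ω → ℝ`, written in curried form
`I → Ω → ℝ`, whose sample paths are almost surely square integrable. -/

/-- The Hilbert space `L²([0,1])`. -/
abbrev L2I : Type := Lp ℝ 2 (volume : Measure I)

/-- The Hilbert space `L²([0,1]²)`. -/
abbrev L2II : Type := Lp ℝ 2 (volume : Measure (I × I))

instance : MeasurableSpace L2I := borel L2I

instance : BorelSpace L2I := ⟨rfl⟩

open Classical in
/-- The class in `L²` of a square integrable function (and `0` for all other functions). -/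
def toL2 {S : Type*} [MeasureSpace S] (f : S → ℝ) : Lp ℝ 2 (volume : Measure S) :=
  if h : MemLp f 2 volume then h.toLp f else 0

variable {Ω : Type*} [MeasurableSpace Ω]

/-- `(X t)_{t ∈ ℤ}` is a functional time series in `L²([0,1])`. -/
def IsFunctionalTimeSeries (P : Measure Ω) (X : ℤ → I → Ω → ℝ) : Prop :=
  ∀ t, Measurable (Function.uncurry (X t)) ∧ ∀ᵐ ω ∂P, MemLp (fun τ => X t τ ω) 2 volume

/-- Strict stationarity: for all `q`, `h` and `t₁, …, t_q`, the vectors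
`(X_{t₁+h}, …, X_{t_q+h})` and `(X_{t₁}, …, X_{t_q})` have the same law in `L²([0,1])^q`. -/
def IsStationary (P : Measure Ω) (X : ℤ → I → Ω → ℝ) : Prop :=
  ∀ (q : ℕ) (h : ℤ) (t : Fin q → ℤ),
    IdentDistrib (fun ω (j : Fin q) => (toL2 (fun τ => X (t j + h) τ ω) : L2I))
      (fun ω (j : Fin q) => (toL2 (fun τ => X (t j) τ ω) : L2I)) P P

/-- The sequence `(X T t)_{t ∈ ℤ}`, `T ≥ 1`, of functional time series is locally stationary of
order `ρ`, with the strictly stationary approximating series `(Y u t)_{t ∈ ℤ}`, `u ∈ [0,1]`. -/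
structure IsLocallyStationary (P : Measure Ω) (ρ : ℝ) (X : ℕ → ℤ → I → Ω → ℝ)
    (Y : I → ℤ → I → Ω → ℝ) : Prop where
  series : ∀ T, 1 ≤ T → IsFunctionalTimeSeries P (X T)
  approx_series : ∀ u, IsFunctionalTimeSeries P (Y u)
  approx_stationary : ∀ u, IsStationary P (Y u)
  approx : ∃ (Q : ℕ → ℤ → I → Ω → ℝ) (C : ℝ≥0),
    ∀ T : ℕ, 1 ≤ T → ∀ t : ℤ, 1 ≤ t → t ≤ T → ∀ u : I,
      Measurable (Q T t u) ∧
      ∫⁻ ω, ‖Q T t u ω‖ₑ ^ ρ ∂P ≤ C ∧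
      ∀ᵐ ω ∂P, eLpNorm (fun τ => X T t τ ω - Y u t τ ω) 2 volume
        ≤ ENNReal.ofReal ((|(t : ℝ) / (T : ℝ) - (u : ℝ)| + 1 / (T : ℝ)) * Q T t u ω)

/-- All moments of `‖X_{t,T}‖₂` and `‖X_0^{(u)}‖₂` are bounded uniformly in `t`, `T` and `u`. -/
def MomentCondition (P : Measure Ω) (X : ℕ → ℤ → I → Ω → ℝ) (Y : I → ℤ → I → Ω → ℝ) : Prop :=
  ∀ k : ℕ, ∃ C : ℝ≥0,
    (∀ T : ℕ, 1 ≤ T → ∀ t : ℤ,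
      ∫⁻ ω, eLpNorm (fun τ => X T t τ ω) 2 volume ^ k ∂P ≤ C) ∧
    ∀ u : I, ∫⁻ ω, eLpNorm (fun τ => Y u 0 τ ω) 2 volume ^ k ∂P ≤ C

/-! ### Strong mixing -/

/-- The strong mixing coefficient `α(𝓕, 𝓖) = sup |P(A ∩ B) - P(A) P(B)|` over `A ∈ 𝓕`, `B ∈ 𝓖`. -/
def alphaCoef (P : Measure Ω) (𝓕 𝓖 : MeasurableSpace Ω) : ℝ≥0∞ :=
  ⨆ (A : Set Ω) (_ : MeasurableSet[𝓕] A) (B : Set Ω) (_ : MeasurableSet[𝓖] B),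
    ENNReal.ofReal |P.real (A ∩ B) - P.real A * P.real B|

/-- The σ-field generated by the values `X s τ`, `s ∈ S`, `τ ∈ [0,1]`. -/
@[reducible] def sigmaField (X : ℤ → I → Ω → ℝ) (S : Set ℤ) : MeasurableSpace Ω :=
  ⨆ (s : ℤ) (_ : s ∈ S) (τ : I), MeasurableSpace.comap (X s τ) inferInstance

/-- The mixing coefficient at distance `k` of a single functional time series. -/
def mixingCoef (P : Measure Ω) (X : ℤ → I → Ω → ℝ) (k : ℕ) : ℝ≥0∞ :=
  ⨆ t : ℤ, alphaCoef P (sigmaField X (Set.Iic t)) (sigmaField X (Set.Ici (t + k)))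

/-- The mixing coefficient `α(k) = max {α'(k), α''(k)}`: `α'` is the supremum of the coefficients of
the series `X T`, `T ≥ 1`, and `α''` that of the coefficients of the approximating series `Y u`,
`u ∈ [0,1]`. -/
def alphaMix (P : Measure Ω) (X : ℕ → ℤ → I → Ω → ℝ) (Y : I → ℤ → I → Ω → ℝ) (k : ℕ) : ℝ≥0∞ :=
  max (⨆ (T : ℕ) (_ : 1 ≤ T), mixingCoef P (X T) k) (⨆ u : I, mixingCoef P (Y u) k)

/-- Exponential strong mixing: `α(k) ≤ c a ^ k` for some `c > 0` and `a ∈ (0,1)`. -/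
def IsExpStronglyMixing (P : Measure Ω) (X : ℕ → ℤ → I → Ω → ℝ) (Y : I → ℤ → I → Ω → ℝ) : Prop :=
  ∃ c a : ℝ, 0 < c ∧ 0 < a ∧ a < 1 ∧ ∀ k : ℕ, alphaMix P X Y k ≤ ENNReal.ofReal (c * a ^ k)

/-! ### Covariance kernels and the limiting quantities -/

/-- The cross-covariance function `(τ, φ) ↦ cov(Z(τ), W(φ))`. -/
def covFun (P : Measure Ω) (Z W : I → Ω → ℝ) (p : I × I) : ℝ := cov[Z p.1, W p.2; P]

/-- The lag `k` autocovariance kernel `cov(X_0^{(w)}, X_k^{(w)})` as an element of `L²([0,1]²)`. -/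
def acovKernel (P : Measure Ω) (Y : I → ℤ → I → Ω → ℝ) (w : I) (k : ℤ) : L2II :=
  toL2 (covFun P (Y w 0) (Y w k))

/-- The integrated autocovariance kernel `∫₀¹ cov(X_0^{(w)}, X_k^{(w)}) dw`. -/
def intAcov (P : Measure Ω) (Y : I → ℤ → I → Ω → ℝ) (k : ℤ) : L2II :=
  ∫ w : I, acovKernel P Y w k

/-- The trace `∫₀¹ cov(X_0^{(w)}(τ), X_k^{(w)}(τ)) dτ`. -/
def acovTrace (P : Measure Ω) (Y : I → ℤ → I → Ω → ℝ) (w : I) (k : ℤ) : ℝ :=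
  ∫ τ : I, cov[Y w 0 τ, Y w k τ; P]

/-- The covariance kernel `r((u, ·), (v, ·)) = ∑_{k ∈ ℤ} ∫_0^{u ∧ v} cov(X_0^{(w)}, X_k^{(w)}) dw` of
the centred Gaussian limit `B` of the partial sum process
`T^{-1/2} ∑_{t ≤ uT} (X_{t,T} - E X_{t,T})`. -/
def limitCovKernel (P : Measure Ω) (Y : I → ℤ → I → Ω → ℝ) (u v : I) : L2II :=
  ∑' k : ℤ, ∫ w in Set.Iic (min u v), acovKernel P Y w k

/-- The long-run covariance kernel `σ_c(τ, φ) = cov(B(1, τ), B(1, φ))`. -/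
def longRunCov (P : Measure Ω) (Y : I → ℤ → I → Ω → ℝ) : L2II := limitCovKernel P Y 1 1

/-- The bias constant `Δ`. -/
def Delta (P : Measure Ω) (Y : I → ℤ → I → Ω → ℝ) : ℝ :=
  ‖∑' k : ℤ, |(k : ℝ)| • intAcov P Y k‖ ^ 2

/-- The integrand of the variance constant `Γ`. -/
def gammaIntegrand (P : Measure Ω) (Y : I → ℤ → I → Ω → ℝ) (w : I) : ℝ :=
  (∑' k : ℤ, acovTrace P Y w k) ^ 2 + ‖∑' k : ℤ, acovKernel P Y w k‖ ^ 2

/-- The variance constant `Γ`. -/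
def Gamma (P : Measure Ω) (Y : I → ℤ → I → Ω → ℝ) : ℝ :=
  2 / 3 * ∫ w : I, gammaIntegrand P Y w

/-! ### The bootstrap estimator -/

/-- The block sum `∑_{t=i}^{(i+m-1) ∧ T} (X_{t,T}(τ) - E X_{t,T}(τ))`. -/
def blockSum (P : Measure Ω) (X : ℕ → ℤ → I → Ω → ℝ) (T m i : ℕ) (τ : I) (ω : Ω) : ℝ :=
  ∑ t ∈ Finset.Icc i (min (i + m - 1) T), (X T (t : ℤ) τ ω - ∫ ω', X T (t : ℤ) τ ω' ∂P)

/-- The bootstrap estimator `σ̃_T(τ, φ)` with block length `m`, `p = (τ, φ)`. -/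
def sigmaTilde (P : Measure Ω) (X : ℕ → ℤ → I → Ω → ℝ) (T m : ℕ) (p : I × I) (ω : Ω) : ℝ :=
  1 / (T : ℝ) * ∑ i ∈ Finset.Icc 1 T,
    1 / (m : ℝ) * (blockSum P X T m i p.1 ω * blockSum P X T m i p.2 ω)

/-- Multipliers: independent standard normal random variables that are independent of the process
`(X_{t,T})`. -/
structure IsMultiplierSequence (P : Measure Ω) (X : ℕ → ℤ → I → Ω → ℝ) (R : ℕ → Ω → ℝ) : Prop where
  measurable : ∀ i, Measurable (R i)
  law : ∀ i, HasLaw (R i) (gaussianReal 0 1) P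
  indep : iIndepFun R P
  indep_process : Indep (⨆ i : ℕ, MeasurableSpace.comap (R i) inferInstance)
    (⨆ (T : ℕ) (_ : 1 ≤ T), sigmaField (X T) Set.univ) P

/-- The multiplier process
`B_T(u, τ) = T^{-1/2} ∑_{i=1}^{⌊uT⌋} m^{-1/2} R_i ∑_{t=i}^{(i+m-1) ∧ T} (X_{t,T}(τ) - E X_{t,T}(τ))`. -/
def multiplierProcess (P : Measure Ω) (X : ℕ → ℤ → I → Ω → ℝ) (R : ℕ → Ω → ℝ) (T m : ℕ)
    (u τ : I) (ω : Ω) : ℝ :=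
  1 / √(T : ℝ) * ∑ i ∈ Finset.Icc 1 ⌊(u : ℝ) * T⌋₊,
    R i ω / √(m : ℝ) * blockSum P X T m i τ ω

/-- The conditional covariance of two real random variables given a σ-field. -/
def condCov (P : Measure Ω) (𝓕 : MeasurableSpace Ω) (Z W : Ω → ℝ) : Ω → ℝ :=
  P[fun ω => (Z ω - (P[Z | 𝓕]) ω) * (W ω - (P[W | 𝓕]) ω) | 𝓕]

/-- The σ-field generated by the observations `X_{1,T}, …, X_{T,T}`. -/
@[reducible] def obsField (X : ℕ → ℤ → I → Ω → ℝ) (T : ℕ) : MeasurableSpace Ω :=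
  sigmaField (X T) (Set.Icc 1 (T : ℤ))

/-! ### Bias, variance and mean squared error -/

/-- The bias `E σ̃_T(τ, φ) - σ_c(τ, φ)`. -/
def bias (P : Measure Ω) (X : ℕ → ℤ → I → Ω → ℝ) (Y : I → ℤ → I → Ω → ℝ) (T m : ℕ)
    (p : I × I) : ℝ :=
  ∫ ω, sigmaTilde P X T m p ω ∂P - longRunCov P Y p

/-- The mean squared error `E (σ̃_T(τ, φ) - σ_c(τ, φ))²`. -/
def mse (P : Measure Ω) (X : ℕ → ℤ → I → Ω → ℝ) (Y : I → ℤ → I → Ω → ℝ) (T m : ℕ)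
    (p : I × I) : ℝ :=
  ∫ ω, (sigmaTilde P X T m p ω - longRunCov P Y p) ^ 2 ∂P

/-- The leading term `x ↦ (x / T) Γ + Δ / x²` of the integrated mean squared error. -/
def leadingIMSE (Γ Δ : ℝ) (T : ℕ) (x : ℝ) : ℝ := x / (T : ℝ) * Γ + Δ / x ^ 2

end BlockBootstrap

end

namespace BlockBootstrap

/-! ### Covariance inequalities under strong mixing -/

/-! Write `x_t` for the centred path of `X_{t,T}`, a random element of `L²([0,1])`. As an element of
`L²([0,1]²)`, the estimator is `1/(Tm)` times the sum over the blocks `i` of the tensor square of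
`∑_{t in block i} x_t`. The integrated squared bias is then the squared norm of its Bochner mean
minus `σ_c`, and the integrated variance is `E‖V - E V‖²` for this random element `V`. The
translation from pointwise moments rests on `IsSquareField.aestronglyMeasurable_path`,
`IsSquareField.integral_path` and `toL2_covFun`.

Bias: a pair `(s,t)` lies in `(m - |t-s|)⁺` common blocks, except near the left end. Freezing the
covariance of `x_s, x_t` at `w = s/T` and replacing the average over `s` by an integral gives `m · E
σ̃_T = m σ_c - ∑ |k| ∫ cov(X_0, X_k) dw + O(m/√T + m²/T + 1/m)`; this is
`IsLocCov.norm_sum_blocks_sub_le`. Since `m²/T → 0`, `m` times the bias converges, and `Δ` is the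
squared norm of the limit.

Variance: the expectation of a product of four factors is the sum of three pairings and a cumulant.
Centring `V` removes the pairing inside the blocks, and the cumulants are summable and hence
negligible (`IsMixingSeq.abs_variance_sub_le`). The other two pairings are products of covariances
between the sums over blocks `i` and `j`, one of traces and one of kernels. Each such covariance is
close to `(m - |j-i|)⁺` times a long-run covariance at `i/T`, and `∑_j ((m-|j-i|)⁺)²` is about
`2m³/3`, which produces the two terms of `Γ` with their factor `2/3`
(`IsLocCov.abs_sum_inner_blockCov_sub_le`).

All decay comes from one covariance inequality: truncation proves it for real variables, random
signs lift it to inner products in a Hilbert space without dependence on the dimension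
(`abs_integral_inner_sub_le`), and duality lifts it to tensors (`norm_integral_tensor_sub_le`). For
cumulants, four times always have a gap comparable to their spread, and across that gap the cumulant
is small (`IsMixingSeq.abs_cumFour_le`). Approximation errors grow with the lag while covariances
decay exponentially; the geometric mean of the two bounds is both small and summable
(`le_sqrt_mul_lagWeight`), at the price of errors of order `T^{-1/2}` instead of `T^{-1}`.

The mean squared error is the sum of variance and squared bias. The conditional covariance formula
uses only that the multipliers are centred, orthonormal and independent of the data. -/

/-- The strong mixing coefficient of `𝓕` and `𝓖` is at most `δ`. -/
def MixBound {Ω : Type*} [MeasurableSpace Ω] (P : Measure Ω) (𝓕 𝓖 : MeasurableSpace Ω) (δ : ℝ) :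
    Prop :=
  ∀ A B, MeasurableSet[𝓕] A → MeasurableSet[𝓖] B →
    |P.real (A ∩ B) - P.real A * P.real B| ≤ δ

section Scalar

variable {Ω : Type*} {𝓕 𝓖 : MeasurableSpace Ω} {mΩ : MeasurableSpace Ω} {P : Measure Ω}

lemma MixBound.symm {δ : ℝ} (h : MixBound P 𝓕 𝓖 δ) : MixBound P 𝓖 𝓕 δ := by
  intro A B hA hB
  rw [Set.inter_comm, mul_comm]
  exact h B A hB hA

/-- Since `f` is `𝓕`-measurable, `h` may be replaced by its conditional expectation. The `L¹` norm
of the latter is a difference of integrals of `h` over two `𝓕`-measurable sets, whence the factor 2.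
-/
lemma abs_integral_mul_le_of_forall_setIntegral_le [IsFiniteMeasure P] (h𝓕 : 𝓕 ≤ mΩ)
    {f h : Ω → ℝ} {M δ : ℝ} (hf : AEStronglyMeasurable[𝓕] f P) (hfM : ∀ ω, |f ω| ≤ M)
    (hM : 0 ≤ M) (hh : Integrable h P)
    (hδ : ∀ A, MeasurableSet[𝓕] A → |∫ ω in A, h ω ∂P| ≤ δ) :
    |∫ ω, f ω * h ω ∂P| ≤ 2 * M * δ := by
  have h1 : ∫ ω, f ω * h ω ∂P = ∫ ω, f ω * (P[h | 𝓕]) ω ∂P := by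
    have := condExp_stronglyMeasurable_mul_of_bound₀ h𝓕 hf hh M
      (Eventually.of_forall fun ω => by simpa using hfM ω)
    rw [← integral_condExp h𝓕 (f := fun ω => f ω * h ω)]
    exact integral_congr_ae this
  have hg : Integrable (P[h | 𝓕]) P := integrable_condExp
  have h2 : |∫ ω, f ω * (P[h | 𝓕]) ω ∂P| ≤ ∫ ω, M * ‖(P[h | 𝓕]) ω‖ ∂P := by
    rw [← Real.norm_eq_abs]
    refine norm_integral_le_of_norm_le (hg.norm.const_mul M) (Eventually.of_forall fun ω => ?_)
    rw [norm_mul]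
    exact mul_le_mul_of_nonneg_right (by simpa using hfM ω) (norm_nonneg _)
  rw [h1]
  refine h2.trans ?_
  rw [integral_const_mul, integral_norm_eq_pos_sub_neg hg]
  have hm : Measurable[𝓕] (P[h | 𝓕]) := stronglyMeasurable_condExp.measurable
  have hA : MeasurableSet[𝓕] {ω | 0 ≤ (P[h | 𝓕]) ω} := measurableSet_le measurable_const hm
  have hB : MeasurableSet[𝓕] {ω | (P[h | 𝓕]) ω ≤ 0} := measurableSet_le hm measurable_const
  rw [setIntegral_condExp h𝓕 hh hA, setIntegral_condExp h𝓕 hh hB]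
  have e1 := (abs_le.1 (hδ _ hA)).2
  have e2 := (abs_le.1 (hδ _ hB)).1
  nlinarith

/-- The previous lemma is used twice: it reduces `f` to indicators of events `A` in `𝓕`, then, for
each `A`, it reduces `g` to indicators of events in `𝓖`. Each use costs a factor 2. -/
lemma abs_covariance_le_of_bounded [IsProbabilityMeasure P] (h𝓕 : 𝓕 ≤ mΩ) (h𝓖 : 𝓖 ≤ mΩ)
    {δ M N : ℝ} (hmix : MixBound P 𝓕 𝓖 δ) {f g : Ω → ℝ} (hf : AEStronglyMeasurable[𝓕] f P)
    (hg : AEStronglyMeasurable[𝓖] g P) (hfM : ∀ ω, |f ω| ≤ M) (hgN : ∀ ω, |g ω| ≤ N) :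
    |∫ ω, f ω * g ω ∂P - (∫ ω, f ω ∂P) * ∫ ω, g ω ∂P| ≤ 4 * M * N * δ := by
  obtain ⟨ω₀⟩ : Nonempty Ω := P.nonempty_of_neZero
  have hM : 0 ≤ M := (abs_nonneg _).trans (hfM ω₀)
  have hN : 0 ≤ N := (abs_nonneg _).trans (hgN ω₀)
  have hfi : Integrable f P := Integrable.of_bound (hf.mono h𝓕) M
    (Eventually.of_forall fun ω => by simpa using hfM ω)
  have hgi : Integrable g P := Integrable.of_bound (hg.mono h𝓖) N
    (Eventually.of_forall fun ω => by simpa using hgN ω)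
  have hfg : Integrable (fun ω => f ω * g ω) P := hgi.bdd_mul (hf.mono h𝓕)
    (Eventually.of_forall fun ω => by simpa using hfM ω)
  set h : Ω → ℝ := fun ω => g ω - ∫ ω', g ω' ∂P with hh
  have hhi : Integrable h P := hgi.sub (integrable_const _)
  have e1 : ∫ ω, f ω * g ω ∂P - (∫ ω, f ω ∂P) * ∫ ω, g ω ∂P = ∫ ω, f ω * h ω ∂P := by
    simp only [hh, mul_sub]
    rw [integral_sub hfg (hfi.mul_const _), integral_mul_const]
  rw [e1]
  refine (abs_integral_mul_le_of_forall_setIntegral_le h𝓕 hf hfM hM hhi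
    (δ := 2 * N * δ) fun A hA => ?_).trans (le_of_eq (by ring))
  have hA' : MeasurableSet A := h𝓕 A hA
  have hind : Integrable (A.indicator fun _ => (1 : ℝ)) P :=
    (integrable_const (1 : ℝ)).indicator hA'
  have e2 : ∫ ω in A, h ω ∂P = ∫ ω, g ω * (A.indicator (fun _ => (1 : ℝ)) ω - P.real A) ∂P := by
    have : ∀ ω, A.indicator g ω = g ω * A.indicator (fun _ => (1 : ℝ)) ω := by
      intro ω; by_cases hω : ω ∈ A <;> simp [hω]
    simp only [hh]
    rw [integral_sub hgi.integrableOn (integrable_const _), ← integral_indicator hA']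
    simp_rw [mul_sub]
    rw [integral_sub _ (hgi.mul_const _), integral_mul_const]
    · simp only [this]
      simp [mul_comm]
    · simpa only [← this] using hgi.indicator hA'
  rw [e2]
  refine abs_integral_mul_le_of_forall_setIntegral_le h𝓖 hg hgN hN (hind.sub (integrable_const _))
    fun B hB => ?_
  have hB' : MeasurableSet B := h𝓖 B hB
  have e3 : ∫ ω in B, (A.indicator (fun _ => (1 : ℝ)) ω - P.real A) ∂P
      = P.real (A ∩ B) - P.real A * P.real B := by
    rw [integral_sub hind.integrableOn (integrable_const _), integral_indicator hA',
      Measure.restrict_restrict hA']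
    simp [mul_comm]
  rw [e3]
  exact hmix A B hA hB

/-- The difference vanishes unless `M² ≤ x² + y²`; in that case it is at most `x² + y² ≤ (x² + y²)²
/ M²`. -/
lemma abs_mul_sub_clamp_mul_clamp_le {M x y : ℝ} (hM : 0 < M) :
    |x * y - max (-M) (min M x) * max (-M) (min M y)| ≤ 2 * (x ^ 4 + y ^ 4) / M ^ 2 := by
  have key : ∀ z : ℝ, |max (-M) (min M z)| ≤ |z| := by
    intro z
    rcases le_total M z with h | h
    · rw [min_eq_left h, max_eq_right (by linarith), abs_of_pos hM]
      exact h.trans (le_abs_self z)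
    · rw [min_eq_right h]
      rcases le_total (-M) z with h' | h'
      · rw [max_eq_right h']
      · rw [max_eq_left h', abs_neg, abs_of_pos hM]
        linarith [neg_abs_le z]
  by_cases hxy : |x| ≤ M ∧ |y| ≤ M
  · have hx := abs_le.1 hxy.1
    have hy := abs_le.1 hxy.2
    rw [min_eq_right hx.2, min_eq_right hy.2, max_eq_right hx.1, max_eq_right hy.1, sub_self,
      abs_zero]
    positivity
  · have h1 : |x * y - max (-M) (min M x) * max (-M) (min M y)| ≤ x ^ 2 + y ^ 2 := by
      calc _ ≤ |x * y| + |max (-M) (min M x) * max (-M) (min M y)| := abs_sub _ _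
        _ ≤ |x| * |y| + |x| * |y| := by
            rw [abs_mul, abs_mul]
            exact add_le_add_right (mul_le_mul (key _) (key _) (abs_nonneg _) (abs_nonneg _)) _
        _ ≤ |x| ^ 2 + |y| ^ 2 := by nlinarith [sq_nonneg (|x| - |y|)]
        _ = _ := by rw [sq_abs, sq_abs]
    refine h1.trans ?_
    rw [le_div_iff₀ (by positivity)]
    have hM2 : M ^ 2 ≤ x ^ 2 + y ^ 2 := by
      rw [not_and_or, not_le, not_le] at hxy
      rcases hxy with h | h
      · have : M ^ 2 ≤ x ^ 2 := by rw [← sq_abs x]; gcongr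
        nlinarith [sq_nonneg y]
      · have : M ^ 2 ≤ y ^ 2 := by rw [← sq_abs y]; gcongr
        nlinarith [sq_nonneg x]
    nlinarith [sq_nonneg (x ^ 2 - y ^ 2), sq_nonneg x, sq_nonneg y]

lemma integrable_pow_of_integrable_pow [IsFiniteMeasure P] {f : Ω → ℝ}
    (hf : AEStronglyMeasurable f P) {j k : ℕ} (hjk : j ≤ k)
    (h : Integrable (fun ω => |f ω| ^ k) P) : Integrable (fun ω => |f ω| ^ j) P := by
  refine Integrable.mono' (h.add (integrable_const 1))
    ((continuous_abs.pow j).comp_aestronglyMeasurable hf)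
    (Eventually.of_forall fun ω => ?_)
  simp only [norm_pow, Real.norm_eq_abs, abs_abs, Pi.add_apply]
  rcases le_total 1 |f ω| with h1 | h1
  · linarith [pow_le_pow_right₀ h1 hjk]
  · linarith [pow_le_one₀ (n := j) (abs_nonneg _) h1, pow_nonneg (abs_nonneg (f ω)) k]

/-- Covariance inequality for strongly mixing real random variables. -/
lemma abs_covariance_le [IsProbabilityMeasure P] (h𝓕 : 𝓕 ≤ mΩ) (h𝓖 : 𝓖 ≤ mΩ)
    {β : ℝ} (hβ : 0 < β) (hmix : MixBound P 𝓕 𝓖 (β ^ 2)) {f g : Ω → ℝ}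
    (hf : AEStronglyMeasurable[𝓕] f P) (hg : AEStronglyMeasurable[𝓖] g P)
    (hf4 : Integrable (fun ω => f ω ^ 4) P) (hg4 : Integrable (fun ω => g ω ^ 4) P) :
    |∫ ω, f ω * g ω ∂P - (∫ ω, f ω ∂P) * ∫ ω, g ω ∂P|
      ≤ 4 * β * (1 + ∫ ω, f ω ^ 4 ∂P + ∫ ω, g ω ^ 4 ∂P) := by
  -- This level balances the two errors: the truncated variables contribute `4M²β² = 4β`, and the
  -- tails contribute a multiple of `1/M² = β`.
  set M : ℝ := √(1 / β) with hMdef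
  have hM : 0 < M := Real.sqrt_pos.2 (by positivity)
  have hM2 : M ^ 2 = 1 / β := Real.sq_sqrt (by positivity)
  set cl : ℝ → ℝ := fun x => max (-M) (min M x) with hcl
  have hclc : Continuous cl := by fun_prop
  have hclM : ∀ x, |cl x| ≤ M := fun x => abs_le.2
    ⟨le_max_left _ _, max_le (by linarith) (min_le_left _ _)⟩
  have hfm := hf.mono h𝓕
  have hgm := hg.mono h𝓖
  have hcf : AEStronglyMeasurable[𝓕] (fun ω => cl (f ω)) P := hclc.comp_aestronglyMeasurable hf
  have hcg : AEStronglyMeasurable[𝓖] (fun ω => cl (g ω)) P := hclc.comp_aestronglyMeasurable hg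
  have hcfi : Integrable (fun ω => cl (f ω)) P := Integrable.of_bound (hcf.mono h𝓕) M
    (Eventually.of_forall fun ω => by simpa using hclM (f ω))
  have hcgi : Integrable (fun ω => cl (g ω)) P := Integrable.of_bound (hcg.mono h𝓖) M
    (Eventually.of_forall fun ω => by simpa using hclM (g ω))
  have hcfg : Integrable (fun ω => cl (f ω) * cl (g ω)) P := hcgi.bdd_mul (hcf.mono h𝓕)
    (Eventually.of_forall fun ω => by simpa using hclM (f ω))
  have hint1 : ∀ {u : Ω → ℝ}, AEStronglyMeasurable u P → Integrable (fun ω => u ω ^ 4) P →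
      Integrable u P ∧ Integrable (fun ω => u ω ^ 2) P := by
    intro u hu hu4
    have h4 : Integrable (fun ω => |u ω| ^ 4) P := by
      simpa [Even.pow_abs (by decide : Even 4)] using hu4
    constructor
    · have := integrable_pow_of_integrable_pow hu (by norm_num : 1 ≤ 4) h4
      simp only [pow_one] at this
      exact (integrable_norm_iff hu).1 this
    · simpa using integrable_pow_of_integrable_pow hu (by norm_num : 2 ≤ 4) h4
  obtain ⟨hfi, hf2⟩ := hint1 hfm hf4
  obtain ⟨hgi, hg2⟩ := hint1 hgm hg4
  have hfg : Integrable (fun ω => f ω * g ω) P := by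
    refine Integrable.mono' (hf2.add hg2) (hfm.mul hgm) (Eventually.of_forall fun ω => ?_)
    simp only [Real.norm_eq_abs, Pi.add_apply, abs_mul]
    nlinarith [sq_nonneg (|f ω| - |g ω|), sq_abs (f ω), sq_abs (g ω), sq_nonneg (f ω),
      sq_nonneg (g ω)]
  have b1 := abs_covariance_le_of_bounded h𝓕 h𝓖 hmix hcf hcg (fun ω => hclM (f ω))
    (fun ω => hclM (g ω))
  have b2 : |∫ ω, f ω * g ω ∂P - ∫ ω, cl (f ω) * cl (g ω) ∂P|
      ≤ 2 * β * (∫ ω, f ω ^ 4 ∂P + ∫ ω, g ω ^ 4 ∂P) := by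
    rw [← integral_sub hfg hcfg, ← Real.norm_eq_abs, ← integral_add hf4 hg4,
      ← integral_const_mul]
    refine norm_integral_le_of_norm_le ((hf4.add hg4).const_mul _)
      (Eventually.of_forall fun ω => ?_)
    refine (abs_mul_sub_clamp_mul_clamp_le hM).trans (le_of_eq ?_)
    rw [hM2]; field_simp
  have b3 : |(∫ ω, f ω ∂P) * (∫ ω, g ω ∂P) - (∫ ω, cl (f ω) ∂P) * ∫ ω, cl (g ω) ∂P|
      ≤ 2 * β * (∫ ω, f ω ^ 4 ∂P + ∫ ω, g ω ^ 4 ∂P) := by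
    -- A product of means is an integral over `Ω × Ω`, that is, over independent copies, so the same
    -- pointwise truncation bound applies.
    rw [← integral_prod_mul, ← integral_prod_mul, ← integral_sub (hfi.mul_prod hgi)
      (hcfi.mul_prod hcgi), ← Real.norm_eq_abs]
    have hF : Integrable (fun z : Ω × Ω => f z.1 ^ 4) (P.prod P) := hf4.comp_fst P
    have hG : Integrable (fun z : Ω × Ω => g z.2 ^ 4) (P.prod P) := hg4.comp_snd P
    have e1 : ∫ z : Ω × Ω, f z.1 ^ 4 ∂(P.prod P) = ∫ ω, f ω ^ 4 ∂P := by
      simpa using integral_prod_mul (μ := P) (ν := P) (fun ω => f ω ^ 4) (fun _ => (1 : ℝ))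
    have e2 : ∫ z : Ω × Ω, g z.2 ^ 4 ∂(P.prod P) = ∫ ω, g ω ^ 4 ∂P := by
      simpa using integral_prod_mul (μ := P) (ν := P) (fun _ => (1 : ℝ)) (fun ω => g ω ^ 4)
    rw [← e1, ← e2, ← integral_add hF hG, ← integral_const_mul]
    refine norm_integral_le_of_norm_le ((hF.add hG).const_mul _)
      (Eventually.of_forall fun z => ?_)
    refine (abs_mul_sub_clamp_mul_clamp_le hM).trans (le_of_eq ?_)
    rw [hM2]; field_simp
  have b4 : 4 * M * M * β ^ 2 = 4 * β := by
    have : 4 * M * M * β ^ 2 = 4 * M ^ 2 * β ^ 2 := by ring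
    rw [this, hM2]; field_simp
  rw [b4] at b1
  have := abs_le.1 b1
  have := abs_le.1 b2
  have := abs_le.1 b3
  rw [abs_le]
  constructor <;> nlinarith

end Scalar

/-! ### Covariance inequality for inner products in a separable Hilbert space -/

section Hilbert

open scoped RealInnerProductSpace

variable {E : Type*} [NormedAddCommGroup E] [InnerProductSpace ℝ E]

/-- Distinct orthonormal vectors are at distance at least 1, so balls of radius 1/2 around them are
disjoint nonempty open sets. -/
lemma countable_of_orthonormal [SecondCountableTopology E] {ι : Type*} {b : ι → E}
    (hb : Orthonormal ℝ b) : Countable ι := by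
  have hd : ∀ i j, i ≠ j → 1 ≤ dist (b i) (b j) := by
    intro i j hij
    have h := norm_sub_sq_real (b i) (b j)
    rw [hb.1 i, hb.1 j, hb.2 hij] at h
    rw [dist_eq_norm]
    nlinarith [norm_nonneg (b i - b j)]
  have : (Set.univ : Set ι).PairwiseDisjoint fun i => Metric.ball (b i) (1 / 2) := by
    intro i _ j _ hij
    refine Metric.ball_disjoint_ball ?_
    have := hd i j hij
    linarith
  rw [← Set.countable_univ_iff]
  exact this.countable_of_isOpen (fun i _ => Metric.isOpen_ball)
    fun i _ => ⟨b i, Metric.mem_ball_self (by norm_num)⟩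

/-- Signed sums of finitely many vectors, with the covariance and the fourth moment bound
(Khintchine's inequality) of a Rademacher sum. -/
lemma exists_rademacher_family {ι : Type*} (b : ι → E) (F : Finset ι) :
    ∃ (κ : Type) (_ : Fintype κ) (_ : Nonempty κ) (G : κ → E),
      (∀ x y, ∑ g, ⟪x, G g⟫ * ⟪y, G g⟫
        = Fintype.card κ * ∑ n ∈ F, ⟪x, b n⟫ * ⟪y, b n⟫) ∧
      ∀ x, ∑ g, ⟪x, G g⟫ ^ 4 ≤ 3 * Fintype.card κ * (∑ n ∈ F, ⟪x, b n⟫ ^ 2) ^ 2 := by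
  classical
  induction F using Finset.induction_on with
  | empty => exact ⟨Unit, inferInstance, inferInstance, fun _ => 0, by simp, by simp⟩
  | insert n F hn ih =>
    obtain ⟨κ, _, _, G, h1, h2⟩ := ih
    -- Every sign pattern is continued with either sign of the new vector, so averages over the
    -- index type are Rademacher expectations.
    refine ⟨κ ⊕ κ, inferInstance, inferInstance, Sum.elim (fun g => G g + b n) fun g => G g - b n,
      fun x y => ?_, fun x => ?_⟩
    · have e : ∀ g, (⟪x, G g⟫ + ⟪x, b n⟫) * (⟪y, G g⟫ + ⟪y, b n⟫)
          = (2 * (⟪x, G g⟫ * ⟪y, G g⟫) + 2 * (⟪x, b n⟫ * ⟪y, b n⟫))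
            - (⟪x, G g⟫ - ⟪x, b n⟫) * (⟪y, G g⟫ - ⟪y, b n⟫) := fun g => by ring
      simp only [Fintype.sum_sum_type, Sum.elim_inl, Sum.elim_inr, inner_add_right,
        inner_sub_right, e, Finset.sum_sub_distrib, Finset.sum_add_distrib, ← Finset.mul_sum, h1,
        Finset.sum_insert hn, Fintype.card_sum, Finset.sum_const, Finset.card_univ, nsmul_eq_mul]
      push_cast
      ring
    · have hsq : ∑ g, ⟪x, G g⟫ ^ 2 = Fintype.card κ * ∑ n ∈ F, ⟪x, b n⟫ ^ 2 := by
        simpa [sq] using h1 x x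
      -- The odd powers cancel between the two signs. With `S` the old sum of squares and `b` the
      -- new coefficient, the induction closes by `6S² + 12b²S + 2b⁴ ≤ 6(S + b²)²`.
      have e : ∀ g, (⟪x, G g⟫ + ⟪x, b n⟫) ^ 4
          = (2 * ⟪x, G g⟫ ^ 4 + 12 * ⟪x, b n⟫ ^ 2 * ⟪x, G g⟫ ^ 2 + 2 * ⟪x, b n⟫ ^ 4)
            - (⟪x, G g⟫ - ⟪x, b n⟫) ^ 4 := fun g => by ring
      simp only [Fintype.sum_sum_type, Sum.elim_inl, Sum.elim_inr, inner_add_right,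
        inner_sub_right, e, Finset.sum_sub_distrib, Finset.sum_add_distrib, ← Finset.mul_sum, hsq,
        Finset.sum_insert hn, Fintype.card_sum, Finset.sum_const, Finset.card_univ, nsmul_eq_mul]
      push_cast
      have := h2 x
      have hc : (0 : ℝ) ≤ Fintype.card κ := by positivity
      nlinarith [mul_nonneg hc (pow_nonneg (sq_nonneg ⟪x, b n⟫) 2)]

variable {Ω : Type*} {𝓕 𝓖 : MeasurableSpace Ω} {mΩ : MeasurableSpace Ω} {P : Measure Ω}

/-- Bessel's inequality gives a bound that is uniform in `F`, which serves as the dominating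
function in the passage to the whole basis. -/
lemma abs_sum_inner_mul_inner_le {ι : Type*} {b : ι → E} (hb : Orthonormal ℝ b) (F : Finset ι)
    (x y : E) : |∑ n ∈ F, ⟪x, b n⟫ * ⟪y, b n⟫| ≤ ‖x‖ ^ 2 + ‖y‖ ^ 2 := by
  have hx := hb.sum_inner_products_le x (s := F)
  have hy := hb.sum_inner_products_le y (s := F)
  calc |∑ n ∈ F, ⟪x, b n⟫ * ⟪y, b n⟫| ≤ ∑ n ∈ F, |⟪x, b n⟫ * ⟪y, b n⟫| :=
        Finset.abs_sum_le_sum_abs _ _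
    _ ≤ ∑ n ∈ F, (‖⟪b n, x⟫‖ ^ 2 + ‖⟪b n, y⟫‖ ^ 2) := by
        refine Finset.sum_le_sum fun n _ => ?_
        rw [abs_mul, real_inner_comm x, real_inner_comm y, Real.norm_eq_abs, Real.norm_eq_abs]
        nlinarith [sq_nonneg (|⟪x, b n⟫| - |⟪y, b n⟫|), sq_nonneg (|⟪x, b n⟫|),
          sq_nonneg (|⟪y, b n⟫|)]
    _ ≤ _ := by rw [Finset.sum_add_distrib]; exact add_le_add hx hy

lemma integrable_norm_pow_of_le [IsFiniteMeasure P] {F : Type*} [NormedAddCommGroup F] {f : Ω → F}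
    (hf : AEStronglyMeasurable f P) {j k : ℕ} (hjk : j ≤ k)
    (h : Integrable (fun ω => ‖f ω‖ ^ k) P) : Integrable (fun ω => ‖f ω‖ ^ j) P := by
  have := integrable_pow_of_integrable_pow hf.norm hjk (by simpa using h)
  simpa using this

lemma integrable_of_integrable_norm_pow [IsFiniteMeasure P] {F : Type*} [NormedAddCommGroup F]
    {f : Ω → F} (hf : AEStronglyMeasurable f P) {k : ℕ} (hk : 1 ≤ k)
    (h : Integrable (fun ω => ‖f ω‖ ^ k) P) : Integrable f P := by
  have := integrable_norm_pow_of_le hf hk h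
  simp only [pow_one] at this
  exact (integrable_norm_iff hf).1 this

/-- Covariance inequality for strongly mixing random elements of a separable Hilbert space. -/
theorem abs_integral_inner_sub_le [CompleteSpace E] [SecondCountableTopology E]
    [IsProbabilityMeasure P] (h𝓕 : 𝓕 ≤ mΩ) (h𝓖 : 𝓖 ≤ mΩ) {β : ℝ} (hβ : 0 < β)
    (hmix : MixBound P 𝓕 𝓖 (β ^ 2)) {U V : Ω → E} (hU : AEStronglyMeasurable[𝓕] U P)
    (hV : AEStronglyMeasurable[𝓖] V P) (hU4 : Integrable (fun ω => ‖U ω‖ ^ 4) P)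
    (hV4 : Integrable (fun ω => ‖V ω‖ ^ 4) P) :
    |∫ ω, ⟪U ω, V ω⟫ ∂P - ⟪∫ ω, U ω ∂P, ∫ ω, V ω ∂P⟫|
      ≤ 4 * β * (1 + 3 * ∫ ω, ‖U ω‖ ^ 4 ∂P + 3 * ∫ ω, ‖V ω‖ ^ 4 ∂P) := by
  obtain ⟨w, b, -⟩ := exists_hilbertBasis ℝ E
  have hb := b.orthonormal
  have : Countable w := countable_of_orthonormal hb
  have hUm := hU.mono h𝓕
  have hVm := hV.mono h𝓖
  have hU2 := integrable_norm_pow_of_le hUm (by norm_num : 2 ≤ 4) hU4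
  have hV2 := integrable_norm_pow_of_le hVm (by norm_num : 2 ≤ 4) hV4
  have hUi := integrable_of_integrable_norm_pow hUm (by norm_num : 1 ≤ 4) hU4
  have hVi := integrable_of_integrable_norm_pow hVm (by norm_num : 1 ≤ 4) hV4
  have hmU : ∀ x : E, AEStronglyMeasurable[𝓕] (fun ω => ⟪U ω, x⟫) P := fun x =>
    (by fun_prop : Continuous fun y : E => ⟪y, x⟫).comp_aestronglyMeasurable hU
  have hmV : ∀ x : E, AEStronglyMeasurable[𝓖] (fun ω => ⟪V ω, x⟫) P := fun x =>
    (by fun_prop : Continuous fun y : E => ⟪y, x⟫).comp_aestronglyMeasurable hV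
  have hint : ∀ x : E, Integrable (fun ω => ⟪U ω, x⟫ * ⟪V ω, x⟫) P := by
    intro x
    refine Integrable.mono' ((hU2.add hV2).const_mul (‖x‖ ^ 2))
      (((hmU x).mono h𝓕).mul ((hmV x).mono h𝓖)) (Eventually.of_forall fun ω => ?_)
    simp only [Real.norm_eq_abs, abs_mul, Pi.add_apply]
    calc |⟪U ω, x⟫| * |⟪V ω, x⟫| ≤ (‖U ω‖ * ‖x‖) * (‖V ω‖ * ‖x‖) := by
          gcongr <;> exact abs_real_inner_le_norm _ _
      _ ≤ _ := by
          have : ‖U ω‖ * ‖V ω‖ ≤ ‖U ω‖ ^ 2 + ‖V ω‖ ^ 2 := by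
            nlinarith [sq_nonneg (‖U ω‖ - ‖V ω‖), sq_nonneg ‖U ω‖, sq_nonneg ‖V ω‖]
          nlinarith [sq_nonneg ‖x‖]
  have hEU : ∀ x : E, ∫ ω, ⟪U ω, x⟫ ∂P = ⟪∫ ω, U ω ∂P, x⟫ := fun x => by
    simp_rw [real_inner_comm x]; exact integral_inner hUi x
  have hEV : ∀ x : E, ∫ ω, ⟪V ω, x⟫ ∂P = ⟪∫ ω, V ω ∂P, x⟫ := fun x => by
    simp_rw [real_inner_comm x]; exact integral_inner hVi x
  -- It suffices to bound the sum of the covariances of finitely many coordinates uniformly in their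
  -- number.
  set D : Finset w → ℝ := fun F => ∫ ω, ∑ n ∈ F, ⟪U ω, b n⟫ * ⟪V ω, b n⟫ ∂P
    - ∑ n ∈ F, ⟪∫ ω, U ω ∂P, b n⟫ * ⟪∫ ω, V ω ∂P, b n⟫ with hD
  have hlim : Tendsto D atTop (𝓝 (∫ ω, ⟪U ω, V ω⟫ ∂P - ⟪∫ ω, U ω ∂P, ∫ ω, V ω ∂P⟫)) := by
    have hs : ∀ x y : E, Tendsto (fun F : Finset w => ∑ n ∈ F, ⟪x, b n⟫ * ⟪y, b n⟫) atTop
        (𝓝 ⟪x, y⟫) := by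
      intro x y
      have := b.hasSum_inner_mul_inner x y
      simpa only [HasSum, SummationFilter.unconditional_filter, real_inner_comm y] using this
    refine Tendsto.sub ?_ (hs _ _)
    refine tendsto_integral_filter_of_dominated_convergence (fun ω => ‖U ω‖ ^ 2 + ‖V ω‖ ^ 2)
      (Eventually.of_forall fun F => ?_) (Eventually.of_forall fun F =>
        Eventually.of_forall fun ω => abs_sum_inner_mul_inner_le hb F _ _) (hU2.add hV2)
      (Eventually.of_forall fun ω => hs _ _)
    exact (integrable_finsetSum F fun n _ => hint (b n)).aestronglyMeasurable
  refine le_of_tendsto hlim.abs (Eventually.of_forall fun F => ?_)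
  -- A term-by-term bound would grow with `F`. Instead the sum is the average over `g` of the
  -- covariances of the scalars `⟪U, G g⟫` and `⟪V, G g⟫`, whose fourth moments average to at most
  -- three times those of `‖U‖` and `‖V‖`.
  obtain ⟨κ, _, _, G, h1, h2⟩ := exists_rademacher_family b F
  have hcard : (0 : ℝ) < Fintype.card κ := by exact_mod_cast Fintype.card_pos
  have hDG : Fintype.card κ * D F = ∑ g, (∫ ω, ⟪U ω, G g⟫ * ⟪V ω, G g⟫ ∂P
      - (∫ ω, ⟪U ω, G g⟫ ∂P) * ∫ ω, ⟪V ω, G g⟫ ∂P) := by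
    rw [Finset.sum_sub_distrib, ← integral_finsetSum _ fun g _ => hint (G g)]
    simp only [hEU, hEV, h1, hD, mul_sub, integral_const_mul]
  have hint4 : ∀ {W : Ω → E}, AEStronglyMeasurable W P → Integrable (fun ω => ‖W ω‖ ^ 4) P →
      ∀ x : E, Integrable (fun ω => ⟪W ω, x⟫ ^ 4) P := by
    intro W hW hW4 x
    refine Integrable.mono' (hW4.mul_const (‖x‖ ^ 4))
      ((by fun_prop : Continuous fun y : E => ⟪y, x⟫ ^ 4).comp_aestronglyMeasurable hW)
      (Eventually.of_forall fun ω => ?_)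
    rw [norm_pow, ← mul_pow]
    exact pow_le_pow_left₀ (norm_nonneg _) (abs_real_inner_le_norm _ _) 4
  have hsum4 : ∀ {W : Ω → E}, AEStronglyMeasurable W P → Integrable (fun ω => ‖W ω‖ ^ 4) P →
      ∑ g, ∫ ω, ⟪W ω, G g⟫ ^ 4 ∂P ≤ 3 * Fintype.card κ * ∫ ω, ‖W ω‖ ^ 4 ∂P := by
    intro W hW hW4
    rw [← integral_finsetSum _ fun g _ => hint4 hW hW4 (G g), ← integral_const_mul]
    refine integral_mono (integrable_finsetSum _ fun g _ => hint4 hW hW4 (G g))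
      (hW4.const_mul _) fun ω => ?_
    refine (h2 (W ω)).trans ?_
    have hB := hb.sum_inner_products_le (W ω) (s := F)
    have e : ∑ n ∈ F, ⟪W ω, b n⟫ ^ 2 = ∑ n ∈ F, ‖⟪b n, W ω⟫‖ ^ 2 := by
      refine Finset.sum_congr rfl fun n _ => ?_
      rw [real_inner_comm, Real.norm_eq_abs, sq_abs]
    rw [e]
    have h0 : 0 ≤ ∑ n ∈ F, ‖⟪b n, W ω⟫‖ ^ 2 := by positivity
    have : (∑ n ∈ F, ‖⟪b n, W ω⟫‖ ^ 2) ^ 2 ≤ (‖W ω‖ ^ 2) ^ 2 := pow_le_pow_left₀ h0 hB 2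
    rw [← pow_mul] at this
    exact mul_le_mul_of_nonneg_left this (by positivity)
  have hbound : |Fintype.card κ * D F| ≤ ∑ g : κ, 4 * β * (1 + ∫ ω, ⟪U ω, G g⟫ ^ 4 ∂P
      + ∫ ω, ⟪V ω, G g⟫ ^ 4 ∂P) := by
    rw [hDG]
    refine (Finset.abs_sum_le_sum_abs _ _).trans (Finset.sum_le_sum fun g _ => ?_)
    exact abs_covariance_le h𝓕 h𝓖 hβ hmix (hmU _) (hmV _) (hint4 hUm hU4 _) (hint4 hVm hV4 _)
  rw [abs_mul, abs_of_pos hcard, ← Finset.mul_sum, Finset.sum_add_distrib, Finset.sum_add_distrib]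
    at hbound
  simp only [Finset.sum_const, Finset.card_univ, nsmul_eq_mul, mul_one] at hbound
  have e1 := hsum4 hUm hU4
  have e2 := hsum4 hVm hV4
  refine le_of_mul_le_mul_left (hbound.trans ?_) hcard
  nlinarith

end Hilbert

/-! ### Covariance inequality for tensor products -/

section Tensor

open scoped RealInnerProductSpace

variable {H K : Type*} [NormedAddCommGroup H] [InnerProductSpace ℝ H]
  [NormedAddCommGroup K] [InnerProductSpace ℝ K]

/-- The bilinear map `B` has the inner products of the Hilbert space tensor product. -/
def IsTensor (B : H →L[ℝ] H →L[ℝ] K) : Prop :=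
  ∀ x y x' y', ⟪B x y, B x' y'⟫ = ⟪x, x'⟫ * ⟪y, y'⟫

lemma IsTensor.norm_apply {B : H →L[ℝ] H →L[ℝ] K} (hB : IsTensor B) (x y : H) :
    ‖B x y‖ = ‖x‖ * ‖y‖ := by
  have h := hB x y x y
  simp only [real_inner_self_eq_norm_sq] at h
  rw [← mul_pow] at h
  exact (pow_left_inj₀ (norm_nonneg _) (by positivity) two_ne_zero).1 h

variable {Ω : Type*} {𝓕 𝓖 : MeasurableSpace Ω} {mΩ : MeasurableSpace Ω} {P : Measure Ω}

lemma integrable_tensor {B : H →L[ℝ] H →L[ℝ] K} (hB : IsTensor B) {U V : Ω → H}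
    (hU : AEStronglyMeasurable U P) (hV : AEStronglyMeasurable V P)
    (hU2 : Integrable (fun ω => ‖U ω‖ ^ 2) P) (hV2 : Integrable (fun ω => ‖V ω‖ ^ 2) P) :
    Integrable (fun ω => B (U ω) (V ω)) P := by
  refine Integrable.mono' (hU2.add hV2)
    ((by fun_prop : Continuous fun z : H × H => B z.1 z.2).comp_aestronglyMeasurable
      (hU.prodMk hV)) (Eventually.of_forall fun ω => ?_)
  simp only [hB.norm_apply, Pi.add_apply]
  nlinarith [sq_nonneg (‖U ω‖ - ‖V ω‖), sq_nonneg ‖U ω‖, sq_nonneg ‖V ω‖]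

/-- Covariance inequality for the Hilbert-Schmidt norm of the cross-covariance of strongly mixing
random elements of a separable Hilbert space. -/
theorem norm_integral_tensor_sub_le [CompleteSpace H] [CompleteSpace K] [SecondCountableTopology H]
    [IsProbabilityMeasure P] {B : H →L[ℝ] H →L[ℝ] K} (hB : IsTensor B)
    (h𝓕 : 𝓕 ≤ mΩ) (h𝓖 : 𝓖 ≤ mΩ) {β : ℝ} (hβ : 0 < β)
    (hmix : MixBound P 𝓕 𝓖 (β ^ 2)) {U V : Ω → H} (hU : AEStronglyMeasurable[𝓕] U P)
    (hV : AEStronglyMeasurable[𝓖] V P) (hU4 : Integrable (fun ω => ‖U ω‖ ^ 4) P)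
    (hV4 : Integrable (fun ω => ‖V ω‖ ^ 4) P) :
    ‖∫ ω, B (U ω) (V ω) ∂P - B (∫ ω, U ω ∂P) (∫ ω, V ω ∂P)‖
      ≤ 4 * β * (1 + 3 * ∫ ω, ‖U ω‖ ^ 4 ∂P + 3 * ∫ ω, ‖V ω‖ ^ 4 ∂P) := by
  have hUm := hU.mono h𝓕
  have hVm := hV.mono h𝓖
  have hU2 := integrable_norm_pow_of_le hUm (by norm_num : 2 ≤ 4) hU4
  have hV2 := integrable_norm_pow_of_le hVm (by norm_num : 2 ≤ 4) hV4
  have hUi := integrable_of_integrable_norm_pow hUm (by norm_num : 1 ≤ 4) hU4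
  have hUV := integrable_tensor hB hUm hVm hU2 hV2
  set κ := ∫ ω, B (U ω) (V ω) ∂P - B (∫ ω, U ω ∂P) (∫ ω, V ω ∂P) with hκ
  have hI : 0 ≤ ∫ ω, ‖U ω‖ ^ 4 ∂P := integral_nonneg fun ω => by positivity
  have hJ : 0 ≤ ∫ ω, ‖V ω‖ ^ 4 ∂P := integral_nonneg fun ω => by positivity
  by_cases h0 : ‖κ‖ = 0
  · rw [h0]; positivity
  set k := ‖κ‖⁻¹ • κ with hk
  have hk1 : ‖k‖ = 1 := by rw [hk, norm_smul, norm_inv, norm_norm, inv_mul_cancel₀ h0]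
  -- The norm of `κ` is its inner product with the unit vector `k`. The contraction `A` with `⟪A x,
  -- y⟫ = ⟪k, B x y⟫` turns this into a covariance of `A U` and `V` for the inner product.
  set A : H → H := fun x => (InnerProductSpace.toDual ℝ H).symm ((innerSL ℝ k).comp (B x)) with hA
  have hAi : ∀ x y, ⟪A x, y⟫ = ⟪k, B x y⟫ := fun x y => by
    simp [hA, InnerProductSpace.toDual_symm_apply]
  have hAc : Continuous A := by
    refine (LinearIsometryEquiv.continuous _).comp ?_
    exact (continuous_const.clm_comp B.continuous)
  have hAn : ∀ x, ‖A x‖ ≤ ‖x‖ := by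
    intro x
    rw [hA]
    simp only [LinearIsometryEquiv.norm_map]
    refine ContinuousLinearMap.opNorm_le_bound _ (norm_nonneg _) fun y => ?_
    simp only [ContinuousLinearMap.comp_apply, innerSL_apply_apply]
    refine (norm_inner_le_norm _ _).trans ?_
    rw [hk1, one_mul, hB.norm_apply]
  have hAU : AEStronglyMeasurable[𝓕] (fun ω => A (U ω)) P := hAc.comp_aestronglyMeasurable hU
  have hAU4 : Integrable (fun ω => ‖A (U ω)‖ ^ 4) P := by
    refine Integrable.mono' hU4 ((by fun_prop : Continuous fun y : H => ‖y‖ ^ 4)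
      |>.comp_aestronglyMeasurable (hAU.mono h𝓕)) (Eventually.of_forall fun ω => ?_)
    rw [norm_pow, norm_norm]
    exact pow_le_pow_left₀ (norm_nonneg _) (hAn _) 4
  have hAUi := integrable_of_integrable_norm_pow (hAU.mono h𝓕) (by norm_num : 1 ≤ 4) hAU4
  have main := abs_integral_inner_sub_le h𝓕 h𝓖 hβ hmix hAU hV hAU4 hV4
  have e1 : ∫ ω, ⟪A (U ω), V ω⟫ ∂P = ⟪k, ∫ ω, B (U ω) (V ω) ∂P⟫ := by
    simp_rw [hAi]
    exact integral_inner hUV k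
  have e2 : ∀ v, ⟪∫ ω, A (U ω) ∂P, v⟫ = ⟪k, B (∫ ω, U ω ∂P) v⟫ := by
    intro v
    rw [real_inner_comm, ← integral_inner hAUi]
    simp_rw [real_inner_comm _ v, hAi]
    have := (((innerSL ℝ k).comp (B.flip v))).integral_comp_comm hUi
    simpa using this
  have e3 : ∫ ω, ⟪A (U ω), V ω⟫ ∂P - ⟪∫ ω, A (U ω) ∂P, ∫ ω, V ω ∂P⟫ = ‖κ‖ := by
    rw [e1, e2, ← inner_sub_right, ← hκ, hk, real_inner_smul_left, real_inner_self_eq_norm_sq]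
    field_simp
  rw [e3, abs_norm] at main
  refine main.trans ?_
  have hle : ∫ ω, ‖A (U ω)‖ ^ 4 ∂P ≤ ∫ ω, ‖U ω‖ ^ 4 ∂P :=
    integral_mono hAU4 hU4 fun ω => pow_le_pow_left₀ (norm_nonneg _) (hAn _) 4
  gcongr

end Tensor

/-! ### Integrated fourth order cumulants across a mixing gap -/

section Cumulants

open scoped RealInnerProductSpace

variable {H K : Type*} [NormedAddCommGroup H] [InnerProductSpace ℝ H]
  [NormedAddCommGroup K] [InnerProductSpace ℝ K]
  {Ω : Type*} {𝓕 𝓖 : MeasurableSpace Ω} {mΩ : MeasurableSpace Ω} {P : Measure Ω}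

/-- A centred random element of `H` whose twelfth moment is at most `M`. -/
structure IsCentredBounded (P : Measure Ω) (M : ℝ) (x : Ω → H) : Prop where
  meas : AEStronglyMeasurable x P
  int : Integrable (fun ω => ‖x ω‖ ^ 12) P
  mom : ∫ ω, ‖x ω‖ ^ 12 ∂P ≤ M
  mean : ∫ ω, x ω ∂P = 0

namespace IsCentredBounded

variable {M : ℝ} {x y z u : Ω → H}

/-- When one of four variables is isolated, the covariance inequality asks for the fourth moment of
a product of the other three; this is why twelfth moments are required. -/
lemma integrable_of_norm_le_mul_mul {F : Type*} [NormedAddCommGroup F] {U : Ω → F}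
    (hx : IsCentredBounded P M x) (hy : IsCentredBounded P M y) (hz : IsCentredBounded P M z)
    (hU : AEStronglyMeasurable U P) (h : ∀ ω, ‖U ω‖ ≤ ‖x ω‖ * ‖y ω‖ * ‖z ω‖) :
    Integrable (fun ω => ‖U ω‖ ^ 4) P ∧ ∫ ω, ‖U ω‖ ^ 4 ∂P ≤ 3 * M := by
  have h3 : ∀ a b c : ℝ, 0 ≤ a → 0 ≤ b → 0 ≤ c → a * b * c ≤ a ^ 3 + b ^ 3 + c ^ 3 := by
    intro a b c ha hb hc
    nlinarith [mul_nonneg (add_nonneg (add_nonneg ha hb) hc)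
      (add_nonneg (add_nonneg (sq_nonneg (a - b)) (sq_nonneg (b - c))) (sq_nonneg (a - c))),
      pow_nonneg ha 3, pow_nonneg hb 3, pow_nonneg hc 3]
  have h4 : ∀ ω, ‖U ω‖ ^ 4 ≤ ‖x ω‖ ^ 12 + ‖y ω‖ ^ 12 + ‖z ω‖ ^ 12 := by
    intro ω
    calc ‖U ω‖ ^ 4 ≤ (‖x ω‖ * ‖y ω‖ * ‖z ω‖) ^ 4 := pow_le_pow_left₀ (norm_nonneg _) (h ω) 4
      _ = ‖x ω‖ ^ 4 * ‖y ω‖ ^ 4 * ‖z ω‖ ^ 4 := by ring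
      _ ≤ _ := by
        have := h3 (‖x ω‖ ^ 4) (‖y ω‖ ^ 4) (‖z ω‖ ^ 4) (by positivity) (by positivity)
          (by positivity)
        simpa only [← pow_mul] using this
  have i12 := (hx.int.add hy.int).add hz.int
  have hU4 : Integrable (fun ω => ‖U ω‖ ^ 4) P := Integrable.mono' i12
    ((by fun_prop : Continuous fun y : F => ‖y‖ ^ 4).comp_aestronglyMeasurable hU)
    (Eventually.of_forall fun ω => by rw [norm_pow, norm_norm]; exact h4 ω)
  refine ⟨hU4, (integral_mono hU4 i12 h4).trans ?_⟩
  rw [integral_add' (hx.int.add hy.int) hz.int, integral_add' hx.int hy.int]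
  linarith [hx.mom, hy.mom, hz.mom]

lemma aesm_inner (hx : IsCentredBounded P M x) (hy : IsCentredBounded P M y) :
    AEStronglyMeasurable (fun ω => ⟪x ω, y ω⟫) P := hx.meas.inner hy.meas

lemma aesm_tensor {B : H →L[ℝ] H →L[ℝ] K} {𝓕 : MeasurableSpace Ω}
    (hx : AEStronglyMeasurable[𝓕] x P) (hy : AEStronglyMeasurable[𝓕] y P) :
    AEStronglyMeasurable[𝓕] (fun ω => B (x ω) (y ω)) P :=
  (by fun_prop : Continuous fun z : H × H => B z.1 z.2).comp_aestronglyMeasurable (hx.prodMk hy)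

variable [IsProbabilityMeasure P]

lemma int_pow (hx : IsCentredBounded P M x) {j : ℕ} (hj : j ≤ 12) :
    Integrable (fun ω => ‖x ω‖ ^ j) P :=
  integrable_norm_pow_of_le hx.meas hj hx.int

lemma mom_pow (hx : IsCentredBounded P M x) (hM : 1 ≤ M) {j : ℕ} (hj : j ≤ 12) :
    ∫ ω, ‖x ω‖ ^ j ∂P ≤ 2 * M := by
  calc ∫ ω, ‖x ω‖ ^ j ∂P ≤ ∫ ω, (‖x ω‖ ^ 12 + 1) ∂P := by
        refine integral_mono (hx.int_pow hj) (hx.int.add (integrable_const 1)) fun ω => ?_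
        simp only
        rcases le_total 1 ‖x ω‖ with h1 | h1
        · linarith [pow_le_pow_right₀ h1 hj]
        · linarith [pow_le_one₀ (n := j) (norm_nonneg _) h1, pow_nonneg (norm_nonneg (x ω)) 12]
    _ ≤ 2 * M := by
        rw [integral_add hx.int (integrable_const 1)]
        simp only [integral_const, probReal_univ, smul_eq_mul, mul_one]
        linarith [hx.mom]

lemma integrable_of_norm_le_mul {F : Type*} [NormedAddCommGroup F] {U : Ω → F}
    (hx : IsCentredBounded P M x) (hy : IsCentredBounded P M y)
    (hU : AEStronglyMeasurable U P) (h : ∀ ω, ‖U ω‖ ≤ ‖x ω‖ * ‖y ω‖) (hM : 1 ≤ M) :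
    (Integrable U P ∧ ∫ ω, ‖U ω‖ ∂P ≤ 4 * M) ∧
      Integrable (fun ω => ‖U ω‖ ^ 4) P ∧ ∫ ω, ‖U ω‖ ^ 4 ∂P ≤ 4 * M := by
  have h2 : ∀ a b : ℝ, a * b ≤ a ^ 2 + b ^ 2 := fun a b => by
    nlinarith [sq_nonneg (a - b), sq_nonneg a, sq_nonneg b]
  have h4 : ∀ ω, ‖U ω‖ ^ 4 ≤ ‖x ω‖ ^ 8 + ‖y ω‖ ^ 8 := by
    intro ω
    calc ‖U ω‖ ^ 4 ≤ (‖x ω‖ * ‖y ω‖) ^ 4 := pow_le_pow_left₀ (norm_nonneg _) (h ω) 4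
      _ = ‖x ω‖ ^ 4 * ‖y ω‖ ^ 4 := by ring
      _ ≤ _ := by
        have := h2 (‖x ω‖ ^ 4) (‖y ω‖ ^ 4)
        simpa only [← pow_mul] using this
  have i2 := (hx.int_pow (by norm_num : 2 ≤ 12)).add (hy.int_pow (by norm_num : 2 ≤ 12))
  have i8 := (hx.int_pow (by norm_num : 8 ≤ 12)).add (hy.int_pow (by norm_num : 8 ≤ 12))
  have hUi : Integrable U P := Integrable.mono' i2 hU
    (Eventually.of_forall fun ω => (h ω).trans (h2 _ _))
  have hU4 : Integrable (fun ω => ‖U ω‖ ^ 4) P := Integrable.mono' i8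
    ((by fun_prop : Continuous fun y : F => ‖y‖ ^ 4).comp_aestronglyMeasurable hU)
    (Eventually.of_forall fun ω => by rw [norm_pow, norm_norm]; exact h4 ω)
  refine ⟨⟨hUi, ?_⟩, hU4, ?_⟩
  · refine (integral_mono hUi.norm i2 fun ω => (h ω).trans (h2 _ _)).trans ?_
    rw [integral_add' (hx.int_pow (by norm_num)) (hy.int_pow (by norm_num))]
    linarith [hx.mom_pow hM (by norm_num : 2 ≤ 12), hy.mom_pow hM (by norm_num : 2 ≤ 12)]
  · refine (integral_mono hU4 i8 h4).trans ?_
    rw [integral_add' (hx.int_pow (by norm_num)) (hy.int_pow (by norm_num))]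
    linarith [hx.mom_pow hM (by norm_num : 8 ≤ 12), hy.mom_pow hM (by norm_num : 8 ≤ 12)]

lemma abs_integral_inner_le (hx : IsCentredBounded P M x) (hy : IsCentredBounded P M y)
    (hM : 1 ≤ M) : |∫ ω, ⟪x ω, y ω⟫ ∂P| ≤ 4 * M := by
  have := (integrable_of_norm_le_mul hx hy (hx.aesm_inner hy)
    (fun ω => norm_inner_le_norm _ _) hM).1.2
  exact (norm_integral_le_integral_norm _).trans this

lemma norm_integral_tensor_le {B : H →L[ℝ] H →L[ℝ] K} (hB : IsTensor B)
    (hx : IsCentredBounded P M x) (hy : IsCentredBounded P M y)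
    (hM : 1 ≤ M) : ‖∫ ω, B (x ω) (y ω) ∂P‖ ≤ 4 * M := by
  have := (integrable_of_norm_le_mul hx hy (aesm_tensor (B := B) hx.meas hy.meas)
    (fun ω => (hB.norm_apply _ _).le) hM).1.2
  exact (norm_integral_le_integral_norm _).trans this

lemma abs_integral_inner_le_of_mixBound [CompleteSpace H] [SecondCountableTopology H]
    (hx : IsCentredBounded P M x) (hy : IsCentredBounded P M y)
    (hM : 1 ≤ M) (h𝓕 : 𝓕 ≤ mΩ) (h𝓖 : 𝓖 ≤ mΩ) {β : ℝ} (hβ : 0 < β)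
    (hmix : MixBound P 𝓕 𝓖 (β ^ 2)) (hxm : AEStronglyMeasurable[𝓕] x P)
    (hym : AEStronglyMeasurable[𝓖] y P) : |∫ ω, ⟪x ω, y ω⟫ ∂P| ≤ 52 * M * β := by
  have := abs_integral_inner_sub_le h𝓕 h𝓖 hβ hmix hxm hym (hx.int_pow (by norm_num))
    (hy.int_pow (by norm_num))
  rw [hx.mean, inner_zero_left, sub_zero] at this
  have h1 := hx.mom_pow hM (by norm_num : 4 ≤ 12)
  have h2 := hy.mom_pow hM (by norm_num : 4 ≤ 12)
  nlinarith

lemma norm_integral_tensor_le_of_mixBound [CompleteSpace H] [CompleteSpace K]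
    [SecondCountableTopology H] {B : H →L[ℝ] H →L[ℝ] K} (hB : IsTensor B)
    (hx : IsCentredBounded P M x) (hy : IsCentredBounded P M y)
    (hM : 1 ≤ M) (h𝓕 : 𝓕 ≤ mΩ) (h𝓖 : 𝓖 ≤ mΩ) {β : ℝ} (hβ : 0 < β)
    (hmix : MixBound P 𝓕 𝓖 (β ^ 2)) (hxm : AEStronglyMeasurable[𝓕] x P)
    (hym : AEStronglyMeasurable[𝓖] y P) : ‖∫ ω, B (x ω) (y ω) ∂P‖ ≤ 52 * M * β := by
  have := norm_integral_tensor_sub_le hB h𝓕 h𝓖 hβ hmix hxm hym (hx.int_pow (by norm_num))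
    (hy.int_pow (by norm_num))
  rw [hx.mean, map_zero, zero_apply, sub_zero] at this
  have h1 := hx.mom_pow hM (by norm_num : 4 ≤ 12)
  have h2 := hy.mom_pow hM (by norm_num : 4 ≤ 12)
  nlinarith

end IsCentredBounded

/-- The integrated fourth order cumulant of `x₁(τ), x₂(φ), x₃(τ), x₄(φ)`. -/
noncomputable def cumFour (P : Measure Ω) (B : H →L[ℝ] H →L[ℝ] K) (x₁ x₂ x₃ x₄ : Ω → H) : ℝ :=
  ∫ ω, ⟪x₁ ω, x₃ ω⟫ * ⟪x₂ ω, x₄ ω⟫ ∂P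
    - ⟪∫ ω, B (x₁ ω) (x₂ ω) ∂P, ∫ ω, B (x₃ ω) (x₄ ω) ∂P⟫
    - (∫ ω, ⟪x₁ ω, x₃ ω⟫ ∂P) * (∫ ω, ⟪x₂ ω, x₄ ω⟫ ∂P)
    - ⟪∫ ω, B (x₁ ω) (x₄ ω) ∂P, ∫ ω, B (x₃ ω) (x₂ ω) ∂P⟫

/-- The variables 1 and 3 share the argument `τ`, and 2 and 4 share `φ`. Exchanges inside these
pairs reduce all separations of the four variables to four patterns: `1|234`, `2|134`, `13|24` and
`12|34`. -/
lemma cumFour_swap_left (B : H →L[ℝ] H →L[ℝ] K) (x₁ x₂ x₃ x₄ : Ω → H) :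
    cumFour P B x₃ x₂ x₁ x₄ = cumFour P B x₁ x₂ x₃ x₄ := by
  simp only [cumFour, real_inner_comm (x₃ _) (x₁ _),
    real_inner_comm (∫ ω, B (x₃ ω) (x₂ ω) ∂P), real_inner_comm (∫ ω, B (x₃ ω) (x₄ ω) ∂P)]
  ring

lemma cumFour_swap_right (B : H →L[ℝ] H →L[ℝ] K) (x₁ x₂ x₃ x₄ : Ω → H) :
    cumFour P B x₁ x₄ x₃ x₂ = cumFour P B x₁ x₂ x₃ x₄ := by
  simp only [cumFour, real_inner_comm (x₄ _) (x₂ _)]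
  ring

variable [IsProbabilityMeasure P] {M β : ℝ} {x₁ x₂ x₃ x₄ : Ω → H} {B : H →L[ℝ] H →L[ℝ] K}

lemma abs_mul_le_of_le {a b A C : ℝ} (ha : |a| ≤ A) (hb : |b| ≤ C) : |a * b| ≤ A * C := by
  rw [abs_mul]; exact mul_le_mul ha hb (abs_nonneg _) ((abs_nonneg _).trans ha)

lemma abs_inner_le_of_le {a b : K} {A C : ℝ} (ha : ‖a‖ ≤ A) (hb : ‖b‖ ≤ C) :
    |⟪a, b⟫| ≤ A * C :=
  (abs_real_inner_le_norm a b).trans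
    (mul_le_mul ha hb (norm_nonneg _) ((norm_nonneg _).trans ha))

lemma abs_le_of_four {a b c d A : ℝ} (h₁ : |a| ≤ A) {b' c' d' : ℝ} (h₂ : |b| ≤ b')
    (h₃ : |c| ≤ c') (h₄ : |d| ≤ d') : |a - b - c - d| ≤ A + b' + c' + d' := by
  rw [abs_le] at *
  constructor <;> linarith

variable [CompleteSpace H] [CompleteSpace K] [SecondCountableTopology H]

/-- The product moment is the mean of `⟪x₁, ⟪x₂, x₄⟫ x₃⟫`, an inner product across the gap whose
first factor is centred. Each of the three pairings contains a covariance of `x₁` with a variable on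
the other side. -/
lemma abs_cumFour_le_first (hB : IsTensor B) (hM : 1 ≤ M)
    (h₁ : IsCentredBounded P M x₁)
    (h₂ : IsCentredBounded P M x₂) (h₃ : IsCentredBounded P M x₃) (h₄ : IsCentredBounded P M x₄)
    (h𝓕 : 𝓕 ≤ mΩ) (h𝓖 : 𝓖 ≤ mΩ) (hβ : 0 < β) (hmix : MixBound P 𝓕 𝓖 (β ^ 2))
    (m₁ : AEStronglyMeasurable[𝓕] x₁ P) (m₂ : AEStronglyMeasurable[𝓖] x₂ P)
    (m₃ : AEStronglyMeasurable[𝓖] x₃ P) (m₄ : AEStronglyMeasurable[𝓖] x₄ P) :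
    |cumFour P B x₁ x₂ x₃ x₄| ≤ 700 * M ^ 2 * β := by
  have hV : AEStronglyMeasurable[𝓖] (fun ω => ⟪x₂ ω, x₄ ω⟫ • x₃ ω) P := (m₂.inner m₄).smul m₃
  have hV4 := IsCentredBounded.integrable_of_norm_le_mul_mul h₂ h₄ h₃ (hV.mono h𝓖) fun ω => by
    rw [norm_smul]
    exact mul_le_mul_of_nonneg_right (norm_inner_le_norm _ _) (norm_nonneg _)
  have e := abs_integral_inner_sub_le h𝓕 h𝓖 hβ hmix m₁ hV (h₁.int_pow (by norm_num)) hV4.1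
  rw [h₁.mean, inner_zero_left, sub_zero] at e
  simp only [real_inner_smul_right, mul_comm ⟪x₂ _, x₄ _⟫] at e
  refine (abs_le_of_four e
    (abs_inner_le_of_le (h₁.norm_integral_tensor_le_of_mixBound hB h₂ hM h𝓕 h𝓖 hβ hmix m₁ m₂)
      (h₃.norm_integral_tensor_le hB h₄ hM))
    (abs_mul_le_of_le (h₁.abs_integral_inner_le_of_mixBound h₃ hM h𝓕 h𝓖 hβ hmix m₁ m₃)
      (h₂.abs_integral_inner_le h₄ hM))
    (abs_inner_le_of_le (h₁.norm_integral_tensor_le_of_mixBound hB h₄ hM h𝓕 h𝓖 hβ hmix m₁ m₄)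
      (h₃.norm_integral_tensor_le hB h₂ hM))).trans ?_
  have b1 := h₁.mom_pow hM (by norm_num : 4 ≤ 12)
  have b2 := hV4.2
  have b3 : M * β ≤ M ^ 2 * β := mul_le_mul_of_nonneg_right (by nlinarith) hβ.le
  have b4 : β ≤ M * β := by nlinarith
  nlinarith

lemma abs_cumFour_le_second (hB : IsTensor B) (hM : 1 ≤ M)
    (h₁ : IsCentredBounded P M x₁)
    (h₂ : IsCentredBounded P M x₂) (h₃ : IsCentredBounded P M x₃) (h₄ : IsCentredBounded P M x₄)
    (h𝓕 : 𝓕 ≤ mΩ) (h𝓖 : 𝓖 ≤ mΩ) (hβ : 0 < β) (hmix : MixBound P 𝓕 𝓖 (β ^ 2))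
    (m₁ : AEStronglyMeasurable[𝓖] x₁ P) (m₂ : AEStronglyMeasurable[𝓕] x₂ P)
    (m₃ : AEStronglyMeasurable[𝓖] x₃ P) (m₄ : AEStronglyMeasurable[𝓖] x₄ P) :
    |cumFour P B x₁ x₂ x₃ x₄| ≤ 700 * M ^ 2 * β := by
  have hV : AEStronglyMeasurable[𝓖] (fun ω => ⟪x₁ ω, x₃ ω⟫ • x₄ ω) P := (m₁.inner m₃).smul m₄
  have hV4 := IsCentredBounded.integrable_of_norm_le_mul_mul h₁ h₃ h₄ (hV.mono h𝓖) fun ω => by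
    rw [norm_smul]
    exact mul_le_mul_of_nonneg_right (norm_inner_le_norm _ _) (norm_nonneg _)
  have e := abs_integral_inner_sub_le h𝓕 h𝓖 hβ hmix m₂ hV (h₂.int_pow (by norm_num)) hV4.1
  rw [h₂.mean, inner_zero_left, sub_zero] at e
  simp only [real_inner_smul_right] at e
  refine (abs_le_of_four e
    (abs_inner_le_of_le (h₁.norm_integral_tensor_le_of_mixBound hB h₂ hM h𝓖 h𝓕 hβ hmix.symm m₁ m₂)
      (h₃.norm_integral_tensor_le hB h₄ hM))
    (abs_mul_le_of_le (h₁.abs_integral_inner_le h₃ hM)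
      (h₂.abs_integral_inner_le_of_mixBound h₄ hM h𝓕 h𝓖 hβ hmix m₂ m₄))
    (abs_inner_le_of_le (h₁.norm_integral_tensor_le hB h₄ hM)
      (h₃.norm_integral_tensor_le_of_mixBound hB h₂ hM h𝓖 h𝓕 hβ hmix.symm m₃ m₂))).trans ?_
  have b1 := h₂.mom_pow hM (by norm_num : 4 ≤ 12)
  have b2 := hV4.2
  have b3 : M * β ≤ M ^ 2 * β := mul_le_mul_of_nonneg_right (by nlinarith) hβ.le
  have b4 : β ≤ M * β := by nlinarith
  nlinarith

/-- Here the product of the two traces does not decay; subtracting it makes the product moment a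
covariance of the real variables `⟪x₁, x₃⟫` and `⟪x₂, x₄⟫`. The other two pairings cross the gap. -/
lemma abs_cumFour_le_outer [SecondCountableTopology K] (hB : IsTensor B) (hM : 1 ≤ M)
    (h₁ : IsCentredBounded P M x₁)
    (h₂ : IsCentredBounded P M x₂) (h₃ : IsCentredBounded P M x₃) (h₄ : IsCentredBounded P M x₄)
    (h𝓕 : 𝓕 ≤ mΩ) (h𝓖 : 𝓖 ≤ mΩ) (hβ : 0 < β) (hmix : MixBound P 𝓕 𝓖 (β ^ 2))
    (m₁ : AEStronglyMeasurable[𝓕] x₁ P) (m₂ : AEStronglyMeasurable[𝓖] x₂ P)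
    (m₃ : AEStronglyMeasurable[𝓕] x₃ P) (m₄ : AEStronglyMeasurable[𝓖] x₄ P) :
    |cumFour P B x₁ x₂ x₃ x₄| ≤ 700 * M ^ 2 * β := by
  have hU4 := (IsCentredBounded.integrable_of_norm_le_mul h₁ h₃ (h₁.aesm_inner h₃)
    (fun ω => norm_inner_le_norm _ _) hM).2
  have hV4 := (IsCentredBounded.integrable_of_norm_le_mul h₂ h₄ (h₂.aesm_inner h₄)
    (fun ω => norm_inner_le_norm _ _) hM).2
  have e := abs_integral_inner_sub_le h𝓕 h𝓖 hβ hmix (m₁.inner m₃) (m₂.inner m₄) hU4.1 hV4.1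
  simp only [RCLike.inner_apply, conj_trivial] at e
  simp only [mul_comm ⟪x₂ _, x₄ _⟫, mul_comm (∫ ω, ⟪x₂ ω, x₄ ω⟫ ∂P)] at e
  have e' := abs_le_of_four e
    (abs_inner_le_of_le (h₁.norm_integral_tensor_le_of_mixBound hB h₂ hM h𝓕 h𝓖 hβ hmix m₁ m₂)
      (h₃.norm_integral_tensor_le hB h₄ hM))
    -- The slot of the trace pairing is zero because `e` has already absorbed that pairing.
    (abs_zero (α := ℝ)).le
    (abs_inner_le_of_le (h₁.norm_integral_tensor_le_of_mixBound hB h₄ hM h𝓕 h𝓖 hβ hmix m₁ m₄)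
      (h₃.norm_integral_tensor_le hB h₂ hM))
  have b3 : M * β ≤ M ^ 2 * β := mul_le_mul_of_nonneg_right (by nlinarith) hβ.le
  have b4 : β ≤ M * β := by nlinarith
  refine le_trans (le_of_eq ?_) (e'.trans ?_)
  · congr 1
    rw [cumFour]
    ring
  · nlinarith [hU4.2, hV4.2]

/-- The tensor identity writes the product moment as the mean of `⟪B x₁ x₂, B x₃ x₄⟫`. With the
first pairing subtracted this is a covariance in `K` across the gap; the remaining pairings cross it
as well. -/
lemma abs_cumFour_le_adjacent [SecondCountableTopology K] (hB : IsTensor B) (hM : 1 ≤ M)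
    (h₁ : IsCentredBounded P M x₁)
    (h₂ : IsCentredBounded P M x₂) (h₃ : IsCentredBounded P M x₃) (h₄ : IsCentredBounded P M x₄)
    (h𝓕 : 𝓕 ≤ mΩ) (h𝓖 : 𝓖 ≤ mΩ) (hβ : 0 < β) (hmix : MixBound P 𝓕 𝓖 (β ^ 2))
    (m₁ : AEStronglyMeasurable[𝓕] x₁ P) (m₂ : AEStronglyMeasurable[𝓕] x₂ P)
    (m₃ : AEStronglyMeasurable[𝓖] x₃ P) (m₄ : AEStronglyMeasurable[𝓖] x₄ P) :
    |cumFour P B x₁ x₂ x₃ x₄| ≤ 700 * M ^ 2 * β := by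
  have hU4 := (IsCentredBounded.integrable_of_norm_le_mul h₁ h₂
    (IsCentredBounded.aesm_tensor (B := B) h₁.meas h₂.meas)
    (fun ω => (hB.norm_apply _ _).le) hM).2
  have hV4 := (IsCentredBounded.integrable_of_norm_le_mul h₃ h₄
    (IsCentredBounded.aesm_tensor (B := B) h₃.meas h₄.meas)
    (fun ω => (hB.norm_apply _ _).le) hM).2
  have e := abs_integral_inner_sub_le h𝓕 h𝓖 hβ hmix
    (IsCentredBounded.aesm_tensor (B := B) m₁ m₂) (IsCentredBounded.aesm_tensor (B := B) m₃ m₄)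
    hU4.1 hV4.1
  simp only [hB _ _ _ _] at e
  have e' := abs_le_of_four e (abs_zero (α := ℝ)).le
    (abs_mul_le_of_le (h₁.abs_integral_inner_le_of_mixBound h₃ hM h𝓕 h𝓖 hβ hmix m₁ m₃)
      (h₂.abs_integral_inner_le h₄ hM))
    (abs_inner_le_of_le (h₁.norm_integral_tensor_le_of_mixBound hB h₄ hM h𝓕 h𝓖 hβ hmix m₁ m₄)
      (h₃.norm_integral_tensor_le hB h₂ hM))
  have b3 : M * β ≤ M ^ 2 * β := mul_le_mul_of_nonneg_right (by nlinarith) hβ.le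
  have b4 : β ≤ M * β := by nlinarith
  rw [sub_zero] at e'
  refine e'.trans ?_
  nlinarith [hU4.2, hV4.2]

end Cumulants

/-! ### Exponential decay of covariances and cumulants of mixing sequences -/

section MixingSequences

open scoped RealInnerProductSpace

variable {H K : Type*} [NormedAddCommGroup H] [InnerProductSpace ℝ H]
  [NormedAddCommGroup K] [InnerProductSpace ℝ K]
  {Ω : Type*} {mΩ : MeasurableSpace Ω} {P : Measure Ω}

/-- A centred sequence with bounded twelfth moments and exponentially decaying strong mixing
coefficients, with respect to given past and future σ-fields. -/
structure IsMixingSeq (P : Measure Ω) (past future : ℤ → MeasurableSpace Ω) (M β ρ : ℝ)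
    (x : ℤ → Ω → H) : Prop where
  past_le : ∀ s, past s ≤ mΩ
  future_le : ∀ s, future s ≤ mΩ
  meas_past : ∀ s t, t ≤ s → AEStronglyMeasurable[past s] (x t) P
  meas_future : ∀ s t, s ≤ t → AEStronglyMeasurable[future s] (x t) P
  -- The square compensates the square root lost in the covariance inequality. The ninth power
  -- compensates that the usable gap may be only a ninth of the total spread of four times.
  mix : ∀ (s : ℤ) (k : ℕ), MixBound P (past s) (future (s + k)) ((β * (ρ ^ 9) ^ k) ^ 2)
  bdd : ∀ t, IsCentredBounded P M (x t)

/-- One of the three consecutive gaps has at least a third of the length `d - a`, hence at least `N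
/ 9`. -/
lemma exists_gap_of_sorted {a b c d : ℤ} {N : ℕ} (hab : a ≤ b) (hbc : b ≤ c) (hcd : c ≤ d)
    (hN : 0 < N) (h : (N : ℤ) ≤ 3 * (d - a)) :
    ∃ (s : ℤ) (g : ℕ), 0 < g ∧ N ≤ 9 * g ∧ a ≤ s ∧ (b ≤ s ∨ s + g ≤ b) ∧ (c ≤ s ∨ s + g ≤ c) ∧
      s + g ≤ d := by
  by_cases h1 : (N : ℤ) ≤ 9 * (b - a)
  · exact ⟨a, (b - a).toNat, by omega, by omega, by omega, by omega, by omega, by omega⟩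
  by_cases h2 : (N : ℤ) ≤ 9 * (c - b)
  · exact ⟨b, (c - b).toNat, by omega, by omega, by omega, by omega, by omega, by omega⟩
  · exact ⟨c, (d - c).toNat, by omega, by omega, by omega, by omega, by omega, by omega⟩

/-- Four integers can be separated by a gap that is comparable to their spread. -/
lemma exists_gap (t : Fin 4 → ℤ) {N : ℕ}
    (hN : N = (t 1 - t 0).natAbs + (t 2 - t 0).natAbs + (t 3 - t 0).natAbs) (h0 : 0 < N) :
    ∃ (s : ℤ) (g : ℕ), 0 < g ∧ N ≤ 9 * g ∧ (∀ i, t i ≤ s ∨ s + g ≤ t i) ∧ (∃ i, t i ≤ s) ∧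
      ∃ i, s + g ≤ t i := by
  have hmono : Monotone (t ∘ Tuple.sort t) := Tuple.monotone_sort t
  set π := Tuple.sort t
  have hlo : ∀ i, t (π 0) ≤ t i := fun i => by
    simpa using hmono (Fin.zero_le (π.symm i))
  have hhi : ∀ i, t i ≤ t (π 3) := fun i => by
    simpa using hmono (Fin.le_last (π.symm i))
  obtain ⟨s, g, hg, hNg, e1, e2, e3, e4⟩ := exists_gap_of_sorted
    (hmono (by decide : (0 : Fin 4) ≤ 1)) (hmono (by decide : (1 : Fin 4) ≤ 2))
    (hmono (by decide : (2 : Fin 4) ≤ 3)) h0 (by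
      simp only [Function.comp_apply]
      have := hlo 0; have := hlo 1; have := hlo 2; have := hlo 3
      have := hhi 0; have := hhi 1; have := hhi 2; have := hhi 3
      omega)
  refine ⟨s, g, hg, hNg, fun i => ?_, ⟨_, e1⟩, ⟨_, e4⟩⟩
  obtain ⟨j, rfl⟩ := π.surjective i
  fin_cases j
  exacts [Or.inl e1, e2, e3, Or.inr e4]

variable [IsProbabilityMeasure P] [CompleteSpace H] [CompleteSpace K]
  [SecondCountableTopology H] {past future : ℤ → MeasurableSpace Ω} {M β ρ : ℝ}
  {x : ℤ → Ω → H} {B : H →L[ℝ] H →L[ℝ] K}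

lemma pow_nine_pow_le (h0 : 0 < ρ) (h1 : ρ < 1) (k : ℕ) : (ρ ^ 9) ^ k ≤ ρ ^ k :=
  pow_le_pow_left₀ (by positivity) (pow_le_of_le_one h0.le h1.le (by norm_num)) k

lemma IsMixingSeq.abs_integral_inner_le (hx : IsMixingSeq P past future M β ρ x) (hM : 1 ≤ M)
    (hβ : 0 < β) (h0 : 0 < ρ) (h1 : ρ < 1) (s t : ℤ) :
    |∫ ω, ⟪x s ω, x t ω⟫ ∂P| ≤ 52 * M * β * ρ ^ (t - s).natAbs := by
  have hpow : ∀ k : ℕ, 52 * M * (β * (ρ ^ 9) ^ k) ≤ 52 * M * β * ρ ^ k := fun k => by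
    rw [mul_assoc (52 * M)]
    have := pow_nine_pow_le h0 h1 k
    exact mul_le_mul_of_nonneg_left (mul_le_mul_of_nonneg_left this hβ.le) (by positivity)
  refine le_trans ?_ (hpow _)
  rcases le_total s t with h | h
  · have := hx.mix s (t - s).natAbs
    rw [show s + ((t - s).natAbs : ℤ) = t by omega] at this
    exact (hx.bdd s).abs_integral_inner_le_of_mixBound (hx.bdd t) hM (hx.past_le s)
      (hx.future_le t) (by positivity) this (hx.meas_past s s le_rfl) (hx.meas_future t t le_rfl)
  · have := (hx.mix t (t - s).natAbs).symm
    rw [show t + ((t - s).natAbs : ℤ) = s by omega] at this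
    exact (hx.bdd s).abs_integral_inner_le_of_mixBound (hx.bdd t) hM (hx.future_le s)
      (hx.past_le t) (by positivity) this (hx.meas_future s s le_rfl) (hx.meas_past t t le_rfl)

lemma IsMixingSeq.norm_integral_tensor_le (hx : IsMixingSeq P past future M β ρ x)
    (hB : IsTensor B) (hM : 1 ≤ M) (hβ : 0 < β) (h0 : 0 < ρ) (h1 : ρ < 1) (s t : ℤ) :
    ‖∫ ω, B (x s ω) (x t ω) ∂P‖ ≤ 52 * M * β * ρ ^ (t - s).natAbs := by
  have hpow : ∀ k : ℕ, 52 * M * (β * (ρ ^ 9) ^ k) ≤ 52 * M * β * ρ ^ k := fun k => by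
    rw [mul_assoc (52 * M)]
    have := pow_nine_pow_le h0 h1 k
    exact mul_le_mul_of_nonneg_left (mul_le_mul_of_nonneg_left this hβ.le) (by positivity)
  refine le_trans ?_ (hpow _)
  rcases le_total s t with h | h
  · have := hx.mix s (t - s).natAbs
    rw [show s + ((t - s).natAbs : ℤ) = t by omega] at this
    exact (hx.bdd s).norm_integral_tensor_le_of_mixBound hB (hx.bdd t) hM (hx.past_le s)
      (hx.future_le t) (by positivity) this (hx.meas_past s s le_rfl) (hx.meas_future t t le_rfl)
  · have := (hx.mix t (t - s).natAbs).symm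
    rw [show t + ((t - s).natAbs : ℤ) = s by omega] at this
    exact (hx.bdd s).norm_integral_tensor_le_of_mixBound hB (hx.bdd t) hM (hx.future_le s)
      (hx.past_le t) (by positivity) this (hx.meas_future s s le_rfl) (hx.meas_past t t le_rfl)

/-- Fourth order cumulants of an exponentially mixing sequence decay exponentially. -/
theorem IsMixingSeq.abs_cumFour_le [SecondCountableTopology K]
    (hx : IsMixingSeq P past future M β ρ x)
    (hB : IsTensor B) (hM : 1 ≤ M) (hβ : 0 < β) (h0 : 0 < ρ) (h1 : ρ < 1) (a b c d : ℤ) :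
    |cumFour P B (x a) (x b) (x c) (x d)|
      ≤ 700 * M ^ 2 * β * ρ ^ ((b - a).natAbs + (c - a).natAbs + (d - a).natAbs) := by
  set N := (b - a).natAbs + (c - a).natAbs + (d - a).natAbs with hN
  -- If all times coincide there is no gap, and the mixing bound at distance 0 already suffices.
  rcases Nat.eq_zero_or_pos N with hz | hpos
  · obtain ⟨hb, hc, hd⟩ : b = a ∧ c = a ∧ d = a := by omega
    rw [hz, pow_zero, mul_one, hb, hc, hd]
    have := hx.mix a 0
    simp only [Nat.cast_zero, add_zero, pow_zero, mul_one] at this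
    exact abs_cumFour_le_first hB hM (hx.bdd a) (hx.bdd a) (hx.bdd a) (hx.bdd a) (hx.past_le a)
      (hx.future_le a) hβ this (hx.meas_past a a le_rfl) (hx.meas_future a a le_rfl)
      (hx.meas_future a a le_rfl) (hx.meas_future a a le_rfl)
  obtain ⟨s, g, hg, hNg, hsp, hlo, hhi⟩ :=
    exists_gap ![a, b, c, d] (N := N) (by simpa using hN) hpos
  simp only [Fin.forall_fin_succ, Fin.exists_fin_succ, Matrix.cons_val_zero, Matrix.cons_val_succ,
    IsEmpty.forall_iff, and_true, IsEmpty.exists_iff, or_false] at hsp hlo hhi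
  have hpow : 700 * M ^ 2 * (β * (ρ ^ 9) ^ g) ≤ 700 * M ^ 2 * β * ρ ^ N := by
    rw [mul_assoc (700 * M ^ 2), ← pow_mul]
    have : ρ ^ (9 * g) ≤ ρ ^ N := pow_le_pow_of_le_one h0.le h1.le hNg
    gcongr
  refine le_trans ?_ hpow
  have hb := hx.bdd
  have hp := hx.past_le s
  have hf := hx.future_le (s + g)
  have hβ' : 0 < β * (ρ ^ 9) ^ g := by positivity
  have mx := hx.mix s g
  have my := mx.symm
  have P1 : ∀ t, t ≤ s → AEStronglyMeasurable[past s] (x t) P := fun t => hx.meas_past s t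
  have F1 : ∀ t, s + g ≤ t → AEStronglyMeasurable[future (s + g)] (x t) P :=
    fun t => hx.meas_future (s + g) t
  obtain ⟨ha, hb', hc, hd⟩ := hsp
  have s1 := cumFour_swap_left (P := P) B (x a) (x b) (x c) (x d)
  have s2 := cumFour_swap_right (P := P) B (x a) (x b) (x c) (x d)
  -- Of the sixteen placements of the four times, the two with all times on one side are impossible.
  -- The others match one of the four patterns, up to a swap and the exchange of past and future.
  rcases ha with ha | ha <;> rcases hb' with hb' | hb' <;> rcases hc with hc | hc <;>
    rcases hd with hd | hd
  · exfalso; omega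
  · rw [← s2]
    exact abs_cumFour_le_second hB hM (hb _) (hb _) (hb _) (hb _) hf hp hβ' my (P1 _ ha) (F1 _ hd)
      (P1 _ hc) (P1 _ hb')
  · rw [← s1]
    exact abs_cumFour_le_first hB hM (hb _) (hb _) (hb _) (hb _) hf hp hβ' my (F1 _ hc) (P1 _ hb')
      (P1 _ ha) (P1 _ hd)
  · exact abs_cumFour_le_adjacent hB hM (hb _) (hb _) (hb _) (hb _) hp hf hβ' mx (P1 _ ha)
      (P1 _ hb') (F1 _ hc) (F1 _ hd)
  · exact abs_cumFour_le_second hB hM (hb _) (hb _) (hb _) (hb _) hf hp hβ' my (P1 _ ha)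
      (F1 _ hb') (P1 _ hc) (P1 _ hd)
  · exact abs_cumFour_le_outer hB hM (hb _) (hb _) (hb _) (hb _) hp hf hβ' mx (P1 _ ha)
      (F1 _ hb') (P1 _ hc) (F1 _ hd)
  · rw [← s2]
    exact abs_cumFour_le_adjacent hB hM (hb _) (hb _) (hb _) (hb _) hp hf hβ' mx (P1 _ ha)
      (P1 _ hd) (F1 _ hc) (F1 _ hb')
  · exact abs_cumFour_le_first hB hM (hb _) (hb _) (hb _) (hb _) hp hf hβ' mx (P1 _ ha)
      (F1 _ hb') (F1 _ hc) (F1 _ hd)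
  · exact abs_cumFour_le_first hB hM (hb _) (hb _) (hb _) (hb _) hf hp hβ' my (F1 _ ha)
      (P1 _ hb') (P1 _ hc) (P1 _ hd)
  · rw [← s2]
    exact abs_cumFour_le_adjacent hB hM (hb _) (hb _) (hb _) (hb _) hf hp hβ' my (F1 _ ha)
      (F1 _ hd) (P1 _ hc) (P1 _ hb')
  · exact abs_cumFour_le_outer hB hM (hb _) (hb _) (hb _) (hb _) hf hp hβ' my (F1 _ ha)
      (P1 _ hb') (F1 _ hc) (P1 _ hd)
  · exact abs_cumFour_le_second hB hM (hb _) (hb _) (hb _) (hb _) hp hf hβ' mx (F1 _ ha)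
      (P1 _ hb') (F1 _ hc) (F1 _ hd)
  · exact abs_cumFour_le_adjacent hB hM (hb _) (hb _) (hb _) (hb _) hf hp hβ' my (F1 _ ha)
      (F1 _ hb') (P1 _ hc) (P1 _ hd)
  · rw [← s1]
    exact abs_cumFour_le_first hB hM (hb _) (hb _) (hb _) (hb _) hp hf hβ' mx (P1 _ hc)
      (F1 _ hb') (F1 _ ha) (F1 _ hd)
  · rw [← s2]
    exact abs_cumFour_le_second hB hM (hb _) (hb _) (hb _) (hb _) hp hf hβ' mx (F1 _ ha)
      (P1 _ hd) (F1 _ hc) (F1 _ hb')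
  · exfalso; omega

end MixingSequences

/-! ### Summable lag weights -/

section Weights

/-- Exponentially decaying weights on the lags. -/
noncomputable def lagWeight (ρ : ℝ) (k : ℤ) : ℝ := ((k.natAbs : ℝ) + 2) ^ 2 * √ρ ^ k.natAbs

/-- The sum of the weights. -/
noncomputable def lagWeightSum (ρ : ℝ) : ℝ := ∑' k : ℤ, lagWeight ρ k

variable {ρ : ℝ}

lemma lagWeight_nonneg (k : ℤ) : 0 ≤ lagWeight ρ k := by unfold lagWeight; positivity

lemma lagWeightSum_nonneg : 0 ≤ lagWeightSum ρ := tsum_nonneg lagWeight_nonneg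

lemma sqrt_lt_one_of_lt_one (h1 : ρ < 1) : √ρ < 1 := by
  rw [Real.sqrt_lt' one_pos]; simpa using h1

lemma summable_lagWeight (h1 : ρ < 1) : Summable (lagWeight ρ) := by
  have hr : ‖√ρ‖ < 1 := by
    rw [Real.norm_of_nonneg (Real.sqrt_nonneg _)]; exact sqrt_lt_one_of_lt_one h1
  have h : Summable fun n : ℕ => ((n : ℝ) + 2) ^ 2 * √ρ ^ n := by
    have e : (fun n : ℕ => ((n : ℝ) + 2) ^ 2 * √ρ ^ n) = fun n : ℕ =>
        (n : ℝ) ^ 2 * √ρ ^ n + (4 * ((n : ℝ) ^ 1 * √ρ ^ n) + 4 * ((n : ℝ) ^ 0 * √ρ ^ n)) := by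
      funext n; ring
    rw [e]
    exact (summable_pow_mul_geometric_of_norm_lt_one 2 hr).add
      (((summable_pow_mul_geometric_of_norm_lt_one 1 hr).mul_left 4).add
        ((summable_pow_mul_geometric_of_norm_lt_one 0 hr).mul_left 4))
  apply Summable.of_nat_of_neg <;> simpa [lagWeight] using h

lemma pow_le_sqrt_pow (h0 : 0 < ρ) (h1 : ρ < 1) (n : ℕ) : ρ ^ n ≤ √ρ ^ n := by
  refine pow_le_pow_left₀ h0.le ?_ n
  rw [Real.le_sqrt' h0]
  nlinarith

lemma pow_le_lagWeight (h0 : 0 < ρ) (h1 : ρ < 1) (k : ℤ) : ρ ^ k.natAbs ≤ lagWeight ρ k := by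
  refine (pow_le_sqrt_pow h0 h1 _).trans (le_mul_of_one_le_left (by positivity) ?_)
  nlinarith [(Nat.cast_nonneg k.natAbs : (0 : ℝ) ≤ _)]

lemma abs_mul_pow_le_lagWeight (h0 : 0 < ρ) (h1 : ρ < 1) (k : ℤ) :
    |(k : ℝ)| * ρ ^ k.natAbs ≤ lagWeight ρ k := by
  rw [← Int.cast_abs, ← Nat.cast_natAbs]
  refine mul_le_mul ?_ (pow_le_sqrt_pow h0 h1 _) (by positivity) (by positivity)
  nlinarith [(Nat.cast_nonneg k.natAbs : (0 : ℝ) ≤ _)]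

/-- The factor `k²` arises in the bias, where replacing `(m - |k|)⁺` by `m - |k|` costs at most `k²
/ m`. -/
lemma sq_mul_pow_le_lagWeight (h0 : 0 < ρ) (h1 : ρ < 1) (k : ℤ) :
    (k : ℝ) ^ 2 * ρ ^ k.natAbs ≤ lagWeight ρ k := by
  rw [← sq_abs, ← Int.cast_abs, ← Nat.cast_natAbs]
  refine mul_le_mul ?_ (pow_le_sqrt_pow h0 h1 _) (by positivity) (by positivity)
  nlinarith [(Nat.cast_nonneg k.natAbs : (0 : ℝ) ≤ _)]

/-- Interpolation between a bound that is linear in the lag and an exponential bound. -/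
lemma le_sqrt_mul_lagWeight (h0 : 0 < ρ) {C e δ : ℝ} (hC : 0 ≤ C) (he : 0 ≤ e) (hδ : 0 ≤ δ)
    {k : ℤ} (h₁ : e ≤ C * ((k.natAbs : ℝ) + 2) * δ) (h₂ : e ≤ 2 * C * ρ ^ k.natAbs) :
    e ≤ 2 * C * √δ * lagWeight ρ k := by
  set n := k.natAbs with hn
  have hn0 : (0 : ℝ) ≤ n := Nat.cast_nonneg _
  -- Geometric mean of the two hypotheses: `e² = e · e` is at most the product of the bounds. This
  -- is where `ρ` becomes `√ρ` and `δ` becomes `√δ`.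
  have key : e ≤ 2 * C * ((n : ℝ) + 2) * √δ * √ρ ^ n := by
    refine (sq_le_sq₀ he (by positivity)).1 ?_
    have hs : (√ρ ^ n) ^ 2 = ρ ^ n := by rw [← pow_mul, mul_comm, pow_mul, Real.sq_sqrt h0.le]
    have : (2 * C * ((n : ℝ) + 2) * √δ * √ρ ^ n) ^ 2
        = 4 * C ^ 2 * ((n : ℝ) + 2) ^ 2 * δ * ρ ^ n := by
      rw [mul_pow, mul_pow, hs, Real.sq_sqrt hδ]; ring
    rw [this]
    calc e ^ 2 = e * e := sq e
      _ ≤ (C * ((n : ℝ) + 2) * δ) * (2 * C * ρ ^ n) := mul_le_mul h₁ h₂ he (by positivity)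
      _ = 2 * C ^ 2 * δ * ρ ^ n * ((n : ℝ) + 2) := by ring
      _ ≤ 2 * C ^ 2 * δ * ρ ^ n * (2 * ((n : ℝ) + 2) ^ 2) := by
          refine mul_le_mul_of_nonneg_left ?_ (by positivity)
          nlinarith
      _ = _ := by ring
  refine key.trans ?_
  unfold lagWeight
  rw [← hn]
  calc 2 * C * ((n : ℝ) + 2) * √δ * √ρ ^ n = (2 * C * √δ * √ρ ^ n) * ((n : ℝ) + 2) := by ring
    _ ≤ (2 * C * √δ * √ρ ^ n) * ((n : ℝ) + 2) ^ 2 := by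
        refine mul_le_mul_of_nonneg_left ?_ (by positivity)
        nlinarith
    _ = _ := by ring

variable {E : Type*} [NormedAddCommGroup E]

lemma summable_of_norm_le_lagWeight [CompleteSpace E] (h1 : ρ < 1) {f : ℤ → E} {A : ℝ}
    (hf : ∀ k, ‖f k‖ ≤ A * lagWeight ρ k) : Summable f :=
  Summable.of_norm_bounded ((summable_lagWeight h1).mul_left A) hf

lemma norm_tsum_le_lagWeightSum (h1 : ρ < 1) {f : ℤ → E} {A : ℝ}
    (hf : ∀ k, ‖f k‖ ≤ A * lagWeight ρ k) : ‖∑' k, f k‖ ≤ A * lagWeightSum ρ :=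
  tsum_of_norm_bounded ((summable_lagWeight h1).hasSum.mul_left A) hf

lemma sum_norm_le_lagWeightSum (h1 : ρ < 1) {f : ℤ → E} {A : ℝ} (hA : 0 ≤ A) (s : ℤ)
    (F : Finset ℤ) (hf : ∀ t ∈ F, ‖f t‖ ≤ A * lagWeight ρ (t - s)) :
    ∑ t ∈ F, ‖f t‖ ≤ A * lagWeightSum ρ := by
  calc ∑ t ∈ F, ‖f t‖ ≤ ∑ t ∈ F, A * lagWeight ρ (t - s) := Finset.sum_le_sum hf
    _ = A * ∑ k ∈ F.map (Equiv.subRight s).toEmbedding, lagWeight ρ k := by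
        rw [← Finset.mul_sum, Finset.sum_map]; rfl
    _ ≤ _ := by
        refine mul_le_mul_of_nonneg_left ?_ hA
        exact (summable_lagWeight h1).sum_le_tsum _ fun k _ => lagWeight_nonneg k

end Weights

/-! ### Riemann sums on the unit interval -/

section Riemann

variable {E : Type*} [NormedAddCommGroup E] [NormedSpace ℝ E]

/-- The point `i / T` of the unit interval. -/
noncomputable def gridPoint (T : ℕ) (i : ℤ) : I := Set.projIcc (0 : ℝ) 1 zero_le_one ((i : ℝ) / T)

lemma coe_gridPoint {T : ℕ} (hT : 1 ≤ T) {i : ℤ} (h0 : 0 ≤ i) (h1 : i ≤ T) :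
    (gridPoint T i : ℝ) = (i : ℝ) / T := by
  have hT' : (0 : ℝ) < T := by exact_mod_cast hT
  have : (i : ℝ) / T ∈ Set.Icc (0 : ℝ) 1 := by
    refine ⟨div_nonneg (by exact_mod_cast h0) hT'.le, ?_⟩
    rw [div_le_one hT']
    exact_mod_cast h1
  rw [gridPoint, Set.projIcc_of_mem _ this]

lemma integral_unitInterval_eq (F : I → E) :
    ∫ w, F w = ∫ x in (0 : ℝ)..1, F (Set.projIcc 0 1 zero_le_one x) := by
  rw [intervalIntegral.integral_of_le zero_le_one, ← integral_Icc_eq_integral_Ioc,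
    ← integral_subtype measurableSet_Icc]
  refine integral_congr_ae (Eventually.of_forall fun w => ?_)
  simp

lemma sum_Icc_natCast {M : Type*} [AddCommMonoid M] (a b : ℕ) (f : ℤ → M) :
    ∑ t ∈ Finset.Icc a b, f (t : ℤ) = ∑ t ∈ Finset.Icc (a : ℤ) b, f t := by
  refine Finset.sum_bij (fun t _ => (t : ℤ)) (fun t ht => ?_) (fun t _ u _ h => ?_)
    (fun t ht => ?_) fun t _ => rfl
  · simp only [Finset.mem_Icc] at ht ⊢; omega
  · exact_mod_cast h
  · simp only [Finset.mem_Icc] at ht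
    exact ⟨t.toNat, by simp only [Finset.mem_Icc]; omega, by omega⟩

/-- Error bound for Riemann sums on the unit interval. -/
lemma norm_riemann_sum_sub_integral_le [CompleteSpace E] {F : I → E} (hF : Continuous F) {T : ℕ}
    (hT : 1 ≤ T) {η : ℝ}
    (hη : ∀ u w : I, |(u : ℝ) - w| ≤ 1 / T → ‖F u - F w‖ ≤ η) :
    ‖(1 / (T : ℝ)) • ∑ i ∈ Finset.Icc (1 : ℤ) T, F (gridPoint T i) - ∫ w, F w‖ ≤ η := by
  have hT' : (0 : ℝ) < T := by exact_mod_cast hT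
  set f : ℝ → E := fun x => F (Set.projIcc 0 1 zero_le_one x) with hf
  have hfc : Continuous f := hF.comp continuous_projIcc
  have e1 : ∫ w, F w
      = ∑ k ∈ Finset.range T, ∫ x in ((k : ℕ) : ℝ) / T..((k + 1 : ℕ) : ℝ) / T, f x := by
    rw [integral_unitInterval_eq, intervalIntegral.sum_integral_adjacent_intervals
      (a := fun k : ℕ => (k : ℝ) / T) fun k _ => hfc.intervalIntegrable _ _]
    simp [hf, hT'.ne']
  have e2 : (1 / (T : ℝ)) • ∑ i ∈ Finset.Icc (1 : ℤ) T, F (gridPoint T i)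
      = ∑ k ∈ Finset.range T, ∫ x in ((k : ℕ) : ℝ) / T..((k + 1 : ℕ) : ℝ) / T,
        F (gridPoint T ((k : ℤ) + 1)) := by
    have : ∑ i ∈ Finset.Icc (1 : ℤ) T, F (gridPoint T i)
        = ∑ k ∈ Finset.range T, F (gridPoint T ((k : ℤ) + 1)) := by
      symm
      refine Finset.sum_bij (fun k _ => (k : ℤ) + 1) (fun t ht => ?_) (fun t _ u _ h => ?_)
        (fun t ht => ?_) fun t _ => rfl
      · simp only [Finset.mem_Icc, Finset.mem_range] at ht ⊢; omega
      · omega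
      · simp only [Finset.mem_Icc] at ht
        exact ⟨(t - 1).toNat, by simp only [Finset.mem_range]; omega, by omega⟩
    rw [this, Finset.smul_sum]
    refine Finset.sum_congr rfl fun k _ => ?_
    rw [intervalIntegral.integral_const]
    congr 1
    push_cast
    ring
  -- Both sides are now sums over the cells `(k/T, (k+1)/T]`, on which the right end point is within
  -- `1/T` of every point.
  rw [e1, e2, ← Finset.sum_sub_distrib]
  calc _ ≤ ∑ k ∈ Finset.range T, η * (1 / T) := by
        refine norm_sum_le_of_le _ fun k hk => ?_
        rw [Finset.mem_range] at hk
        rw [← intervalIntegral.integral_sub (by simp) (hfc.intervalIntegrable _ _)]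
        have hle : ((k : ℕ) : ℝ) / T ≤ ((k + 1 : ℕ) : ℝ) / T := by gcongr; omega
        have := intervalIntegral.norm_integral_le_of_norm_le_const (C := η)
          (f := fun x => F (gridPoint T ((k : ℤ) + 1)) - f x)
          (a := ((k : ℕ) : ℝ) / T) (b := ((k + 1 : ℕ) : ℝ) / T) fun x hx => ?_
        · refine this.trans (le_of_eq ?_)
          rw [abs_of_nonneg (by linarith)]
          push_cast
          ring
        · rw [Set.uIoc_of_le hle] at hx
          apply hη
          have h0 : (0 : ℝ) ≤ (k : ℝ) / T := by positivity
          have h1 : ((k + 1 : ℕ) : ℝ) / T ≤ 1 := by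
            rw [div_le_one hT']; exact_mod_cast hk
          have hx01 : x ∈ Set.Icc (0 : ℝ) 1 := ⟨h0.trans hx.1.le, hx.2.trans h1⟩
          rw [coe_gridPoint hT (by omega) (by omega), Set.projIcc_of_mem _ hx01, abs_le]
          have h3 := hx.1
          have h4 := hx.2
          push_cast at h4 ⊢
          rw [add_div] at h4 ⊢
          constructor <;> linarith
    _ = η := by
        rw [Finset.sum_const, Finset.card_range, nsmul_eq_mul]; field_simp

end Riemann

/-! ### Arrays of covariances with local stationary approximations -/

section LocalCovariances

variable {E : Type*} [NormedAddCommGroup E]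

/-- An array of covariances with exponential decay in the lag and its local stationary
approximations. -/
structure IsLocCov (c : ℕ → ℤ → ℤ → E) (γ : I → ℤ → E) (C ρ : ℝ) : Prop where
  C_nonneg : 0 ≤ C
  rho_pos : 0 < ρ
  rho_lt : ρ < 1
  le : ∀ T, 1 ≤ T → ∀ s t, ‖c T s t‖ ≤ C * ρ ^ (t - s).natAbs
  lim_le : ∀ w k, ‖γ w k‖ ≤ C * ρ ^ k.natAbs
  approx : ∀ T : ℕ, 1 ≤ T → ∀ s t : ℤ, 1 ≤ s → s ≤ T → 1 ≤ t → t ≤ T → ∀ w : I,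
    ‖c T s t - γ w (t - s)‖ ≤ C * (|(s : ℝ) / T - w| + |(t : ℝ) / T - w| + 2 / T)

namespace IsLocCov

variable {c : ℕ → ℤ → ℤ → E} {γ : I → ℤ → E} {C ρ : ℝ}

/-- No regularity of `γ` in `w` is assumed; it is forced by the array. Both `γ u k` and `γ w k`
approximate the same entry at times `s, s + k` with `s/T` near `u`, with errors that tend to `0` and
to a multiple of `|u - w|` as `T → ∞`. -/
lemma lipschitz (h : IsLocCov c γ C ρ) (u w : I) (k : ℤ) :
    ‖γ u k - γ w k‖ ≤ 2 * C * |(u : ℝ) - w| := by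
  have hC := h.C_nonneg
  have key : ∀ᶠ T : ℕ in atTop, ‖γ u k - γ w k‖
      ≤ 2 * C * |(u : ℝ) - w| + C * (6 * |(k : ℝ)| + 12) / T := by
    filter_upwards [eventually_ge_atTop (2 * k.natAbs + 1)] with T hT
    have hT' : (0 : ℝ) < T := by exact_mod_cast (by omega : 0 < T)
    -- The integer part of `uT`, moved by at most `|k| + 1` so that both `s` and `s + k` lie in `1,
    -- …, T`.
    set s : ℤ := max (k.natAbs + 1) (min (T - k.natAbs) ⌊(u : ℝ) * T⌋) with hs
    have hu0 : 0 ≤ (u : ℝ) * T := mul_nonneg u.2.1 hT'.le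
    have hu1 : (u : ℝ) * T ≤ T := mul_le_of_le_one_left hT'.le u.2.2
    have hfl0 : 0 ≤ ⌊(u : ℝ) * T⌋ := Int.floor_nonneg.2 hu0
    have hfl1 : ⌊(u : ℝ) * T⌋ ≤ T := by
      have := Int.floor_mono hu1
      rwa [Int.floor_natCast] at this
    have hsb : |s - ⌊(u : ℝ) * T⌋| ≤ |k| + 1 := by
      rw [Int.abs_eq_natAbs, Int.abs_eq_natAbs]; omega
    have hs1 : |(s : ℝ) - (u : ℝ) * T| ≤ |(k : ℝ)| + 2 := by
      have h1 : |(s : ℝ) - (⌊(u : ℝ) * T⌋ : ℝ)| ≤ |(k : ℝ)| + 1 := by exact_mod_cast hsb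
      have h2 := Int.floor_le ((u : ℝ) * T)
      have h3 := Int.lt_floor_add_one ((u : ℝ) * T)
      rw [abs_le] at h1 ⊢
      constructor <;> linarith
    have hd1 : |(s : ℝ) / T - u| ≤ (|(k : ℝ)| + 2) / T := by
      rw [show (s : ℝ) / T - u = ((s : ℝ) - (u : ℝ) * T) / T by field_simp, abs_div,
        abs_of_pos hT']
      gcongr
    have hd2 : |((s + k : ℤ) : ℝ) / T - u| ≤ (2 * |(k : ℝ)| + 2) / T := by
      rw [show ((s + k : ℤ) : ℝ) / T - u = ((s : ℝ) - (u : ℝ) * T + k) / T by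
        push_cast; field_simp; ring, abs_div, abs_of_pos hT']
      gcongr
      exact (abs_add_le _ _).trans (by linarith)
    have t1 : |(s : ℝ) / T - w| ≤ |(s : ℝ) / T - u| + |(u : ℝ) - w| := abs_sub_le _ _ _
    have t2 : |((s + k : ℤ) : ℝ) / T - w| ≤ |((s + k : ℤ) : ℝ) / T - u| + |(u : ℝ) - w| :=
      abs_sub_le _ _ _
    have a1 := h.approx T (by omega) s (s + k) (by omega) (by omega) (by omega) (by omega) u
    have a2 := h.approx T (by omega) s (s + k) (by omega) (by omega) (by omega) (by omega) w
    rw [add_sub_cancel_left] at a1 a2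
    have : ‖γ u k - γ w k‖ ≤ ‖c T s (s + k) - γ u k‖ + ‖c T s (s + k) - γ w k‖ := by
      rw [show γ u k - γ w k = (c T s (s + k) - γ w k) - (c T s (s + k) - γ u k) by abel]
      exact (norm_sub_le _ _).trans (le_of_eq (add_comm _ _))
    refine this.trans ((add_le_add a1 a2).trans ?_)
    rw [← mul_add]
    have e : 2 * C * |(u : ℝ) - w| + C * (6 * |(k : ℝ)| + 12) / T
        = C * (2 * |(u : ℝ) - w| + (6 * |(k : ℝ)| + 12) / T) := by ring
    rw [e]
    have e3 : (6 * |(k : ℝ)| + 12) / T = 2 * ((|(k : ℝ)| + 2) / T) + 2 * ((2 * |(k : ℝ)| + 2) / T)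
      + 2 * (2 / T) := by ring
    refine mul_le_mul_of_nonneg_left ?_ hC
    linarith
  refine ge_of_tendsto ?_ key
  have : Tendsto (fun T : ℕ => C * (6 * |(k : ℝ)| + 12) / (T : ℝ)) atTop (𝓝 0) :=
    tendsto_const_div_atTop_nhds_zero_nat _
  simpa using this.const_add (2 * C * |(u : ℝ) - w|)

end IsLocCov

end LocalCovariances

/-! ### Combinatorics of overlapping blocks -/

/-- The times in the `i`-th block of length `m`. -/
noncomputable def block (T m : ℕ) (i : ℤ) : Finset ℤ := Finset.Icc i (min (i + m - 1) T)

lemma mem_block {T m : ℕ} {i s : ℤ} : s ∈ block T m i ↔ i ≤ s ∧ s < i + m ∧ s ≤ T := by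
  simp only [block, Finset.mem_Icc]; omega

lemma block_subset {T m : ℕ} {i : ℤ} (hi : 1 ≤ i) : block T m i ⊆ Finset.Icc 1 (T : ℤ) := by
  intro s hs
  rw [mem_block] at hs
  simp only [Finset.mem_Icc]; omega

lemma card_block_le (T m : ℕ) (i : ℤ) : (block T m i).card ≤ m := by
  simp only [block, Int.card_Icc]; omega

/-- The triangular weights `(m - |k|)⁺`. -/
noncomputable def tri (m : ℕ) (k : ℤ) : ℝ := ((m - k.natAbs : ℕ) : ℝ)

lemma tri_nonneg (m : ℕ) (k : ℤ) : 0 ≤ tri m k := Nat.cast_nonneg _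

lemma tri_le (m : ℕ) (k : ℤ) : tri m k ≤ m := by
  unfold tri; exact_mod_cast Nat.sub_le _ _

lemma abs_tri_sub_le (m : ℕ) (h k : ℤ) : |tri m (h - k) - tri m h| ≤ |(k : ℝ)| := by
  unfold tri
  have h1 : |((m - (h - k).natAbs : ℕ) : ℤ) - ((m - h.natAbs : ℕ) : ℤ)| ≤ |k| := by
    rw [Int.abs_eq_natAbs, Int.abs_eq_natAbs]; omega
  exact_mod_cast h1

lemma tri_eq_zero {m : ℕ} {k : ℤ} (h : m ≤ k.natAbs) : tri m k = 0 := by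
  unfold tri; simp [Nat.sub_eq_zero_of_le h]

section Counting

variable {E : Type*} [NormedAddCommGroup E] [NormedSpace ℝ E]

lemma sum_block_eq {N : Type*} [AddCommMonoid N] {T m : ℕ} {i : ℤ} (hi : 1 ≤ i) (f : ℤ → N) :
    ∑ s ∈ block T m i, f s = ∑ s ∈ Finset.Icc 1 (T : ℤ), if s ∈ block T m i then f s else 0 := by
  rw [← Finset.sum_filter]
  congr 1
  ext s
  simp only [Finset.mem_filter]
  exact ⟨fun h => ⟨block_subset hi h, h⟩, fun h => h.2⟩

/-- The number of blocks that contain both `s` and `t`. -/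
noncomputable def blockCount (T m : ℕ) (s t : ℤ) : ℕ :=
  ((Finset.Icc 1 (T : ℤ)).filter fun i => s ∈ block T m i ∧ t ∈ block T m i).card

lemma blockCount_eq {T m : ℕ} {s t : ℤ} (hs : s ∈ Finset.Icc 1 (T : ℤ))
    (ht : t ∈ Finset.Icc 1 (T : ℤ)) :
    blockCount T m s t = (min s t + 1 - max 1 (max s t - m + 1)).toNat := by
  rw [blockCount, ← Int.card_Icc]
  congr 1
  ext i
  simp only [Finset.mem_filter, Finset.mem_Icc, mem_block] at hs ht ⊢
  omega

lemma blockCount_le {T m : ℕ} {s t : ℤ} (hs : s ∈ Finset.Icc 1 (T : ℤ))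
    (ht : t ∈ Finset.Icc 1 (T : ℤ)) : blockCount T m s t ≤ m := by
  rw [blockCount_eq hs ht]; omega

/-- Only the left end distorts the count, because blocks that would start before time 1 are missing.
Cutting blocks off at `T` loses no pair of times up to `T`. -/
lemma blockCount_eq_tri {T m : ℕ} {s t : ℤ} (hs : s ∈ Finset.Icc 1 (T : ℤ))
    (ht : t ∈ Finset.Icc 1 (T : ℤ)) (hms : m ≤ s) : (blockCount T m s t : ℝ) = tri m (t - s) := by
  unfold tri
  rw [blockCount_eq hs ht]
  congr 1
  simp only [Finset.mem_Icc] at hs ht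
  omega

/-- Interchange of summation: a pair is weighted by the number of blocks containing both times. -/
lemma sum_blocks_eq (T m : ℕ) (f : ℤ → ℤ → E) :
    ∑ i ∈ Finset.Icc 1 (T : ℤ), ∑ s ∈ block T m i, ∑ t ∈ block T m i, f s t
      = ∑ s ∈ Finset.Icc 1 (T : ℤ), ∑ t ∈ Finset.Icc 1 (T : ℤ),
        (blockCount T m s t : ℝ) • f s t := by
  have h1 : ∀ i ∈ Finset.Icc 1 (T : ℤ), ∑ s ∈ block T m i, ∑ t ∈ block T m i, f s t
      = ∑ s ∈ Finset.Icc 1 (T : ℤ), ∑ t ∈ Finset.Icc 1 (T : ℤ),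
        if s ∈ block T m i ∧ t ∈ block T m i then f s t else 0 := by
    intro i hi
    have hi' := (Finset.mem_Icc.1 hi).1
    rw [sum_block_eq hi']
    refine Finset.sum_congr rfl fun s _ => ?_
    rw [sum_block_eq hi']
    by_cases hs : s ∈ block T m i <;> simp [hs]
  rw [Finset.sum_congr rfl h1, Finset.sum_comm]
  refine Finset.sum_congr rfl fun s _ => ?_
  rw [Finset.sum_comm]
  refine Finset.sum_congr rfl fun t _ => ?_
  rw [← Finset.sum_filter, Finset.sum_const, blockCount, Nat.cast_smul_eq_nsmul]

lemma sum_sum_block_le {T m : ℕ} {f : ℤ → ℝ} (hf : ∀ t, 0 ≤ f t) :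
    ∑ j ∈ Finset.Icc 1 (T : ℤ), ∑ t ∈ block T m j, f t ≤ m * ∑ t ∈ Finset.Icc 1 (T : ℤ), f t := by
  have h1 : ∀ j ∈ Finset.Icc 1 (T : ℤ), ∑ t ∈ block T m j, f t
      = ∑ t ∈ Finset.Icc 1 (T : ℤ), if t ∈ block T m j then f t else 0 :=
    fun j hj => sum_block_eq (Finset.mem_Icc.1 hj).1 f
  rw [Finset.sum_congr rfl h1, Finset.sum_comm, Finset.mul_sum]
  refine Finset.sum_le_sum fun t ht => ?_
  rw [← Finset.sum_filter, Finset.sum_const, nsmul_eq_mul]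
  refine mul_le_mul_of_nonneg_right ?_ (hf t)
  have h2 : ((Finset.Icc 1 (T : ℤ)).filter fun j => t ∈ block T m j).card ≤ m := by
    have := blockCount_le (m := m) ht ht
    simpa only [blockCount, and_self] using this
  exact_mod_cast h2

/-- Between two full windows of length `m` at offset `j - i`, the lag `k` occurs `(m - |j - i -
k|)⁺` times. -/
lemma sum_Ico_sum_Ico_eq_sum_tri (m : ℕ) (i j : ℤ) (f : ℤ → E) :
    ∑ s ∈ Finset.Ico i (i + m), ∑ t ∈ Finset.Ico j (j + m), f (t - s)
      = ∑ k ∈ Finset.Ioo (j - i - m) (j - i + m), tri m (j - i - k) • f k := by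
  have h1 : ∀ s ∈ Finset.Ico i (i + m), ∑ t ∈ Finset.Ico j (j + m), f (t - s)
      = ∑ k ∈ Finset.Ioo (j - i - m) (j - i + m),
        if s + k ∈ Finset.Ico j (j + m) then f k else 0 := by
    intro s hs
    rw [← Finset.sum_filter]
    refine Finset.sum_bij (fun t _ => t - s) (fun t ht => ?_) (fun t _ u _ h => ?_)
      (fun k hk => ⟨s + k, ?_, ?_⟩) fun t _ => rfl
    · simp only [Finset.mem_filter, Finset.mem_Ioo, Finset.mem_Ico] at hs ht ⊢; omega
    · omega
    · simp only [Finset.mem_filter] at hk; exact hk.2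
    · ring
  rw [Finset.sum_congr rfl h1, Finset.sum_comm]
  refine Finset.sum_congr rfl fun k hk => ?_
  rw [← Finset.sum_filter, Finset.sum_const, tri, Nat.cast_smul_eq_nsmul]
  congr 1
  have : (Finset.Ico i (i + m)).filter (fun s => s + k ∈ Finset.Ico j (j + m))
      = Finset.Ico (max i (j - k)) (min (i + m) (j - k + m)) := by
    ext s
    simp only [Finset.mem_filter, Finset.mem_Ico]; omega
  rw [this, Int.card_Ico]
  omega

lemma tsum_tri_smul_eq (m : ℕ) (h : ℤ) (f : ℤ → E) :
    ∑' k, tri m (h - k) • f k = ∑ k ∈ Finset.Ioo (h - m) (h + m), tri m (h - k) • f k := by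
  refine tsum_eq_sum fun k hk => ?_
  rw [tri_eq_zero, zero_smul]
  simp only [Finset.mem_Ioo] at hk; omega

/-- The level `x` is independent of `n` so that the induction on `n` works. The case `x = n` gives
`(2n³ + n)/3`, the source of the constant `2/3` in `Γ`. -/
lemma sum_sq_Ico (x : ℝ) (n : ℕ) :
    ∑ h ∈ Finset.Ico (-(n : ℤ)) n, (x - (h.natAbs : ℝ)) ^ 2
      = 2 * n * x ^ 2 - 2 * x * n ^ 2 + (2 * (n : ℝ) ^ 3 + n) / 3 := by
  induction n with
  | zero => simp
  | succ n ih =>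
    have h1 : Finset.Ico (-((n + 1 : ℕ) : ℤ)) ((n + 1 : ℕ) : ℤ)
        = insert (-((n : ℤ) + 1)) (insert (n : ℤ) (Finset.Ico (-(n : ℤ)) n)) := by
      ext k; simp only [Finset.mem_Ico, Finset.mem_insert]; omega
    rw [h1, Finset.sum_insert, Finset.sum_insert, ih]
    · have e1 : (-((n : ℤ) + 1)).natAbs = n + 1 := by omega
      rw [e1, Int.natAbs_natCast]
      push_cast
      ring
    · simp
    · simp only [Finset.mem_insert, Finset.mem_Ico]; omega

lemma sum_tri_sq {T m : ℕ} {i : ℤ} (h1 : (m : ℤ) < i) (h2 : i + m ≤ T) :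
    ∑ j ∈ Finset.Icc 1 (T : ℤ), tri m (j - i) ^ 2 = (2 * (m : ℝ) ^ 3 + m) / 3 := by
  have hsub : (Finset.Ico (-(m : ℤ)) m).map (Equiv.addRight i).toEmbedding
      ⊆ Finset.Icc 1 (T : ℤ) := by
    intro j hj
    simp only [Finset.mem_map_equiv, Finset.mem_Ico, Equiv.addRight_symm, Equiv.coe_addRight] at hj
    simp only [Finset.mem_Icc]; omega
  rw [← Finset.sum_subset hsub fun j _ hj => ?_, Finset.sum_map]
  · have := sum_sq_Ico m m
    have e : 2 * (m : ℝ) * (m : ℝ) ^ 2 - 2 * m * (m : ℝ) ^ 2 + (2 * (m : ℝ) ^ 3 + m) / 3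
        = (2 * (m : ℝ) ^ 3 + m) / 3 := by ring
    rw [e] at this
    rw [← this]
    refine Finset.sum_congr rfl fun k hk => ?_
    simp only [Equiv.coe_toEmbedding, Equiv.coe_addRight, add_sub_cancel_right, tri]
    simp only [Finset.mem_Ico] at hk
    rw [Nat.cast_sub (by omega)]
  · rw [tri_eq_zero, zero_pow two_ne_zero]
    simp only [Finset.mem_map_equiv, Finset.mem_Ico, Equiv.addRight_symm, Equiv.coe_addRight] at hj
    omega

end Counting

/-! ### Summation of local covariances and the bias expansion -/

namespace IsLocCov

variable {E : Type*} [NormedAddCommGroup E] {c : ℕ → ℤ → ℤ → E} {γ : I → ℤ → E} {C ρ : ℝ}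

/-- The Lipschitz bound is not summable over `k` and the exponential bound is not small in `|u -
w|`; interpolation gives both properties. -/
lemma norm_sub_le_weight (h : IsLocCov c γ C ρ) (u w : I) (k : ℤ) :
    ‖γ u k - γ w k‖ ≤ 2 * C * √|(u : ℝ) - w| * lagWeight ρ k := by
  refine le_sqrt_mul_lagWeight h.rho_pos h.C_nonneg (norm_nonneg _) (abs_nonneg _) ?_ ?_
  · refine (h.lipschitz u w k).trans ?_
    refine mul_le_mul_of_nonneg_right ?_ (abs_nonneg _)
    nlinarith [h.C_nonneg, mul_nonneg h.C_nonneg (Nat.cast_nonneg k.natAbs : (0 : ℝ) ≤ _)]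
  · refine (norm_sub_le _ _).trans ?_
    linarith [h.lim_le u k, h.lim_le w k]

lemma continuous_lim (h : IsLocCov c γ C ρ) (k : ℤ) : Continuous fun w => γ w k := by
  refine (LipschitzWith.of_dist_le_mul (K := (2 * C).toNNReal) fun u w => ?_).continuous
  rw [dist_eq_norm, Subtype.dist_eq, Real.dist_eq,
    Real.coe_toNNReal _ (by linarith [h.C_nonneg])]
  exact h.lipschitz u w k

lemma integrable_lim (h : IsLocCov c γ C ρ) (k : ℤ) : Integrable (fun w => γ w k) volume :=
  (h.continuous_lim k).integrable_of_hasCompactSupport (HasCompactSupport.of_compactSpace _)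

lemma lim_le_weight (h : IsLocCov c γ C ρ) (w : I) (k : ℤ) : ‖γ w k‖ ≤ C * lagWeight ρ k :=
  (h.lim_le w k).trans (mul_le_mul_of_nonneg_left (pow_le_lagWeight h.rho_pos h.rho_lt k)
    h.C_nonneg)

lemma le_weight (h : IsLocCov c γ C ρ) {T : ℕ} (hT : 1 ≤ T) (s t : ℤ) :
    ‖c T s t‖ ≤ C * lagWeight ρ (t - s) :=
  (h.le T hT s t).trans (mul_le_mul_of_nonneg_left (pow_le_lagWeight h.rho_pos h.rho_lt _)
    h.C_nonneg)

lemma norm_array_sub_le (h : IsLocCov c γ C ρ) {T : ℕ} (hT : 1 ≤ T) {s t : ℤ} (hs1 : 1 ≤ s)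
    (hsT : s ≤ T) (ht1 : 1 ≤ t) (htT : t ≤ T) (w : I) {δ : ℝ} (hδ : 0 ≤ δ)
    (hle : |(s : ℝ) / T - w| + |(t : ℝ) / T - w| + 2 / T ≤ (((t - s).natAbs : ℝ) + 2) * δ) :
    ‖c T s t - γ w (t - s)‖ ≤ 2 * C * √δ * lagWeight ρ (t - s) := by
  refine le_sqrt_mul_lagWeight h.rho_pos h.C_nonneg (norm_nonneg _) hδ ?_ ?_
  · refine (h.approx T hT s t hs1 hsT ht1 htT w).trans ?_
    rw [mul_assoc]
    exact mul_le_mul_of_nonneg_left hle h.C_nonneg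
  · refine (norm_sub_le _ _).trans ?_
    linarith [h.lim_le w (t - s), h.le T hT s t]

lemma summable_lim [CompleteSpace E] (h : IsLocCov c γ C ρ) (w : I) : Summable fun k => γ w k :=
  summable_of_norm_le_lagWeight h.rho_lt (h.lim_le_weight w)

lemma norm_tsum_le (h : IsLocCov c γ C ρ) (w : I) : ‖∑' k, γ w k‖ ≤ C * lagWeightSum ρ :=
  norm_tsum_le_lagWeightSum h.rho_lt (h.lim_le_weight w)

lemma continuous_tsum_lim [CompleteSpace E] (h : IsLocCov c γ C ρ) :
    Continuous fun w => ∑' k, γ w k :=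
  continuous_tsum h.continuous_lim ((summable_lagWeight h.rho_lt).mul_left C)
    fun k w => h.lim_le_weight w k

lemma norm_tsum_sub_tsum_le [CompleteSpace E] (h : IsLocCov c γ C ρ) (u w : I) :
    ‖∑' k, γ u k - ∑' k, γ w k‖ ≤ 2 * C * √|(u : ℝ) - w| * lagWeightSum ρ := by
  rw [← (h.summable_lim u).tsum_sub (h.summable_lim w)]
  exact norm_tsum_le_lagWeightSum h.rho_lt (h.norm_sub_le_weight u w)

variable [NormedSpace ℝ E]

lemma norm_integral_le (h : IsLocCov c γ C ρ) (k : ℤ) : ‖∫ w, γ w k‖ ≤ C * ρ ^ k.natAbs := by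
  have := norm_integral_le_of_norm_le_const (μ := (volume : Measure I)) (f := fun w => γ w k)
    (Eventually.of_forall fun w => h.lim_le w k)
  simpa using this

lemma norm_integral_le_weight (h : IsLocCov c γ C ρ) (k : ℤ) :
    ‖∫ w, γ w k‖ ≤ C * lagWeight ρ k :=
  (h.norm_integral_le k).trans (mul_le_mul_of_nonneg_left
    (pow_le_lagWeight h.rho_pos h.rho_lt k) h.C_nonneg)

lemma norm_abs_smul_integral_le (h : IsLocCov c γ C ρ) (k : ℤ) :
    ‖|(k : ℝ)| • ∫ w, γ w k‖ ≤ C * lagWeight ρ k := by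
  rw [norm_smul, Real.norm_eq_abs, abs_abs]
  calc |(k : ℝ)| * ‖∫ w, γ w k‖ ≤ |(k : ℝ)| * (C * ρ ^ k.natAbs) :=
        mul_le_mul_of_nonneg_left (h.norm_integral_le k) (abs_nonneg _)
    _ = C * (|(k : ℝ)| * ρ ^ k.natAbs) := by ring
    _ ≤ _ := mul_le_mul_of_nonneg_left (abs_mul_pow_le_lagWeight h.rho_pos h.rho_lt k) h.C_nonneg

variable [CompleteSpace E]

lemma summable_integral (h : IsLocCov c γ C ρ) : Summable fun k => ∫ w, γ w k :=
  summable_of_norm_le_lagWeight h.rho_lt h.norm_integral_le_weight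

lemma summable_abs_smul_integral (h : IsLocCov c γ C ρ) :
    Summable fun k : ℤ => |(k : ℝ)| • ∫ w, γ w k :=
  summable_of_norm_le_lagWeight h.rho_lt h.norm_abs_smul_integral_le

/-- The error of the expected bootstrap estimator, to the first order in `1 / m`. -/
theorem norm_sum_blocks_sub_le (h : IsLocCov c γ C ρ) {T m : ℕ} (hT : 1 ≤ T) (hm : 1 ≤ m) :
    ‖(1 / (T : ℝ)) • ∑ i ∈ Finset.Icc 1 (T : ℤ), ∑ s ∈ block T m i, ∑ t ∈ block T m i, c T s t
        - ((m : ℝ) • ∑' k, (∫ w, γ w k) - ∑' k : ℤ, |(k : ℝ)| • ∫ w, γ w k)‖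
      ≤ 4 * C * lagWeightSum ρ * (m / √T + (m : ℝ) ^ 2 / T + 1 / m) := by
  have hC := h.C_nonneg
  have hT' : (0 : ℝ) < T := by exact_mod_cast hT
  have hm' : (0 : ℝ) < m := by exact_mod_cast hm
  set S := lagWeightSum ρ with hS
  have hS0 : 0 ≤ S := lagWeightSum_nonneg
  -- `D s` collects the pairs with first time `s`; `target u` is its analogue for the stationary
  -- series at `u`, without boundary effects.
  set D : ℤ → E := fun s => ∑ t ∈ Finset.Icc 1 (T : ℤ), (blockCount T m s t : ℝ) • c T s t with hD
  set target : I → E := fun u => ∑' k, tri m k • γ u k with htarget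
  set g : ℤ → E := fun k => ∫ w, γ w k with hg
  have htri : ∀ (f : ℤ → E) (A : ℝ), (∀ k, ‖f k‖ ≤ A * lagWeight ρ k) →
      ∀ k, ‖tri m k • f k‖ ≤ m * A * lagWeight ρ k := by
    intro f A hf k
    rw [norm_smul, Real.norm_of_nonneg (tri_nonneg m k), mul_assoc]
    exact mul_le_mul (tri_le m k) (hf k) (norm_nonneg _) hm'.le
  -- the part of a single time
  have hbd : ∀ s ∈ Finset.Icc 1 (T : ℤ), ‖D s - target (gridPoint T s)‖
      ≤ m * (2 * C * √(1 / T)) * S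
        + if (m : ℤ) < s ∧ s + m ≤ T then 0 else 2 * (m * C * S) := by
    intro s hs
    have hs' := Finset.mem_Icc.1 hs
    split_ifs with hint
    · have e1 : target (gridPoint T s)
          = ∑ t ∈ Finset.Icc 1 (T : ℤ), tri m (t - s) • γ (gridPoint T s) (t - s) := by
        change ∑' k, tri m k • γ (gridPoint T s) k = _
        rw [← (Equiv.subRight s).tsum_eq]
        refine tsum_eq_sum fun t ht => ?_
        rw [Equiv.subRight_apply, tri_eq_zero, zero_smul]
        simp only [Finset.mem_Icc] at ht; omega
      rw [e1, hD, ← Finset.sum_sub_distrib, add_zero]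
      refine (norm_sum_le _ _).trans ?_
      refine sum_norm_le_lagWeightSum h.rho_lt (by positivity) s _ fun t ht => ?_
      have ht' := Finset.mem_Icc.1 ht
      rw [blockCount_eq_tri hs ht hint.1.le, ← smul_sub, norm_smul,
        Real.norm_of_nonneg (tri_nonneg m _), mul_assoc]
      refine mul_le_mul (tri_le m _) ?_ (norm_nonneg _) hm'.le
      -- Freezing at `w = s/T` makes the first distance zero, and the total is exactly `(|t-s| + 2)
      -- / T`, so `δ = 1/T`.
      refine h.norm_array_sub_le hT hs'.1 hs'.2 ht'.1 ht'.2 _ (by positivity) (le_of_eq ?_)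
      rw [coe_gridPoint hT (by omega) hs'.2, sub_self, abs_zero, ← sub_div, abs_div,
        abs_of_pos hT', Nat.cast_natAbs]
      push_cast
      ring
    · have b1 : ‖D s‖ ≤ m * C * S := by
        refine (norm_sum_le _ _).trans ?_
        refine sum_norm_le_lagWeightSum h.rho_lt (by positivity) s _ fun t ht => ?_
        rw [norm_smul, Real.norm_natCast, mul_assoc]
        exact mul_le_mul (by exact_mod_cast blockCount_le hs ht) (h.le_weight hT s t)
          (norm_nonneg _) hm'.le
      have b2 : ‖target (gridPoint T s)‖ ≤ m * C * S :=
        norm_tsum_le_lagWeightSum h.rho_lt (htri _ C (h.lim_le_weight _))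
      have b3 : 0 ≤ m * (2 * C * √(1 / T)) * S := by positivity
      linarith [norm_sub_le (D s) (target (gridPoint T s))]
  -- There are at most `m` exceptional times at either end, each with an error of order `m`; after
  -- division by `T` this is the term `m²/T`.
  have hcount : ∑ s ∈ Finset.Icc 1 (T : ℤ),
      (if (m : ℤ) < s ∧ s + m ≤ T then (0 : ℝ) else 2 * (m * C * S))
        ≤ 2 * m * (2 * (m * C * S)) := by
    rw [Finset.sum_congr rfl fun s _ => (ite_not (p := (m : ℤ) < s ∧ s + m ≤ T) _ _).symm,
      ← Finset.sum_filter, Finset.sum_const, nsmul_eq_mul]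
    refine mul_le_mul_of_nonneg_right ?_ (by positivity)
    have h1 : ((Finset.Icc 1 (T : ℤ)).filter fun s => ¬((m : ℤ) < s ∧ s + m ≤ T))
        ⊆ Finset.Icc 1 (m : ℤ) ∪ Finset.Ioc (T - m : ℤ) T := by
      intro s hs
      simp only [Finset.mem_filter, Finset.mem_Icc, Finset.mem_union, Finset.mem_Ioc] at hs ⊢
      omega
    have h2 := (Finset.card_le_card h1).trans (Finset.card_union_le _ _)
    rw [Int.card_Icc, Int.card_Ioc] at h2
    have h3 : ((Finset.Icc 1 (T : ℤ)).filter fun s => ¬((m : ℤ) < s ∧ s + m ≤ T)).card ≤ 2 * m := by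
      omega
    exact_mod_cast h3
  have step1 : ‖(1 / (T : ℝ)) • ∑ s ∈ Finset.Icc 1 (T : ℤ), D s
      - (1 / (T : ℝ)) • ∑ s ∈ Finset.Icc 1 (T : ℤ), target (gridPoint T s)‖
      ≤ 2 * C * S * (m / √T) + 4 * C * S * ((m : ℝ) ^ 2 / T) := by
    rw [← smul_sub, ← Finset.sum_sub_distrib, norm_smul, Real.norm_of_nonneg (by positivity)]
    calc _ ≤ 1 / (T : ℝ) * (∑ s ∈ Finset.Icc 1 (T : ℤ), (m * (2 * C * √(1 / T)) * S
        + if (m : ℤ) < s ∧ s + m ≤ T then 0 else 2 * (m * C * S))) := by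
          gcongr
          exact norm_sum_le_of_le _ hbd
      _ ≤ 1 / (T : ℝ) * (T * (m * (2 * C * √(1 / T)) * S) + 2 * m * (2 * (m * C * S))) := by
          rw [Finset.sum_add_distrib, Finset.sum_const, Int.card_Icc, nsmul_eq_mul]
          have : (((T : ℤ) + 1 - 1).toNat : ℝ) = T := by simp
          rw [this]
          gcongr
      _ = _ := by
          rw [Real.sqrt_div zero_le_one, Real.sqrt_one]
          field_simp
          ring
  -- With the finite average inside the series, the Riemann sum can be compared with the integral
  -- lag by lag.
  have step2 : (1 / (T : ℝ)) • ∑ s ∈ Finset.Icc 1 (T : ℤ), target (gridPoint T s)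
      = ∑' k, tri m k • ((1 / (T : ℝ)) • ∑ s ∈ Finset.Icc 1 (T : ℤ), γ (gridPoint T s) k) := by
    have hsum : ∀ s ∈ Finset.Icc 1 (T : ℤ), Summable fun k => tri m k • γ (gridPoint T s) k :=
      fun s _ => summable_of_norm_le_lagWeight h.rho_lt (htri _ C (h.lim_le_weight _))
    rw [htarget]
    simp only
    rw [← Summable.tsum_finsetSum hsum, ← tsum_const_smul'']
    refine tsum_congr fun k => ?_
    rw [← Finset.smul_sum, smul_comm]
  have hR : ∀ k, ‖(1 / (T : ℝ)) • ∑ s ∈ Finset.Icc 1 (T : ℤ), γ (gridPoint T s) k - g k‖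
      ≤ 2 * C * √(1 / T) * lagWeight ρ k := fun k =>
    norm_riemann_sum_sub_integral_le (h.continuous_lim k) hT fun u w huw => by
      refine (h.norm_sub_le_weight u w k).trans ?_
      have := lagWeight_nonneg (ρ := ρ) k
      gcongr
  have hgs : Summable fun k => tri m k • g k :=
    summable_of_norm_le_lagWeight h.rho_lt (htri _ C h.norm_integral_le_weight)
  have hRs := summable_of_norm_le_lagWeight h.rho_lt (htri _ _ hR)
  have step3 : ‖∑' k, tri m k • ((1 / (T : ℝ)) • ∑ s ∈ Finset.Icc 1 (T : ℤ), γ (gridPoint T s) k)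
      - ∑' k, tri m k • g k‖ ≤ 2 * C * S * (m / √T) := by
    have hs : Summable fun k =>
        tri m k • ((1 / (T : ℝ)) • ∑ s ∈ Finset.Icc 1 (T : ℤ), γ (gridPoint T s) k) := by
      refine (hRs.add hgs).congr fun k => ?_
      rw [smul_sub, sub_add_cancel]
    rw [← hs.tsum_sub hgs]
    simp only [← smul_sub]
    refine (norm_tsum_le_lagWeightSum h.rho_lt (htri _ _ hR)).trans (le_of_eq ?_)
    rw [Real.sqrt_div zero_le_one, Real.sqrt_one]
    ring
  have step4 : ‖∑' k, tri m k • g k - ((m : ℝ) • ∑' k, g k - ∑' k : ℤ, |(k : ℝ)| • g k)‖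
      ≤ C / m * S := by
    rw [← tsum_const_smul'', ← (h.summable_integral.const_smul (m : ℝ)).tsum_sub
      h.summable_abs_smul_integral, ← hgs.tsum_sub
      ((h.summable_integral.const_smul (m : ℝ)).sub h.summable_abs_smul_integral)]
    refine norm_tsum_le_lagWeightSum h.rho_lt fun k => ?_
    rw [← sub_smul, ← sub_smul, norm_smul]
    -- Equality of the two weights up to lag `m`; beyond it the difference is `|k| - m ≤ |k| ≤
    -- k²/m`.
    have e1 : ‖tri m k - ((m : ℝ) - |(k : ℝ)|)‖ ≤ (k : ℝ) ^ 2 / m := by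
      have hk : |(k : ℝ)| = (k.natAbs : ℝ) := by rw [Nat.cast_natAbs]; push_cast; rfl
      rw [hk, ← sq_abs, hk, tri]
      rcases le_total k.natAbs m with hle | hle
      · rw [Nat.cast_sub hle, sub_self, norm_zero]; positivity
      · rw [Nat.sub_eq_zero_of_le hle, Nat.cast_zero]
        have : (m : ℝ) ≤ k.natAbs := by exact_mod_cast hle
        rw [Real.norm_of_nonneg (by linarith), le_div_iff₀ hm']
        nlinarith
    calc _ ≤ (k : ℝ) ^ 2 / m * (C * ρ ^ k.natAbs) :=
          mul_le_mul e1 (h.norm_integral_le k) (norm_nonneg _) (by positivity)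
      _ = C / m * ((k : ℝ) ^ 2 * ρ ^ k.natAbs) := by ring
      _ ≤ _ := mul_le_mul_of_nonneg_left (sq_mul_pow_le_lagWeight h.rho_pos h.rho_lt k)
        (by positivity)
  rw [sum_blocks_eq]
  rw [step2] at step1
  have tri3 := (norm_sub_le_norm_sub_add_norm_sub ((1 / (T : ℝ)) • ∑ s ∈ Finset.Icc 1 (T : ℤ), D s)
    (∑' k, tri m k • ((1 / (T : ℝ)) • ∑ s ∈ Finset.Icc 1 (T : ℤ), γ (gridPoint T s) k))
    ((m : ℝ) • ∑' k, g k - ∑' k : ℤ, |(k : ℝ)| • g k))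
  have tri4 := (norm_sub_le_norm_sub_add_norm_sub
    (∑' k, tri m k • ((1 / (T : ℝ)) • ∑ s ∈ Finset.Icc 1 (T : ℤ), γ (gridPoint T s) k))
    (∑' k, tri m k • g k) ((m : ℝ) • ∑' k, g k - ∑' k : ℤ, |(k : ℝ)| • g k))
  have e4 : C / m * S ≤ 4 * C * S * (1 / m) := by
    have : 0 ≤ C * S / m := by positivity
    have e5 : 4 * C * S * (1 / m) - C / m * S = 3 * (C * S / m) := by ring
    linarith
  refine le_trans tri3 ?_
  calc _ ≤ (2 * C * S * (m / √T) + 4 * C * S * ((m : ℝ) ^ 2 / T))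
        + (2 * C * S * (m / √T) + 4 * C * S * (1 / m)) :=
      add_le_add step1 (tri4.trans (add_le_add step3 (step4.trans e4)))
    _ = _ := by ring

end IsLocCov

/-! ### Covariances between block sums and the leading variance term -/

/-- The covariance of the sums over the blocks `i` and `j`. -/
noncomputable def blockCov {E : Type*} [NormedAddCommGroup E] (c : ℕ → ℤ → ℤ → E) (T m : ℕ)
    (i j : ℤ) : E :=
  ∑ s ∈ block T m i, ∑ t ∈ block T m j, c T s t

namespace IsLocCov

section Norm

variable {E : Type*} [NormedAddCommGroup E] {c : ℕ → ℤ → ℤ → E} {γ : I → ℤ → E} {C ρ : ℝ}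

lemma norm_blockCov_le (h : IsLocCov c γ C ρ) {T : ℕ} (hT : 1 ≤ T) (m : ℕ) (i j : ℤ) :
    ‖blockCov c T m i j‖ ≤ m * (C * lagWeightSum ρ) := by
  have hC := h.C_nonneg
  have hS0 : 0 ≤ lagWeightSum ρ := lagWeightSum_nonneg
  calc ‖blockCov c T m i j‖ ≤ ∑ s ∈ block T m i, C * lagWeightSum ρ := by
        refine norm_sum_le_of_le _ fun s _ => (norm_sum_le _ _).trans ?_
        exact sum_norm_le_lagWeightSum h.rho_lt hC s _ fun t _ => h.le_weight hT s t
    _ ≤ _ := by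
        rw [Finset.sum_const, nsmul_eq_mul]
        have : ((block T m i).card : ℝ) ≤ m := by exact_mod_cast card_block_le T m i
        gcongr

/-- The triangular weight vanishes at offset `j - i` and is 1-Lipschitz, so the lag `k` occurs at
most `|k|` times. Hence the bound is free of `m`. -/
lemma norm_blockCov_le_of_disjoint (h : IsLocCov c γ C ρ) {T : ℕ} (hT : 1 ≤ T) {m : ℕ} {i j : ℤ}
    (hij : m ≤ (j - i).natAbs) : ‖blockCov c T m i j‖ ≤ C * lagWeightSum ρ := by
  have hC := h.C_nonneg
  have hρ := h.rho_pos
  have hsub : ∀ i, block T m i ⊆ Finset.Ico i (i + m) := by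
    intro i s hs
    rw [mem_block] at hs
    rw [Finset.mem_Ico]; omega
  calc ‖blockCov c T m i j‖
      ≤ ∑ s ∈ block T m i, ∑ t ∈ block T m j, C * ρ ^ (t - s).natAbs :=
        norm_sum_le_of_le _ fun s _ => norm_sum_le_of_le _ fun t _ => h.le T hT s t
    _ ≤ ∑ s ∈ Finset.Ico i (i + m), ∑ t ∈ Finset.Ico j (j + m), C * ρ ^ (t - s).natAbs := by
        refine (Finset.sum_le_sum fun s _ => Finset.sum_le_sum_of_subset_of_nonneg (hsub j)
          fun t _ _ => by positivity).trans ?_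
        exact Finset.sum_le_sum_of_subset_of_nonneg (hsub i)
          fun s _ _ => Finset.sum_nonneg fun t _ => by positivity
    _ = ∑ k ∈ Finset.Ioo (j - i - m) (j - i + m), tri m (j - i - k) • (C * ρ ^ k.natAbs) :=
        sum_Ico_sum_Ico_eq_sum_tri m i j fun k => C * ρ ^ k.natAbs
    _ ≤ ∑ k ∈ Finset.Ioo (j - i - m) (j - i + m), C * lagWeight ρ k := by
        refine Finset.sum_le_sum fun k _ => ?_
        rw [smul_eq_mul]
        have h1 : tri m (j - i - k) ≤ |(k : ℝ)| := by
          have := (abs_le.1 (abs_tri_sub_le m (j - i) k)).2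
          rwa [tri_eq_zero hij, sub_zero] at this
        calc tri m (j - i - k) * (C * ρ ^ k.natAbs) ≤ |(k : ℝ)| * (C * ρ ^ k.natAbs) := by gcongr
          _ = C * (|(k : ℝ)| * ρ ^ k.natAbs) := by ring
          _ ≤ _ := mul_le_mul_of_nonneg_left (abs_mul_pow_le_lagWeight hρ h.rho_lt k) hC
    _ ≤ _ := by
        rw [← Finset.mul_sum]
        exact mul_le_mul_of_nonneg_left ((summable_lagWeight h.rho_lt).sum_le_tsum _
          fun k _ => lagWeight_nonneg k) hC

/-- One factor `m` counts the times in block `i`, the other the blocks `j` that contain a given time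
`t`. -/
lemma sum_norm_blockCov_le (h : IsLocCov c γ C ρ) {T : ℕ} (hT : 1 ≤ T) (m : ℕ) (i : ℤ) :
    ∑ j ∈ Finset.Icc 1 (T : ℤ), ‖blockCov c T m i j‖ ≤ (m : ℝ) ^ 2 * (C * lagWeightSum ρ) := by
  have hC := h.C_nonneg
  have hS0 : 0 ≤ lagWeightSum ρ := lagWeightSum_nonneg
  calc ∑ j ∈ Finset.Icc 1 (T : ℤ), ‖blockCov c T m i j‖
      ≤ ∑ j ∈ Finset.Icc 1 (T : ℤ), ∑ s ∈ block T m i, ∑ t ∈ block T m j, ‖c T s t‖ :=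
        Finset.sum_le_sum fun j _ => norm_sum_le_of_le _ fun s _ => norm_sum_le _ _
    _ = ∑ s ∈ block T m i, ∑ j ∈ Finset.Icc 1 (T : ℤ), ∑ t ∈ block T m j, ‖c T s t‖ :=
        Finset.sum_comm
    _ ≤ ∑ s ∈ block T m i, m * (C * lagWeightSum ρ) := by
        refine Finset.sum_le_sum fun s _ => (sum_sum_block_le fun t => norm_nonneg _).trans ?_
        exact mul_le_mul_of_nonneg_left (sum_norm_le_lagWeightSum h.rho_lt hC s _
          fun t _ => h.le_weight hT s t) (Nat.cast_nonneg m)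
    _ ≤ _ := by
        rw [Finset.sum_const, nsmul_eq_mul, sq, mul_assoc]
        have : ((block T m i).card : ℝ) ≤ m := by exact_mod_cast card_block_le T m i
        gcongr

variable [NormedSpace ℝ E] [CompleteSpace E]

/-- Two replacements: the array is frozen at `i/T`, which costs `√(m/T)` for each of `m` times, and
the weight at `j - i - k` becomes that at `j - i`, which costs `|k|` per lag. The margins `m` and
`2m` keep block `j` inside `1, …, T` and uncut. -/
lemma norm_blockCov_sub_le (h : IsLocCov c γ C ρ) {T m : ℕ} (hm : 1 ≤ m) {i j : ℤ}
    (hi : (m : ℤ) < i) (hi' : i + 2 * m ≤ T) (hij : (j - i).natAbs < m) :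
    ‖blockCov c T m i j - tri m (j - i) • ∑' k, γ (gridPoint T i) k‖
      ≤ m * (2 * C * √(5 * m / T) * lagWeightSum ρ) + C * lagWeightSum ρ := by
  have hC := h.C_nonneg
  have hT : 1 ≤ T := by omega
  have hT' : (0 : ℝ) < T := by exact_mod_cast hT
  have hm' : (1 : ℝ) ≤ m := by exact_mod_cast hm
  set u := gridPoint T i with hu
  have hfull : ∀ i : ℤ, i + m ≤ T + 1 → block T m i = Finset.Ico i (i + m) := by
    intro i hi
    ext s
    rw [mem_block, Finset.mem_Ico]; omega
  have b1 : ‖blockCov c T m i j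
      - ∑ s ∈ Finset.Ico i (i + m), ∑ t ∈ Finset.Ico j (j + m), γ u (t - s)‖
      ≤ m * (2 * C * √(5 * m / T) * lagWeightSum ρ) := by
    rw [blockCov, hfull i (by omega), hfull j (by omega), ← Finset.sum_sub_distrib]
    have : ∀ s ∈ Finset.Ico i (i + m), ‖∑ t ∈ Finset.Ico j (j + m), c T s t
        - ∑ t ∈ Finset.Ico j (j + m), γ u (t - s)‖ ≤ 2 * C * √(5 * m / T) * lagWeightSum ρ := by
      intro s hs
      rw [← Finset.sum_sub_distrib]
      refine (norm_sum_le _ _).trans ?_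
      refine sum_norm_le_lagWeightSum h.rho_lt (by positivity) s _ fun t ht => ?_
      rw [Finset.mem_Ico] at hs ht
      refine h.norm_array_sub_le hT (by omega) (by omega) (by omega) (by omega) _ (by positivity) ?_
      have hs2 : |(s : ℝ) / T - u| ≤ m / T := by
        rw [hu, coe_gridPoint hT (by omega) (by omega), ← sub_div, abs_div, abs_of_pos hT']
        gcongr
        have : |s - i| ≤ (m : ℤ) := by rw [abs_le]; omega
        exact_mod_cast this
      have ht2 : |(t : ℝ) / T - u| ≤ 2 * m / T := by
        rw [hu, coe_gridPoint hT (by omega) (by omega), ← sub_div, abs_div, abs_of_pos hT']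
        gcongr
        have : |t - i| ≤ (2 * m : ℤ) := by rw [abs_le]; omega
        exact_mod_cast this
      have h2 : 2 / (T : ℝ) ≤ 2 * m / T := by gcongr; linarith
      -- The constant 5 in `δ = 5m/T` is the sum of these three contributions.
      calc _ ≤ (m : ℝ) / T + 2 * m / T + 2 * m / T := add_le_add (add_le_add hs2 ht2) h2
        _ = 1 * (5 * m / T) := by ring
        _ ≤ _ := by
          refine mul_le_mul_of_nonneg_right ?_ (by positivity)
          linarith [(Nat.cast_nonneg (t - s).natAbs : (0 : ℝ) ≤ _)]
    refine (norm_sum_le_of_le _ this).trans (le_of_eq ?_)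
    rw [Finset.sum_const, Int.card_Ico, nsmul_eq_mul]
    simp
  have b2 : ‖∑ s ∈ Finset.Ico i (i + m), ∑ t ∈ Finset.Ico j (j + m), γ u (t - s)
      - tri m (j - i) • ∑' k, γ u k‖ ≤ C * lagWeightSum ρ := by
    rw [sum_Ico_sum_Ico_eq_sum_tri m i j fun k => γ u k, ← tsum_tri_smul_eq, ← tsum_const_smul'']
    have hs1 : Summable fun k => tri m (j - i - k) • γ u k := by
      refine summable_of_norm_le_lagWeight (A := m * C) h.rho_lt fun k => ?_
      rw [norm_smul, Real.norm_of_nonneg (tri_nonneg m _), mul_assoc]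
      exact mul_le_mul (tri_le m _) (h.lim_le_weight u k) (norm_nonneg _) (by positivity)
    rw [← hs1.tsum_sub ((h.summable_lim u).const_smul _)]
    refine norm_tsum_le_lagWeightSum h.rho_lt fun k => ?_
    rw [← sub_smul, norm_smul]
    calc ‖tri m (j - i - k) - tri m (j - i)‖ * ‖γ u k‖ ≤ |(k : ℝ)| * (C * ρ ^ k.natAbs) :=
          mul_le_mul (abs_tri_sub_le m _ k) (h.lim_le u k) (norm_nonneg _) (abs_nonneg _)
      _ = C * (|(k : ℝ)| * ρ ^ k.natAbs) := by ring
      _ ≤ _ := mul_le_mul_of_nonneg_left (abs_mul_pow_le_lagWeight h.rho_pos h.rho_lt k) hC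
  exact (norm_sub_le_norm_sub_add_norm_sub _ _ _).trans (add_le_add b1 b2)

end Norm

section Inner

open scoped RealInnerProductSpace

variable {E : Type*} [NormedAddCommGroup E] [InnerProductSpace ℝ E]
  {c c' : ℕ → ℤ → ℤ → E} {γ γ' : I → ℤ → E} {C ρ : ℝ}

lemma abs_inner_sub_inner_le {a a' b b' : E} {A d d' : ℝ} (ha' : ‖a'‖ ≤ A) (hb : ‖b‖ ≤ A)
    (hd : ‖a - b‖ ≤ d) (hd' : ‖a' - b'‖ ≤ d') : |⟪a, a'⟫ - ⟪b, b'⟫| ≤ d * A + A * d' := by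
  have e : ⟪a, a'⟫ - ⟪b, b'⟫ = ⟪a - b, a'⟫ + ⟪b, a' - b'⟫ := by
    rw [inner_sub_left, inner_sub_right]; ring
  rw [e]
  refine (abs_add_le _ _).trans (add_le_add ?_ ?_)
  · exact (abs_real_inner_le_norm _ _).trans
      (mul_le_mul hd ha' (norm_nonneg _) ((norm_nonneg _).trans hd))
  · exact (abs_real_inner_le_norm _ _).trans
      (mul_le_mul hb hd' (norm_nonneg _) ((norm_nonneg _).trans hb))

/-- The leading term of the part of the variance that is due to pairs of covariances. -/
theorem abs_sum_inner_blockCov_sub_le [CompleteSpace E] (h : IsLocCov c γ C ρ)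
    (h' : IsLocCov c' γ' C ρ) {T m : ℕ}
    (hT : 1 ≤ T) (hm : 1 ≤ m) :
    |1 / ((T : ℝ) * (m : ℝ) ^ 3) * ∑ i ∈ Finset.Icc 1 (T : ℤ), ∑ j ∈ Finset.Icc 1 (T : ℤ),
          ⟪blockCov c T m i j, blockCov c' T m i j⟫
        - 2 / 3 * ∫ w, ⟪∑' k, γ w k, ∑' k, γ' w k⟫|
      ≤ 8 * (C * lagWeightSum ρ) ^ 2 * (√(5 * m / T) + 1 / m + m / T + 1 / √T) := by
  have hC := h.C_nonneg
  have hT' : (0 : ℝ) < T := by exact_mod_cast hT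
  have hm' : (1 : ℝ) ≤ m := by exact_mod_cast hm
  have hm0 : (0 : ℝ) < m := by linarith
  set A := C * lagWeightSum ρ with hA
  have hA0 : 0 ≤ A := mul_nonneg hC lagWeightSum_nonneg
  set Q := √(5 * (m : ℝ) / T) with hQ
  have hQ0 : 0 ≤ Q := Real.sqrt_nonneg _
  set G : I → ℝ := fun w => ⟪∑' k, γ w k, ∑' k, γ' w k⟫ with hG
  set Z : ℤ → ℝ := fun i => ∑ j ∈ Finset.Icc 1 (T : ℤ),
    ⟪blockCov c T m i j, blockCov c' T m i j⟫ with hZ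
  have hGb : ∀ w, |G w| ≤ A ^ 2 := fun w => by
    refine (abs_real_inner_le_norm _ _).trans ?_
    rw [sq]
    exact mul_le_mul (h.norm_tsum_le w) (h'.norm_tsum_le w) (norm_nonneg _) hA0
  set d := 2 * m * A * Q + A with hd
  have hd0 : 0 ≤ d := by positivity
  have hdle : m * (2 * C * Q * lagWeightSum ρ) + C * lagWeightSum ρ = d := by
    rw [hd, hA]; ring
  have hcard : ((Finset.Icc 1 (T : ℤ)).card : ℝ) = T := by rw [Int.card_Icc]; simp
  -- the part of a single block
  have hbd : ∀ i ∈ Finset.Icc 1 (T : ℤ), |Z i - 2 / 3 * (m : ℝ) ^ 3 * G (gridPoint T i)|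
      ≤ A ^ 2 * (8 * (m : ℝ) ^ 3 * Q + 6 * (m : ℝ) ^ 2)
        + if (m : ℤ) < i ∧ i + 2 * m ≤ T then 0 else 2 * (m : ℝ) ^ 3 * A ^ 2 := by
    intro i hi
    have hi' := Finset.mem_Icc.1 hi
    set u := gridPoint T i with hu
    split_ifs with hint
    -- Offsets below `m` carry the main term; there are at most `2m` of them, each with error `2d ·
    -- mA`. For larger offsets one factor is bounded by `A`, and the other sums to order `m²`, which
    -- is negligible against `m³`.
    · have hper : ∀ j ∈ Finset.Icc 1 (T : ℤ),
          |⟪blockCov c T m i j, blockCov c' T m i j⟫ - tri m (j - i) ^ 2 * G u|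
          ≤ (if (j - i).natAbs < m then 2 * d * (m * A) else 0) + ‖blockCov c T m i j‖ * A := by
        intro j _
        split_ifs with hij
        · have e : tri m (j - i) ^ 2 * G u
              = ⟪tri m (j - i) • ∑' k, γ u k, tri m (j - i) • ∑' k, γ' u k⟫ := by
            rw [real_inner_smul_left, real_inner_smul_right]; ring
          rw [e]
          have hb : ‖tri m (j - i) • ∑' k, γ u k‖ ≤ m * A := by
            rw [norm_smul, Real.norm_of_nonneg (tri_nonneg m _)]
            exact mul_le_mul (tri_le m _) (h.norm_tsum_le u) (norm_nonneg _) hm0.le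
          have k1 := h.norm_blockCov_sub_le hm hint.1 hint.2 hij
          have k2 := h'.norm_blockCov_sub_le hm hint.1 hint.2 hij
          rw [hdle] at k1 k2
          refine (abs_inner_sub_inner_le (h'.norm_blockCov_le hT m i j) hb k1 k2).trans ?_
          have : 0 ≤ ‖blockCov c T m i j‖ * A := by positivity
          linarith
        · rw [tri_eq_zero (not_lt.1 hij), zero_pow two_ne_zero, zero_mul, sub_zero, zero_add]
          refine (abs_real_inner_le_norm _ _).trans ?_
          exact mul_le_mul_of_nonneg_left (h'.norm_blockCov_le_of_disjoint hT (not_lt.1 hij))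
            (norm_nonneg _)
      have hnum : ∑ j ∈ Finset.Icc 1 (T : ℤ), (if (j - i).natAbs < m then 2 * d * (m * A) else 0)
          ≤ 2 * m * (2 * d * (m * A)) := by
        rw [← Finset.sum_filter, Finset.sum_const, nsmul_eq_mul]
        refine mul_le_mul_of_nonneg_right ?_ (by positivity)
        have h1 : (Finset.Icc 1 (T : ℤ)).filter (fun j => (j - i).natAbs < m)
            ⊆ Finset.Ico (i - m) (i + m) := by
          intro j hj
          simp only [Finset.mem_filter, Finset.mem_Ico] at hj ⊢; omega
        have h2 := Finset.card_le_card h1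
        rw [Int.card_Ico] at h2
        have h3 : ((Finset.Icc 1 (T : ℤ)).filter (fun j => (j - i).natAbs < m)).card ≤ 2 * m := by
          omega
        exact_mod_cast h3
      have e1 : |Z i - (2 * (m : ℝ) ^ 3 + m) / 3 * G u|
          ≤ 2 * m * (2 * d * (m * A)) + (m : ℝ) ^ 2 * A * A := by
        rw [← sum_tri_sq (T := T) hint.1 (by omega), Finset.sum_mul, hZ]
        simp only
        rw [← Finset.sum_sub_distrib]
        refine (Finset.abs_sum_le_sum_abs _ _).trans ((Finset.sum_le_sum hper).trans ?_)
        rw [Finset.sum_add_distrib, ← Finset.sum_mul]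
        exact add_le_add hnum (mul_le_mul_of_nonneg_right (h.sum_norm_blockCov_le hT m i) hA0)
      have e2 : |(m : ℝ) / 3 * G u| ≤ (m : ℝ) ^ 2 * A ^ 2 := by
        rw [abs_mul, abs_of_pos (by positivity)]
        refine mul_le_mul ?_ (hGb u) (abs_nonneg _) (by positivity)
        nlinarith
      have e3 : Z i - 2 / 3 * (m : ℝ) ^ 3 * G u
          = (Z i - (2 * (m : ℝ) ^ 3 + m) / 3 * G u) + (m : ℝ) / 3 * G u := by ring
      rw [e3, add_zero]
      refine (abs_add_le _ _).trans ((add_le_add e1 e2).trans (le_of_eq ?_))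
      rw [hd]; ring
    · have e1 : |Z i| ≤ (m : ℝ) ^ 3 * A ^ 2 := by
        calc |Z i| ≤ ∑ j ∈ Finset.Icc 1 (T : ℤ), ‖blockCov c T m i j‖ * (m * A) := by
              refine (Finset.abs_sum_le_sum_abs _ _).trans (Finset.sum_le_sum fun j _ => ?_)
              exact (abs_real_inner_le_norm _ _).trans (mul_le_mul_of_nonneg_left
                (h'.norm_blockCov_le hT m i j) (norm_nonneg _))
          _ ≤ (m : ℝ) ^ 2 * A * (m * A) := by
              rw [← Finset.sum_mul]
              exact mul_le_mul_of_nonneg_right (h.sum_norm_blockCov_le hT m i) (by positivity)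
          _ = _ := by ring
      have e2 : |2 / 3 * (m : ℝ) ^ 3 * G u| ≤ (m : ℝ) ^ 3 * A ^ 2 := by
        rw [abs_mul, abs_of_pos (by positivity)]
        refine mul_le_mul ?_ (hGb u) (abs_nonneg _) (by positivity)
        linarith [pow_pos hm0 3]
      have e3 : 0 ≤ A ^ 2 * (8 * (m : ℝ) ^ 3 * Q + 6 * (m : ℝ) ^ 2) := by positivity
      linarith [abs_sub (Z i) (2 / 3 * (m : ℝ) ^ 3 * G u)]
  have hcount : ∑ i ∈ Finset.Icc 1 (T : ℤ),
      (if (m : ℤ) < i ∧ i + 2 * m ≤ T then (0 : ℝ) else 2 * (m : ℝ) ^ 3 * A ^ 2)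
      ≤ 3 * m * (2 * (m : ℝ) ^ 3 * A ^ 2) := by
    rw [Finset.sum_congr rfl fun i _ => (ite_not (p := (m : ℤ) < i ∧ i + 2 * m ≤ T) _ _).symm,
      ← Finset.sum_filter, Finset.sum_const, nsmul_eq_mul]
    refine mul_le_mul_of_nonneg_right ?_ (by positivity)
    have h1 : ((Finset.Icc 1 (T : ℤ)).filter fun i => ¬((m : ℤ) < i ∧ i + 2 * m ≤ T))
        ⊆ Finset.Icc 1 (m : ℤ) ∪ Finset.Ioc (T - 2 * m : ℤ) T := by
      intro s hs
      simp only [Finset.mem_filter, Finset.mem_Icc, Finset.mem_union, Finset.mem_Ioc] at hs ⊢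
      omega
    have h2 := (Finset.card_le_card h1).trans (Finset.card_union_le _ _)
    rw [Int.card_Icc, Int.card_Ioc] at h2
    have h3 : ((Finset.Icc 1 (T : ℤ)).filter fun i => ¬((m : ℤ) < i ∧ i + 2 * m ≤ T)).card
        ≤ 3 * m := by
      omega
    exact_mod_cast h3
  have step1 : |1 / ((T : ℝ) * (m : ℝ) ^ 3) * ∑ i ∈ Finset.Icc 1 (T : ℤ), Z i
      - 2 / 3 * ((1 / (T : ℝ)) • ∑ i ∈ Finset.Icc 1 (T : ℤ), G (gridPoint T i))|
      ≤ A ^ 2 * (8 * Q + 6 / m) + 6 * A ^ 2 * (m / T) := by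
    have e : 1 / ((T : ℝ) * (m : ℝ) ^ 3) * ∑ i ∈ Finset.Icc 1 (T : ℤ), Z i
        - 2 / 3 * ((1 / (T : ℝ)) • ∑ i ∈ Finset.Icc 1 (T : ℤ), G (gridPoint T i))
        = 1 / ((T : ℝ) * (m : ℝ) ^ 3) * ∑ i ∈ Finset.Icc 1 (T : ℤ),
          (Z i - 2 / 3 * (m : ℝ) ^ 3 * G (gridPoint T i)) := by
      rw [Finset.sum_sub_distrib, ← Finset.mul_sum, smul_eq_mul]
      field_simp
    rw [e, abs_mul, abs_of_pos (by positivity)]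
    calc _ ≤ 1 / ((T : ℝ) * (m : ℝ) ^ 3) * (∑ i ∈ Finset.Icc 1 (T : ℤ),
          (A ^ 2 * (8 * (m : ℝ) ^ 3 * Q + 6 * (m : ℝ) ^ 2)
            + if (m : ℤ) < i ∧ i + 2 * m ≤ T then 0 else 2 * (m : ℝ) ^ 3 * A ^ 2)) := by
          refine mul_le_mul_of_nonneg_left ?_ (by positivity)
          exact (Finset.abs_sum_le_sum_abs _ _).trans (Finset.sum_le_sum hbd)
      _ ≤ 1 / ((T : ℝ) * (m : ℝ) ^ 3) * (T * (A ^ 2 * (8 * (m : ℝ) ^ 3 * Q + 6 * (m : ℝ) ^ 2))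
            + 3 * m * (2 * (m : ℝ) ^ 3 * A ^ 2)) := by
          refine mul_le_mul_of_nonneg_left ?_ (by positivity)
          rw [Finset.sum_add_distrib, Finset.sum_const, nsmul_eq_mul, hcard]
          exact add_le_add le_rfl hcount
      _ = _ := by field_simp; ring
  have hGc : Continuous G := h.continuous_tsum_lim.inner h'.continuous_tsum_lim
  -- The long-run covariances are Hölder continuous of order 1/2 in `w`, so the Riemann sum has
  -- error of order `T^{-1/2}`.
  have step2 : ‖(1 / (T : ℝ)) • ∑ i ∈ Finset.Icc 1 (T : ℤ), G (gridPoint T i) - ∫ w, G w‖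
      ≤ 4 * A ^ 2 * (1 / √T) := by
    refine norm_riemann_sum_sub_integral_le hGc hT fun u w huw => ?_
    have hq : √|(u : ℝ) - w| ≤ 1 / √T := by
      rw [← Real.sqrt_one, ← Real.sqrt_div zero_le_one]
      exact Real.sqrt_le_sqrt huw
    have k1 : ‖∑' k, γ u k - ∑' k, γ w k‖ ≤ 2 * A * (1 / √T) := by
      refine (h.norm_tsum_sub_tsum_le u w).trans ?_
      rw [hA, show 2 * C * √|(u : ℝ) - w| * lagWeightSum ρ
        = 2 * (C * lagWeightSum ρ) * √|(u : ℝ) - w| by ring]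
      exact mul_le_mul_of_nonneg_left hq (by positivity)
    have k2 : ‖∑' k, γ' u k - ∑' k, γ' w k‖ ≤ 2 * A * (1 / √T) := by
      refine (h'.norm_tsum_sub_tsum_le u w).trans ?_
      rw [hA, show 2 * C * √|(u : ℝ) - w| * lagWeightSum ρ
        = 2 * (C * lagWeightSum ρ) * √|(u : ℝ) - w| by ring]
      exact mul_le_mul_of_nonneg_left hq (by positivity)
    refine (abs_inner_sub_inner_le (h'.norm_tsum_le u) (h.norm_tsum_le w) k1 k2).trans
      (le_of_eq ?_)
    ring
  rw [Real.norm_eq_abs] at step2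
  set g₀ := (1 / (T : ℝ)) • ∑ i ∈ Finset.Icc 1 (T : ℤ), G (gridPoint T i)
  have e : 1 / ((T : ℝ) * (m : ℝ) ^ 3) * ∑ i ∈ Finset.Icc 1 (T : ℤ), Z i - 2 / 3 * ∫ w, G w
      = (1 / ((T : ℝ) * (m : ℝ) ^ 3) * ∑ i ∈ Finset.Icc 1 (T : ℤ), Z i - 2 / 3 * g₀)
        + 2 / 3 * (g₀ - ∫ w, G w) := by ring
  rw [e]
  have r1 : 0 ≤ A ^ 2 * (1 / m) := by positivity
  have r2 : 0 ≤ A ^ 2 * (m / T) := by positivity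
  have r3 : 0 ≤ A ^ 2 * (1 / √T) := by positivity
  calc _ ≤ _ + _ := abs_add_le _ _
    _ ≤ (A ^ 2 * (8 * Q + 6 / m) + 6 * A ^ 2 * (m / T)) + 2 / 3 * (4 * A ^ 2 * (1 / √T)) := by
        refine add_le_add step1 ?_
        rw [abs_mul, abs_of_pos (by norm_num : (0 : ℝ) < 2 / 3)]
        exact mul_le_mul_of_nonneg_left step2 (by norm_num)
    _ = 8 * A ^ 2 * Q + 6 * (A ^ 2 * (1 / m)) + 6 * (A ^ 2 * (m / T))
        + 8 / 3 * (A ^ 2 * (1 / √T)) := by ring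
    _ ≤ 8 * A ^ 2 * Q + 8 * (A ^ 2 * (1 / m)) + 8 * (A ^ 2 * (m / T))
        + 8 * (A ^ 2 * (1 / √T)) := by linarith
    _ = _ := by ring

end Inner

end IsLocCov

/-! ### Variance of the sum of tensor squares: pairings and cumulants -/

section VarianceExpansion

open scoped RealInnerProductSpace

variable {H K : Type*} [NormedAddCommGroup H] [InnerProductSpace ℝ H]
  [NormedAddCommGroup K] [InnerProductSpace ℝ K]
  {Ω : Type*} {mΩ : MeasurableSpace Ω} {P : Measure Ω} [IsProbabilityMeasure P]

lemma integral_norm_sub_integral_sq [CompleteSpace K] {V : Ω → K} (hV : Integrable V P)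
    (hV2 : Integrable (fun ω => ⟪V ω, V ω⟫) P) :
    ∫ ω, ‖V ω - ∫ ω', V ω' ∂P‖ ^ 2 ∂P
      = ∫ ω, ⟪V ω, V ω⟫ ∂P - ⟪∫ ω, V ω ∂P, ∫ ω, V ω ∂P⟫ := by
  set e := ∫ ω', V ω' ∂P with he
  have h1 : ∀ ω, ‖V ω - e‖ ^ 2 = ⟪V ω, V ω⟫ - 2 * ⟪e, V ω⟫ + ⟪e, e⟫ := by
    intro ω
    rw [norm_sub_sq_real, real_inner_self_eq_norm_sq, real_inner_self_eq_norm_sq,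
      real_inner_comm]
  simp only [h1]
  have h2 : Integrable (fun ω => 2 * ⟪e, V ω⟫) P := (hV.const_inner e).const_mul 2
  have h3 : Integrable (fun ω => ⟪V ω, V ω⟫ - 2 * ⟪e, V ω⟫) P := hV2.sub h2
  rw [integral_add h3 (integrable_const _), integral_sub hV2 h2, integral_const_mul,
    integral_inner hV]
  simp only [integral_const, probReal_univ, one_smul]
  rw [← he]; ring

lemma integral_norm_sum_sub_sq [CompleteSpace K] {ι : Type*} (F : Finset ι) {y : ι → Ω → K}
    (hy : ∀ a ∈ F, Integrable (y a) P)
    (hy2 : ∀ a ∈ F, ∀ b ∈ F, Integrable (fun ω => ⟪y a ω, y b ω⟫) P) :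
    ∫ ω, ‖∑ a ∈ F, y a ω - ∫ ω', ∑ a ∈ F, y a ω' ∂P‖ ^ 2 ∂P
      = ∑ a ∈ F, ∑ b ∈ F, (∫ ω, ⟪y a ω, y b ω⟫ ∂P - ⟪∫ ω, y a ω ∂P, ∫ ω, y b ω ∂P⟫) := by
  have e : ∀ ω, ⟪∑ a ∈ F, y a ω, ∑ b ∈ F, y b ω⟫ = ∑ a ∈ F, ∑ b ∈ F, ⟪y a ω, y b ω⟫ := by
    intro ω
    rw [sum_inner]
    exact Finset.sum_congr rfl fun a _ => inner_sum _ _ _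
  have hi : ∀ a ∈ F, Integrable (fun ω => ∑ b ∈ F, ⟪y a ω, y b ω⟫) P :=
    fun a ha => integrable_finsetSum _ fun b hb => hy2 a ha b hb
  rw [integral_norm_sub_integral_sq (integrable_finsetSum _ hy)
    (by simpa only [e] using integrable_finsetSum _ hi)]
  simp only [e]
  rw [integral_finsetSum _ hi, integral_finsetSum _ hy, sum_inner, ← Finset.sum_sub_distrib]
  refine Finset.sum_congr rfl fun a ha => ?_
  rw [integral_finsetSum _ (hy2 a ha), inner_sum, ← Finset.sum_sub_distrib]

variable {B : H →L[ℝ] H →L[ℝ] K} {M β ρ : ℝ} {past future : ℤ → MeasurableSpace Ω} {x : ℤ → Ω → H}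

lemma IsCentredBounded.integrable_inner_mul_inner {x₁ x₂ x₃ x₄ : Ω → H}
    (h₁ : IsCentredBounded P M x₁) (h₂ : IsCentredBounded P M x₂) (h₃ : IsCentredBounded P M x₃)
    (h₄ : IsCentredBounded P M x₄) :
    Integrable (fun ω => ⟪x₁ ω, x₃ ω⟫ * ⟪x₂ ω, x₄ ω⟫) P := by
  have hi : ∀ {x : Ω → H}, IsCentredBounded P M x → Integrable (fun ω => ‖x ω‖ ^ 4) P :=
    fun hx => hx.int_pow (by norm_num)
  refine Integrable.mono' (((hi h₁).add (hi h₃)).add ((hi h₂).add (hi h₄)))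
    ((h₁.aesm_inner h₃).mul (h₂.aesm_inner h₄)) (Eventually.of_forall fun ω => ?_)
  simp only [Pi.add_apply, norm_mul]
  calc ‖⟪x₁ ω, x₃ ω⟫‖ * ‖⟪x₂ ω, x₄ ω⟫‖ ≤ (‖x₁ ω‖ * ‖x₃ ω‖) * (‖x₂ ω‖ * ‖x₄ ω‖) :=
        mul_le_mul (norm_inner_le_norm _ _) (norm_inner_le_norm _ _) (norm_nonneg _)
          (by positivity)
    _ ≤ _ := by
        have h2 : ∀ a b : ℝ, a * b ≤ a ^ 2 / 2 + b ^ 2 / 2 := fun a b => by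
          nlinarith [sq_nonneg (a - b)]
        have e1 := h2 (‖x₁ ω‖ * ‖x₃ ω‖) (‖x₂ ω‖ * ‖x₄ ω‖)
        have e2 := h2 (‖x₁ ω‖ ^ 2) (‖x₃ ω‖ ^ 2)
        have e3 := h2 (‖x₂ ω‖ ^ 2) (‖x₄ ω‖ ^ 2)
        have p1 := pow_nonneg (norm_nonneg (x₁ ω)) 4
        have p2 := pow_nonneg (norm_nonneg (x₂ ω)) 4
        have p3 := pow_nonneg (norm_nonneg (x₃ ω)) 4
        have p4 := pow_nonneg (norm_nonneg (x₄ ω)) 4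
        simp only [mul_pow, ← pow_mul] at e1 e2 e3
        norm_num at e1 e2 e3
        linarith

lemma sum_pow_le_lagWeightSum (h0 : 0 < ρ) (h1 : ρ < 1) (F : Finset ℤ) (s : ℤ) :
    ∑ t ∈ F, ρ ^ (t - s).natAbs ≤ lagWeightSum ρ := by
  have := sum_norm_le_lagWeightSum (f := fun t => ρ ^ (t - s).natAbs) h1 zero_le_one s F
    fun t _ => by
      rw [Real.norm_of_nonneg (by positivity), one_mul]
      exact pow_le_lagWeight h0 h1 _
  rw [one_mul] at this
  refine le_trans (Finset.sum_le_sum fun t _ => ?_) this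
  exact le_abs_self _

/-- For given `a`, the decay makes the sums over `b`, `c` and `d` bounded. What remains is at most
`Tm` choices of `(i, a)` and at most `m` blocks `j` containing `c`. -/
lemma sum_cumulant_bound_le (h0 : 0 < ρ) (h1 : ρ < 1) (T m : ℕ) :
    ∑ i ∈ Finset.Icc 1 (T : ℤ), ∑ a ∈ block T m i, ∑ b ∈ block T m i,
      ∑ j ∈ Finset.Icc 1 (T : ℤ), ∑ c ∈ block T m j, ∑ d ∈ block T m j,
        ρ ^ ((b - a).natAbs + (c - a).natAbs + (d - a).natAbs)
      ≤ lagWeightSum ρ ^ 3 * (T * (m : ℝ) ^ 2) := by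
  set S := lagWeightSum ρ
  have hS : 0 ≤ S := lagWeightSum_nonneg
  have k1 : ∀ a : ℤ, ∑ j ∈ Finset.Icc 1 (T : ℤ), ∑ c ∈ block T m j, ∑ d ∈ block T m j,
      ρ ^ (c - a).natAbs * ρ ^ (d - a).natAbs ≤ m * S * S := by
    intro a
    calc _ ≤ ∑ j ∈ Finset.Icc 1 (T : ℤ), ∑ c ∈ block T m j, ρ ^ (c - a).natAbs * S := by
          refine Finset.sum_le_sum fun j _ => Finset.sum_le_sum fun c _ => ?_
          rw [← Finset.mul_sum]
          exact mul_le_mul_of_nonneg_left (sum_pow_le_lagWeightSum h0 h1 _ _) (by positivity)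
      _ ≤ m * ∑ c ∈ Finset.Icc 1 (T : ℤ), ρ ^ (c - a).natAbs * S :=
          sum_sum_block_le fun t => by positivity
      _ ≤ m * (S * S) := by
          rw [← Finset.sum_mul]
          exact mul_le_mul_of_nonneg_left (mul_le_mul_of_nonneg_right
            (sum_pow_le_lagWeightSum h0 h1 _ _) hS) (Nat.cast_nonneg m)
      _ = _ := by ring
  calc _ ≤ ∑ i ∈ Finset.Icc 1 (T : ℤ), ∑ a ∈ block T m i, ∑ b ∈ block T m i,
        ρ ^ (b - a).natAbs * (m * S * S) := by
        refine Finset.sum_le_sum fun i _ => Finset.sum_le_sum fun a _ =>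
          Finset.sum_le_sum fun b _ => ?_
        refine le_trans (le_of_eq ?_) (mul_le_mul_of_nonneg_left (k1 a)
          (by positivity : 0 ≤ ρ ^ (b - a).natAbs))
        simp only [pow_add, mul_assoc, Finset.mul_sum]
    _ ≤ ∑ i ∈ Finset.Icc 1 (T : ℤ), ∑ a ∈ block T m i, S * (m * S * S) := by
        refine Finset.sum_le_sum fun i _ => Finset.sum_le_sum fun a _ => ?_
        rw [← Finset.sum_mul]
        exact mul_le_mul_of_nonneg_right (sum_pow_le_lagWeightSum h0 h1 _ _) (by positivity)
    _ ≤ ∑ i ∈ Finset.Icc 1 (T : ℤ), m * (S * (m * S * S)) := by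
        refine Finset.sum_le_sum fun i _ => ?_
        rw [Finset.sum_const, nsmul_eq_mul]
        have : ((block T m i).card : ℝ) ≤ m := by exact_mod_cast card_block_le T m i
        gcongr
    _ = _ := by
        rw [Finset.sum_const, Int.card_Icc, nsmul_eq_mul]
        simp only [add_sub_cancel_right, Int.toNat_natCast]
        ring

/-- The variance of the sum of the tensor squares of all block sums consists of the products of two
covariances, up to the cumulants. -/
theorem IsMixingSeq.abs_variance_sub_le [CompleteSpace H] [CompleteSpace K]
    [SecondCountableTopology H] [SecondCountableTopology K]
    (hx : IsMixingSeq P past future M β ρ x) (hB : IsTensor B) (hM : 1 ≤ M) (hβ : 0 < β)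
    (h0 : 0 < ρ) (h1 : ρ < 1) (T m : ℕ) :
    |∫ ω, ‖∑ i ∈ Finset.Icc 1 (T : ℤ), B (∑ s ∈ block T m i, x s ω) (∑ s ∈ block T m i, x s ω)
          - ∫ ω', ∑ i ∈ Finset.Icc 1 (T : ℤ),
            B (∑ s ∈ block T m i, x s ω') (∑ s ∈ block T m i, x s ω') ∂P‖ ^ 2 ∂P
        - ∑ i ∈ Finset.Icc 1 (T : ℤ), ∑ j ∈ Finset.Icc 1 (T : ℤ),
          (⟪blockCov (fun _ s t => ∫ ω, ⟪x s ω, x t ω⟫ ∂P) T m i j,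
              blockCov (fun _ s t => ∫ ω, ⟪x s ω, x t ω⟫ ∂P) T m i j⟫
            + ⟪blockCov (fun _ s t => ∫ ω, B (x s ω) (x t ω) ∂P) T m i j,
              blockCov (fun _ s t => ∫ ω, B (x t ω) (x s ω) ∂P) T m i j⟫)|
      ≤ 700 * M ^ 2 * β * (lagWeightSum ρ ^ 3 * (T * (m : ℝ) ^ 2)) := by
  -- An index is a block with an ordered pair of its times, so that the variance becomes a double
  -- sum of covariances of tensors.
  set F : Finset (Σ _ : ℤ, ℤ × ℤ) :=
    (Finset.Icc 1 (T : ℤ)).sigma fun i => block T m i ×ˢ block T m i with hF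
  set y : (Σ _ : ℤ, ℤ × ℤ) → Ω → K := fun p ω => B (x p.2.1 ω) (x p.2.2 ω) with hy
  have hsum : ∀ ω, ∑ i ∈ Finset.Icc 1 (T : ℤ),
      B (∑ s ∈ block T m i, x s ω) (∑ s ∈ block T m i, x s ω) = ∑ p ∈ F, y p ω := by
    intro ω
    rw [hF, Finset.sum_sigma]
    refine Finset.sum_congr rfl fun i _ => ?_
    rw [Finset.sum_product]
    simp only [map_sum, sum_apply, hy]
    rw [Finset.sum_comm]
  have hyi : ∀ p, Integrable (y p) P := fun p =>
    (IsCentredBounded.integrable_of_norm_le_mul (hx.bdd p.2.1) (hx.bdd p.2.2)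
      (IsCentredBounded.aesm_tensor (B := B) (hx.bdd _).meas (hx.bdd _).meas)
      (fun ω => (hB.norm_apply _ _).le) hM).1.1
  have hyi2 : ∀ p q, Integrable (fun ω => ⟪y p ω, y q ω⟫) P := fun p q => by
    simp only [hy, hB _ _ _ _]
    exact (hx.bdd _).integrable_inner_mul_inner (hx.bdd _) (hx.bdd _) (hx.bdd _)
  simp only [hsum]
  rw [integral_norm_sum_sub_sq F (fun p _ => hyi p) fun p _ q _ => hyi2 p q]
  have hconv : ∀ f : ℤ → ℤ → ℤ → ℤ → ℝ, ∑ p ∈ F, ∑ q ∈ F, f p.2.1 p.2.2 q.2.1 q.2.2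
      = ∑ i ∈ Finset.Icc 1 (T : ℤ), ∑ a ∈ block T m i, ∑ b ∈ block T m i,
        ∑ j ∈ Finset.Icc 1 (T : ℤ), ∑ c ∈ block T m j, ∑ d ∈ block T m j, f a b c d := by
    intro f
    rw [hF, Finset.sum_sigma]
    refine Finset.sum_congr rfl fun i _ => ?_
    rw [Finset.sum_product]
    refine Finset.sum_congr rfl fun a _ => Finset.sum_congr rfl fun b _ => ?_
    rw [Finset.sum_sigma]
    refine Finset.sum_congr rfl fun j _ => ?_
    rw [Finset.sum_product]
  set tr : ℤ → ℤ → ℝ := fun s t => ∫ ω, ⟪x s ω, x t ω⟫ ∂P with htr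
  set cv : ℤ → ℤ → K := fun s t => ∫ ω, B (x s ω) (x t ω) ∂P with hcv
  have hpairs : ∑ i ∈ Finset.Icc 1 (T : ℤ), ∑ j ∈ Finset.Icc 1 (T : ℤ),
      (⟪blockCov (fun _ s t => tr s t) T m i j, blockCov (fun _ s t => tr s t) T m i j⟫
        + ⟪blockCov (fun _ s t => cv s t) T m i j, blockCov (fun _ s t => cv t s) T m i j⟫)
      = ∑ p ∈ F, ∑ q ∈ F, (tr p.2.1 q.2.1 * tr p.2.2 q.2.2
        + ⟪cv p.2.1 q.2.2, cv q.2.1 p.2.2⟫) := by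
    rw [hconv fun a b c d => tr a c * tr b d + ⟪cv a d, cv c b⟫]
    refine Finset.sum_congr rfl fun i _ => ?_
    have e1 : ∀ j, ⟪blockCov (fun _ s t => tr s t) T m i j, blockCov (fun _ s t => tr s t) T m i j⟫
        = ∑ a ∈ block T m i, ∑ b ∈ block T m i, ∑ c ∈ block T m j, ∑ d ∈ block T m j,
          tr a c * tr b d := by
      intro j
      simp only [RCLike.inner_apply, conj_trivial, blockCov]
      rw [Finset.sum_mul_sum]
      refine Finset.sum_congr rfl fun a _ => Finset.sum_congr rfl fun b _ => ?_
      rw [Finset.sum_mul_sum]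
    have e2 : ∀ j, ⟪blockCov (fun _ s t => cv s t) T m i j, blockCov (fun _ s t => cv t s) T m i j⟫
        = ∑ a ∈ block T m i, ∑ b ∈ block T m i, ∑ c ∈ block T m j, ∑ d ∈ block T m j,
          ⟪cv a d, cv c b⟫ := by
      intro j
      simp only [blockCov]
      rw [sum_inner]
      refine Finset.sum_congr rfl fun a _ => ?_
      rw [inner_sum]
      refine Finset.sum_congr rfl fun b _ => ?_
      rw [inner_sum]
      refine Finset.sum_congr rfl fun c _ => ?_
      rw [sum_inner]
    simp only [e1, e2, ← Finset.sum_add_distrib]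
    rw [Finset.sum_comm]
    refine Finset.sum_congr rfl fun a _ => ?_
    rw [Finset.sum_comm]
  rw [hpairs, ← Finset.sum_sub_distrib]
  simp only [← Finset.sum_sub_distrib]
  -- Centring subtracts the pairing inside the blocks; removing the two cross pairings leaves
  -- exactly the cumulant.
  have hcum : ∀ p q : Σ _ : ℤ, ℤ × ℤ, ∫ ω, ⟪y p ω, y q ω⟫ ∂P - ⟪∫ ω, y p ω ∂P, ∫ ω, y q ω ∂P⟫
      - (tr p.2.1 q.2.1 * tr p.2.2 q.2.2 + ⟪cv p.2.1 q.2.2, cv q.2.1 p.2.2⟫)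
      = cumFour P B (x p.2.1) (x p.2.2) (x q.2.1) (x q.2.2) := by
    intro p q
    simp only [hy, hB _ _ _ _, cumFour, htr, hcv]
    ring
  simp only [hcum]
  calc _ ≤ ∑ p ∈ F, ∑ q ∈ F, 700 * M ^ 2 * β * ρ ^ ((p.2.2 - p.2.1).natAbs
        + (q.2.1 - p.2.1).natAbs + (q.2.2 - p.2.1).natAbs) := by
        refine (Finset.abs_sum_le_sum_abs _ _).trans (Finset.sum_le_sum fun p _ => ?_)
        refine (Finset.abs_sum_le_sum_abs _ _).trans (Finset.sum_le_sum fun q _ => ?_)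
        exact hx.abs_cumFour_le hB hM hβ h0 h1 _ _ _ _
    _ = 700 * M ^ 2 * β * ∑ p ∈ F, ∑ q ∈ F, ρ ^ ((p.2.2 - p.2.1).natAbs
        + (q.2.1 - p.2.1).natAbs + (q.2.2 - p.2.1).natAbs) := by
        simp only [Finset.mul_sum]
    _ ≤ _ := by
        rw [hconv fun a b c d => ρ ^ ((b - a).natAbs + (c - a).natAbs + (d - a).natAbs)]
        exact mul_le_mul_of_nonneg_left (sum_cumulant_bound_le h0 h1 T m) (by positivity)

end VarianceExpansion

/-! ### Passage from functions to classes in `L²` -/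

section ToL2

open scoped RealInnerProductSpace

variable {S : Type*} [MeasureSpace S] {f g : S → ℝ}

lemma toL2_of_memLp (hf : MemLp f 2 volume) : toL2 f = hf.toLp f := dif_pos hf

lemma coeFn_toL2 (hf : MemLp f 2 volume) : toL2 f =ᵐ[volume] f := by
  rw [toL2_of_memLp hf]
  exact hf.coeFn_toLp

lemma toL2_coeFn (f : Lp ℝ 2 (volume : Measure S)) : toL2 (f : S → ℝ) = f := by
  rw [toL2_of_memLp (Lp.memLp f), Lp.toLp_coeFn]

lemma toL2_congr (h : f =ᵐ[volume] g) : toL2 f = toL2 g := by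
  by_cases hf : MemLp f 2 volume
  · have hg := (memLp_congr_ae h).1 hf
    rw [toL2_of_memLp hf, toL2_of_memLp hg, MemLp.toLp_eq_toLp_iff]
    exact h
  · have hg : ¬ MemLp g 2 volume := fun hg => hf ((memLp_congr_ae h).2 hg)
    rw [toL2, toL2, dif_neg hf, dif_neg hg]

lemma toL2_eq_of_ae {f : S → ℝ} {F : Lp ℝ 2 (volume : Measure S)} (h : f =ᵐ[volume] F) :
    toL2 f = F := by
  rw [toL2_congr h, toL2_coeFn]

lemma toL2_add (hf : MemLp f 2 volume) (hg : MemLp g 2 volume) :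
    toL2 (fun s => f s + g s) = toL2 f + toL2 g := by
  rw [toL2_of_memLp hf, toL2_of_memLp hg, ← MemLp.toLp_add hf hg, ← toL2_of_memLp (hf.add hg)]
  rfl

lemma toL2_sub (hf : MemLp f 2 volume) (hg : MemLp g 2 volume) :
    toL2 (fun s => f s - g s) = toL2 f - toL2 g := by
  rw [toL2_of_memLp hf, toL2_of_memLp hg, ← MemLp.toLp_sub hf hg, ← toL2_of_memLp (hf.sub hg)]
  rfl

lemma toL2_const_mul (c : ℝ) (hf : MemLp f 2 volume) :
    toL2 (fun s => c * f s) = c • toL2 f := by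
  rw [toL2_of_memLp hf, ← MemLp.toLp_const_smul c hf, ← toL2_of_memLp (hf.const_smul c)]
  rfl

lemma toL2_sum {ι : Type*} (A : Finset ι) {f : ι → S → ℝ}
    (hf : ∀ i ∈ A, MemLp (f i) 2 volume) :
    toL2 (fun s => ∑ i ∈ A, f i s) = ∑ i ∈ A, toL2 (f i) := by
  classical
  induction A using Finset.induction_on with
  | empty =>
    simp only [Finset.sum_empty]
    exact toL2_eq_of_ae (Lp.coeFn_zero _ _ _).symm
  | insert a A ha ih =>
    simp only [Finset.sum_insert ha]
    rw [toL2_add (hf a (Finset.mem_insert_self a A))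
      (memLp_finsetSum A fun i hi => hf i (Finset.mem_insert_of_mem hi)),
      ih fun i hi => hf i (Finset.mem_insert_of_mem hi)]

lemma inner_toL2 (hf : MemLp f 2 volume) (hg : MemLp g 2 volume) :
    ⟪toL2 f, toL2 g⟫ = ∫ s, f s * g s := by
  rw [L2.inner_def]
  refine integral_congr_ae ?_
  filter_upwards [coeFn_toL2 hf, coeFn_toL2 hg] with s h1 h2
  simp only [h1, h2, RCLike.inner_apply, conj_trivial, mul_comm]

lemma norm_toL2_sq (hf : MemLp f 2 volume) : ‖toL2 f‖ ^ 2 = ∫ s, f s ^ 2 := by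
  rw [← real_inner_self_eq_norm_sq, inner_toL2 hf hf]
  simp only [sq]

lemma enorm_toL2 (hf : MemLp f 2 volume) : ‖toL2 f‖ₑ = eLpNorm f 2 volume := by
  rw [toL2_of_memLp hf, Lp.enorm_def]
  exact eLpNorm_congr_ae hf.coeFn_toLp

end ToL2

/-! ### The tensor product of `L²([0,1])` with itself -/

section TensorProduct

open scoped RealInnerProductSpace

variable {f g : I → ℝ}

lemma memLp_mul_prod (hf : MemLp f 2 volume) (hg : MemLp g 2 volume) :
    MemLp (fun p : I × I => f p.1 * g p.2) 2 volume := by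
  rw [memLp_two_iff_integrable_sq]
  · simp only [mul_pow]
    exact hf.integrable_sq.mul_prod hg.integrable_sq
  · exact (hf.1.comp_fst).mul (hg.1.comp_snd)

lemma toL2_mul_congr {f' g' : I → ℝ} (hf : f =ᵐ[volume] f') (hg : g =ᵐ[volume] g') :
    toL2 (fun p : I × I => f p.1 * g p.2) = toL2 (fun p : I × I => f' p.1 * g' p.2) := by
  refine toL2_congr ?_
  filter_upwards [Measure.quasiMeasurePreserving_fst.ae hf,
    Measure.quasiMeasurePreserving_snd.ae hg] with p h1 h2
  rw [h1, h2]

lemma inner_toL2_mul {f' g' : I → ℝ} (hf : MemLp f 2 volume) (hg : MemLp g 2 volume)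
    (hf' : MemLp f' 2 volume) (hg' : MemLp g' 2 volume) :
    ⟪toL2 (fun p : I × I => f p.1 * g p.2), toL2 (fun p : I × I => f' p.1 * g' p.2)⟫
      = ⟪toL2 f, toL2 f'⟫ * ⟪toL2 g, toL2 g'⟫ := by
  rw [inner_toL2 (memLp_mul_prod hf hg) (memLp_mul_prod hf' hg'), inner_toL2 hf hf',
    inner_toL2 hg hg', ← integral_prod_mul]
  refine integral_congr_ae (Eventually.of_forall fun p => ?_)
  simp only
  ring

/-- The tensor product `(f, g) ↦ f ⊗ g` from `L²([0,1])` to `L²([0,1]²)`. -/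
noncomputable def tensorL2 : L2I →L[ℝ] L2I →L[ℝ] L2II :=
  LinearMap.mkContinuous₂
    (LinearMap.mk₂ ℝ (fun f g : L2I => toL2 fun p : I × I => f p.1 * g p.2)
      (fun f f' g => by
        rw [← toL2_add (memLp_mul_prod (Lp.memLp f) (Lp.memLp g))
          (memLp_mul_prod (Lp.memLp f') (Lp.memLp g)),
          toL2_mul_congr (Lp.coeFn_add f f') (ae_eq_refl g)]
        simp only [Pi.add_apply, add_mul])
      (fun c f g => by
        rw [← toL2_const_mul c (memLp_mul_prod (Lp.memLp f) (Lp.memLp g)),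
          toL2_mul_congr (Lp.coeFn_smul c f) (ae_eq_refl g)]
        simp only [Pi.smul_apply, smul_eq_mul, mul_assoc])
      (fun f g g' => by
        rw [← toL2_add (memLp_mul_prod (Lp.memLp f) (Lp.memLp g))
          (memLp_mul_prod (Lp.memLp f) (Lp.memLp g')),
          toL2_mul_congr (ae_eq_refl f) (Lp.coeFn_add g g')]
        simp only [Pi.add_apply, mul_add])
      (fun c f g => by
        rw [← toL2_const_mul c (memLp_mul_prod (Lp.memLp f) (Lp.memLp g)),
          toL2_mul_congr (ae_eq_refl f) (Lp.coeFn_smul c g)]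
        simp only [Pi.smul_apply, smul_eq_mul, mul_left_comm]))
    1 (fun f g => by
      have h := inner_toL2_mul (Lp.memLp f) (Lp.memLp g) (Lp.memLp f) (Lp.memLp g)
      simp only [toL2_coeFn, real_inner_self_eq_norm_sq, ← mul_pow] at h
      rw [one_mul]
      exact ((pow_left_inj₀ (norm_nonneg _) (by positivity) two_ne_zero).1 h).le)

lemma tensorL2_apply (f g : L2I) : tensorL2 f g = toL2 fun p : I × I => f p.1 * g p.2 := rfl

lemma tensorL2_toL2 (hf : MemLp f 2 volume) (hg : MemLp g 2 volume) :
    tensorL2 (toL2 f) (toL2 g) = toL2 fun p : I × I => f p.1 * g p.2 :=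
  toL2_mul_congr (coeFn_toL2 hf) (coeFn_toL2 hg)

theorem isTensor_tensorL2 : IsTensor tensorL2 := fun x y x' y' => by
  rw [tensorL2_apply, tensorL2_apply,
    inner_toL2_mul (Lp.memLp x) (Lp.memLp y) (Lp.memLp x') (Lp.memLp y')]
  simp only [toL2_coeFn]

end TensorProduct

/-! ### Weak and strong measurability -/

section WeakMeasurability

open scoped RealInnerProductSpace

variable {H : Type*} [NormedAddCommGroup H] [InnerProductSpace ℝ H] [CompleteSpace H]

lemma stronglyMeasurable_limUnder_sum {Ω ι : Type*} {m : MeasurableSpace Ω} [Countable ι]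
    {z : ι → Ω → ℝ} {b : ι → H} (hz : ∀ i, StronglyMeasurable (z i)) :
    StronglyMeasurable fun ω => limUnder atTop fun A : Finset ι => ∑ i ∈ A, z i ω • b i :=
  StronglyMeasurable.limUnder fun A =>
    Finset.stronglyMeasurable_fun_sum A fun i _ => (hz i).smul_const (b i)

variable [SecondCountableTopology H] {Ω : Type*} {𝓕 mΩ : MeasurableSpace Ω} {P : Measure Ω}

/-- Weakly measurable maps into a separable Hilbert space are strongly measurable. -/
theorem aestronglyMeasurable_of_inner {f : Ω → H}
    (h : ∀ g, AEStronglyMeasurable[𝓕] (fun ω => ⟪g, f ω⟫) P) : AEStronglyMeasurable[𝓕] f P := by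
  obtain ⟨w, b, -⟩ := exists_hilbertBasis ℝ H
  have : Countable w := countable_of_orthonormal b.orthonormal
  -- The countably many coordinates are replaced by measurable versions, and `f` is recovered almost
  -- surely as the limit of the partial sums of its expansion.
  choose z hz hfz using fun i : w => h (b i)
  refine ⟨fun ω => limUnder atTop fun A : Finset w => ∑ i ∈ A, z i ω • b i,
    stronglyMeasurable_limUnder_sum hz, ?_⟩
  filter_upwards [ae_all_iff.2 hfz] with ω hω
  have hs := b.hasSum_repr (f ω)
  simp only [b.repr_apply_apply, hω] at hs
  exact (Tendsto.limUnder_eq hs).symm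

end WeakMeasurability

/-! ### Square integrable random fields as random elements of `L²` -/

section SquareField

open scoped RealInnerProductSpace

/-- A jointly measurable random field which is square integrable with respect to the product
measure. -/
structure IsSquareField {S Ω : Type*} [MeasureSpace S] {mΩ : MeasurableSpace Ω} (P : Measure Ω)
    (F : S → Ω → ℝ) : Prop where
  meas : Measurable (Function.uncurry F)
  memLp : MemLp (Function.uncurry F) 2 (volume.prod P)

variable {S : Type*} [MeasureSpace S] {Ω : Type*} {𝓕 : MeasurableSpace Ω}
  {mΩ : MeasurableSpace Ω} {P : Measure Ω}

section ConditionalExpectation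

variable [IsProbabilityMeasure P]

/-- Conditional expectation is self-adjoint: conditioning either product on `𝓕` yields the product
of the two conditional expectations. -/
lemma integral_mul_condExp_comm (h𝓕 : 𝓕 ≤ mΩ) {κ h : Ω → ℝ} {R : ℝ} (hκm : Integrable κ P)
    (hκ : ∀ᵐ ω ∂P, |κ ω| ≤ R) (hh : Integrable h P) :
    ∫ ω, κ ω * (P[h | 𝓕]) ω ∂P = ∫ ω, (P[κ | 𝓕]) ω * h ω ∂P := by
  have b1 : Integrable (κ * P[h | 𝓕]) P :=
    integrable_condExp.bdd_mul hκm.1 hκ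
  have b2 : Integrable (P[κ | 𝓕] * h) P :=
    hh.bdd_mul integrable_condExp.1 (ae_bdd_abs_condExp_of_ae_bdd_abs hκ)
  have e1 := condExp_mul_of_stronglyMeasurable_right (m := 𝓕) stronglyMeasurable_condExp b1 hκm
  have e2 := condExp_mul_of_stronglyMeasurable_left (m := 𝓕) stronglyMeasurable_condExp b2 hh
  calc ∫ ω, κ ω * (P[h | 𝓕]) ω ∂P = ∫ ω, (P[κ * P[h | 𝓕] | 𝓕]) ω ∂P :=
        (integral_condExp h𝓕).symm
    _ = ∫ ω, (P[P[κ | 𝓕] * h | 𝓕]) ω ∂P := integral_congr_ae (e1.trans e2.symm)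
    _ = _ := integral_condExp h𝓕

/-- A random variable which has the same mean over every event as its conditional expectation is
measurable with respect to the conditioning σ-field. -/
lemma aestronglyMeasurable_of_integral_mul_condExp (h𝓕 : 𝓕 ≤ mΩ) {h : Ω → ℝ}
    (hh : Integrable h P)
    (heq : ∀ A, MeasurableSet A → ∫ ω, (P[A.indicator (fun _ => (1 : ℝ)) | 𝓕]) ω * h ω ∂P
      = ∫ ω, A.indicator (fun _ => (1 : ℝ)) ω * h ω ∂P) :
    AEStronglyMeasurable[𝓕] h P := by
  refine ⟨P[h | 𝓕], stronglyMeasurable_condExp, ?_⟩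
  refine Integrable.ae_eq_of_forall_setIntegral_eq h (P[h | 𝓕]) hh integrable_condExp
    fun A hA _ => ?_
  have hi : ∀ f : Ω → ℝ, ∫ ω in A, f ω ∂P = ∫ ω, A.indicator (fun _ => (1 : ℝ)) ω * f ω ∂P := by
    intro f
    rw [← integral_indicator hA]
    refine integral_congr_ae (Eventually.of_forall fun ω => ?_)
    by_cases hω : ω ∈ A <;> simp [hω]
  rw [hi, hi, ← heq A hA, integral_mul_condExp_comm (R := 1) h𝓕
    ((integrable_const _).indicator hA) (Eventually.of_forall fun ω => ?_) hh]
  by_cases hω : ω ∈ A <;> simp [hω]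

end ConditionalExpectation

namespace IsSquareField

variable {F G : S → Ω → ℝ}

lemma integrable_sq (hF : IsSquareField P F) :
    Integrable (fun z : S × Ω => F z.1 z.2 ^ 2) (volume.prod P) := hF.memLp.integrable_sq

lemma integrable_mul (hF : IsSquareField P F) (hG : IsSquareField P G) :
    Integrable (fun z : S × Ω => F z.1 z.2 * G z.1 z.2) (volume.prod P) :=
  hF.memLp.integrable_mul hG.memLp

lemma measurable_apply (hF : IsSquareField P F) (s : S) : Measurable (F s) :=
  hF.meas.comp measurable_prodMk_left

variable [IsProbabilityMeasure P]

lemma of_fun {g : S → ℝ} (hg : Measurable g) (hg2 : MemLp g 2 volume) :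
    IsSquareField P fun s (_ : Ω) => g s :=
  ⟨hg.comp measurable_fst, hg2.comp_fst P⟩

lemma integrable_integral_mul (hF : IsSquareField P F) (hG : IsSquareField P G) :
    Integrable (fun s => ∫ ω, F s ω * G s ω ∂P) volume := (hF.integrable_mul hG).integral_prod_left

variable [IsFiniteMeasure (volume : Measure S)]

lemma ae_memLp_path (hF : IsSquareField P F) : ∀ᵐ ω ∂P, MemLp (fun s => F s ω) 2 volume := by
  filter_upwards [hF.integrable_sq.prod_left_ae] with ω hω
  exact (memLp_two_iff_integrable_sq
    (hF.meas.comp measurable_prodMk_right).aestronglyMeasurable).2 hω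

lemma ae_memLp_apply (hF : IsSquareField P F) : ∀ᵐ s, MemLp (F s) 2 P := by
  filter_upwards [hF.integrable_sq.prod_right_ae] with s hs
  exact (memLp_two_iff_integrable_sq (hF.measurable_apply s).aestronglyMeasurable).2 hs

lemma of_integrable_norm_sq (hm : Measurable (Function.uncurry F))
    (hp : ∀ᵐ ω ∂P, MemLp (fun s => F s ω) 2 volume)
    (hi : Integrable (fun ω => ‖toL2 (fun s => F s ω)‖ ^ 2) P) : IsSquareField P F := by
  refine ⟨hm, (memLp_two_iff_integrable_sq hm.aestronglyMeasurable).2 ?_⟩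
  rw [integrable_prod_iff' (hm.pow_const 2).aestronglyMeasurable]
  refine ⟨hp.mono fun ω hω => hω.integrable_sq, hi.congr ?_⟩
  filter_upwards [hp] with ω hω
  rw [norm_toL2_sq hω]
  refine integral_congr_ae (Eventually.of_forall fun s => ?_)
  simp [Function.uncurry]

lemma integral_inner_path (hF : IsSquareField P F) (hG : IsSquareField P G) :
    ∫ ω, ⟪toL2 (fun s => F s ω), toL2 (fun s => G s ω)⟫ ∂P = ∫ s, ∫ ω, F s ω * G s ω ∂P := by
  rw [integral_integral_swap (hF.integrable_mul hG)]
  refine integral_congr_ae ?_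
  filter_upwards [hF.ae_memLp_path, hG.ae_memLp_path] with ω h1 h2
  exact inner_toL2 h1 h2

lemma integrable_norm_sq_path (hF : IsSquareField P F) :
    Integrable (fun ω => ‖toL2 (fun s => F s ω)‖ ^ 2) P := by
  refine hF.integrable_sq.integral_prod_right.congr ?_
  filter_upwards [hF.ae_memLp_path] with ω h1
  exact (norm_toL2_sq h1).symm

lemma integral_norm_sq_path (hF : IsSquareField P F) :
    ∫ ω, ‖toL2 (fun s => F s ω)‖ ^ 2 ∂P = ∫ s, ∫ ω, F s ω ^ 2 ∂P := by
  have := hF.integral_inner_path hF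
  simp only [real_inner_self_eq_norm_sq, ← sq] at this
  exact this

/-- The squared mean is at most the second moment, because a variance is nonnegative. -/
lemma memLp_integral (hF : IsSquareField P F) : MemLp (fun s => ∫ ω, F s ω ∂P) 2 volume := by
  have hm := hF.meas.stronglyMeasurable.integral_prod_right (ν := P)
  rw [memLp_two_iff_integrable_sq hm.aestronglyMeasurable]
  refine Integrable.mono' hF.integrable_sq.integral_prod_left
    (hm.measurable.pow_const 2).aestronglyMeasurable ?_
  filter_upwards [hF.ae_memLp_apply] with s hs
  have h1 := variance_nonneg (F s) P
  rw [variance_eq_sub hs] at h1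
  rw [Real.norm_of_nonneg (sq_nonneg _)]
  exact sub_nonneg.1 h1

variable [SecondCountableTopology (Lp ℝ 2 (volume : Measure S))]

/-- The `L²`-valued random element of a field is measurable with respect to every σ-field for which
the values of the field are measurable. -/
theorem aestronglyMeasurable_path (hF : IsSquareField P F) (h𝓕 : 𝓕 ≤ mΩ)
    (hFm : ∀ s, Measurable[𝓕] (F s)) :
    AEStronglyMeasurable[𝓕] (fun ω => toL2 (fun s => F s ω)) P := by
  -- The field is jointly measurable only with respect to the full σ-field, so Fubini does not give
  -- `𝓕`-measurability of `∫ g F ds`. Instead, indicators of events are tested against their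
  -- conditional expectations; Fubini moves this test inside the integral over `s`, where `F s` is
  -- `𝓕`-measurable.
  refine aestronglyMeasurable_of_inner fun g => ?_
  obtain ⟨g', hg'm, hgg'⟩ := (Lp.memLp g).1
  have hg2 : MemLp g' 2 volume := (memLp_congr_ae hgg').1 (Lp.memLp g)
  have hgf : IsSquareField P fun s (_ : Ω) => g' s := of_fun hg'm.measurable hg2
  have hZ : (fun ω => ⟪g, toL2 (fun s => F s ω)⟫) =ᵐ[P] fun ω => ∫ s, g' s * F s ω := by
    filter_upwards [hF.ae_memLp_path] with ω hω
    rw [← inner_toL2 hg2 hω, toL2_eq_of_ae hgg'.symm]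
  refine AEStronglyMeasurable.congr ?_ hZ.symm
  have hint := hgf.integrable_mul hF
  refine aestronglyMeasurable_of_integral_mul_condExp h𝓕 hint.integral_prod_right fun A hA => ?_
  have key : ∀ κ : Ω → ℝ, AEStronglyMeasurable κ P → (∀ᵐ ω ∂P, |κ ω| ≤ (1 : ℝ)) →
      ∫ ω, κ ω * (∫ s, g' s * F s ω) ∂P = ∫ s, g' s * ∫ ω, κ ω * F s ω ∂P := by
    intro κ hκm hκ
    have hi : Integrable (fun z : S × Ω => κ z.2 * (g' z.1 * F z.1 z.2)) (volume.prod P) :=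
      hint.bdd_mul hκm.comp_snd (Measure.quasiMeasurePreserving_snd.ae hκ)
    simp only [← integral_const_mul]
    rw [← integral_integral_swap hi]
    simp only [mul_left_comm]
  have h1A : ∀ ω, |A.indicator (fun _ => (1 : ℝ)) ω| ≤ 1 := fun ω => by
    by_cases hω : ω ∈ A <;> simp [hω]
  have hAi : Integrable (A.indicator fun _ => (1 : ℝ)) P := (integrable_const _).indicator hA
  refine (key _ integrable_condExp.1
    (ae_bdd_abs_condExp_of_ae_bdd_abs (Eventually.of_forall h1A))).trans (Eq.trans ?_
      (key _ hAi.1 (Eventually.of_forall h1A)).symm)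
  refine integral_congr_ae ?_
  filter_upwards [hF.ae_memLp_apply] with s hs
  have hsi : Integrable (F s) P := hs.integrable one_le_two
  rw [← integral_mul_condExp_comm (R := 1) h𝓕 hAi (Eventually.of_forall h1A) hsi,
    condExp_of_stronglyMeasurable h𝓕 (hFm s).stronglyMeasurable hsi]

lemma integrable_path (hF : IsSquareField P F) :
    Integrable (fun ω => toL2 (fun s => F s ω)) P :=
  integrable_of_integrable_norm_pow (hF.aestronglyMeasurable_path le_rfl hF.measurable_apply)
    one_le_two hF.integrable_norm_sq_path

/-- The Bochner expectation of a random field is the pointwise expectation. -/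
theorem integral_path (hF : IsSquareField P F) :
    ∫ ω, toL2 (fun s => F s ω) ∂P = toL2 fun s => ∫ ω, F s ω ∂P := by
  refine ext_inner_left ℝ fun g => ?_
  obtain ⟨g', hg'm, hgg'⟩ := (Lp.memLp g).1
  have hg2 : MemLp g' 2 volume := (memLp_congr_ae hgg').1 (Lp.memLp g)
  have hgf : IsSquareField P fun s (_ : Ω) => g' s := of_fun hg'm.measurable hg2
  rw [← integral_inner hF.integrable_path, ← toL2_eq_of_ae hgg'.symm,
    hgf.integral_inner_path hF, inner_toL2 hg2 hF.memLp_integral]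
  exact integral_congr_ae (Eventually.of_forall fun s => integral_const_mul _ _)

end IsSquareField

end SquareField

/-! ### Centred paths and their moments -/

section CentredFields

open scoped RealInnerProductSpace

variable {S : Type*} [MeasureSpace S] {Ω : Type*} {𝓕 : MeasurableSpace Ω}
  {mΩ : MeasurableSpace Ω} {P : Measure Ω}

lemma eLpNorm_two_sq (f : S → ℝ) : eLpNorm f 2 volume ^ 2 = ∫⁻ s, ‖f s‖ₑ ^ 2 := by
  have := eLpNorm_nnreal_pow_eq_lintegral (f := f) (μ := volume) (p := 2) two_ne_zero
  simpa using this

variable [IsFiniteMeasure (volume : Measure S)] [IsProbabilityMeasure P]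

/-- By Tonelli, the second moment of the path norm is the integral of the squared field over the
product space. -/
lemma isSquareField_of_lintegral {F : S → Ω → ℝ} (hm : Measurable (Function.uncurry F))
    (h : ∫⁻ ω, eLpNorm (fun s => F s ω) 2 volume ^ 2 ∂P ≠ ∞) : IsSquareField P F := by
  refine ⟨hm, hm.aestronglyMeasurable, ?_⟩
  have h1 := eLpNorm_nnreal_pow_eq_lintegral (f := Function.uncurry F)
    (μ := (volume : Measure S).prod P) (p := 2) two_ne_zero
  simp only [eLpNorm_two_sq] at h
  have h2 : ∫⁻ z, ‖Function.uncurry F z‖ₑ ^ (2 : ℝ) ∂((volume : Measure S).prod P) ≠ ∞ := by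
    rw [lintegral_prod_symm _ (by fun_prop)]
    simpa [Function.uncurry] using h
  rw [lt_top_iff_ne_top]
  intro h3
  simp only [NNReal.coe_ofNat, ENNReal.coe_ofNat] at h1
  rw [h3] at h1
  simp at h1
  exact h2 (by simpa using h1.symm)

/-- The random field minus its mean function. -/
noncomputable def centre (P : Measure Ω) (Z : S → Ω → ℝ) (s : S) (ω : Ω) : ℝ :=
  Z s ω - ∫ ω', Z s ω' ∂P

/-- The path of the centred field as a random element of `L²`. -/
noncomputable def centredPath (P : Measure Ω) (Z : S → Ω → ℝ) (ω : Ω) :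
    Lp ℝ 2 (volume : Measure S) :=
  toL2 fun s => centre P Z s ω

namespace IsSquareField

variable {Z : S → Ω → ℝ}

lemma centre (hZ : IsSquareField P Z) : IsSquareField P (centre P Z) := by
  have hm := hZ.meas.stronglyMeasurable.integral_prod_right (ν := P)
  have h := of_fun (P := P) hm.measurable hZ.memLp_integral
  exact ⟨hZ.meas.sub h.meas, hZ.memLp.sub h.memLp⟩

variable [SecondCountableTopology (Lp ℝ 2 (volume : Measure S))]

lemma integrable_norm_pow_path {F : S → Ω → ℝ} (hF : IsSquareField P F) {k : ℕ}
    {C : ℝ≥0} (h : ∫⁻ ω, eLpNorm (fun s => F s ω) 2 volume ^ k ∂P ≤ C) :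
    Integrable (fun ω => ‖toL2 (fun s => F s ω)‖ ^ k) P ∧
      ∫ ω, ‖toL2 (fun s => F s ω)‖ ^ k ∂P ≤ C := by
  have hm := hF.aestronglyMeasurable_path le_rfl hF.measurable_apply
  have hm' : AEStronglyMeasurable (fun ω => ‖toL2 (fun s => F s ω)‖ ^ k) P := hm.norm.pow k
  have e : ∫⁻ ω, ‖‖toL2 (fun s => F s ω)‖ ^ k‖ₑ ∂P ≤ C := by
    refine le_trans (le_of_eq (lintegral_congr_ae ?_)) h
    filter_upwards [hF.ae_memLp_path] with ω hω
    rw [enorm_pow, enorm_norm, enorm_toL2 hω]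
  refine ⟨⟨hm', e.trans_lt ENNReal.coe_lt_top⟩, ?_⟩
  have h1 := integral_norm_eq_lintegral_enorm hm'
  simp only [norm_pow, norm_norm] at h1
  rw [h1]
  refine ENNReal.toReal_le_of_le_ofReal C.2 (e.trans ?_)
  simp

lemma centredPath_ae_eq (hZ : IsSquareField P Z) :
    centredPath P Z =ᵐ[P] fun ω => toL2 (fun s => Z s ω) - ∫ ω', toL2 (fun s => Z s ω') ∂P := by
  filter_upwards [hZ.ae_memLp_path] with ω hω
  rw [hZ.integral_path, ← toL2_sub hω hZ.memLp_integral]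
  rfl

lemma aestronglyMeasurable_centredPath (hZ : IsSquareField P Z) (h𝓕 : 𝓕 ≤ mΩ)
    (hZm : ∀ s, Measurable[𝓕] (Z s)) : AEStronglyMeasurable[𝓕] (centredPath P Z) P :=
  hZ.centre.aestronglyMeasurable_path h𝓕 fun s => (hZm s).sub measurable_const

/-- The mean has norm at most `1 + C` since `r ≤ 1 + r¹²`, and `(a + b)¹² ≤ 2¹² (a¹² + b¹²)`. -/
lemma isCentredBounded (hZ : IsSquareField P Z) {C : ℝ≥0}
    (h : ∫⁻ ω, eLpNorm (fun s => Z s ω) 2 volume ^ 12 ∂P ≤ C) :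
    IsCentredBounded P (2 ^ 12 * (C + (1 + C) ^ 12)) (centredPath P Z) := by
  obtain ⟨hi, hC⟩ := hZ.integrable_norm_pow_path h
  have hm := hZ.aestronglyMeasurable_centredPath le_rfl hZ.measurable_apply
  have hξ := hZ.integrable_path
  set e := ∫ ω', toL2 (fun s => Z s ω') ∂P with he
  have heC : ‖e‖ ≤ 1 + C := by
    calc ‖e‖ ≤ ∫ ω, ‖toL2 (fun s => Z s ω)‖ ∂P := norm_integral_le_integral_norm _
      _ ≤ ∫ ω, (1 + ‖toL2 (fun s => Z s ω)‖ ^ 12) ∂P := by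
          refine integral_mono hξ.norm ((integrable_const 1).add hi) fun ω => ?_
          simp only
          rcases le_total 1 ‖toL2 (fun s => Z s ω)‖ with h1 | h1
          · linarith [le_self_pow₀ h1 (by norm_num : 12 ≠ 0)]
          · linarith [pow_nonneg (norm_nonneg (toL2 (fun s => Z s ω))) 12]
      _ ≤ 1 + C := by
          rw [integral_add (integrable_const 1) hi]
          simp only [integral_const, probReal_univ, one_smul]
          linarith
  have hle : ∀ᵐ ω ∂P, ‖centredPath P Z ω‖ ^ 12
      ≤ 2 ^ 12 * (‖toL2 (fun s => Z s ω)‖ ^ 12 + (1 + C) ^ 12) := by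
    filter_upwards [hZ.centredPath_ae_eq] with ω hω
    rw [hω]
    set a := ‖toL2 (fun s => Z s ω)‖
    have h0 : 0 ≤ a := norm_nonneg _
    have hC0 : (0 : ℝ) ≤ C := C.2
    calc ‖toL2 (fun s => Z s ω) - e‖ ^ 12 ≤ (a + (1 + C)) ^ 12 :=
          pow_le_pow_left₀ (norm_nonneg _) ((norm_sub_le _ _).trans (by gcongr)) _
      _ ≤ (2 * max a (1 + C)) ^ 12 := by
          refine pow_le_pow_left₀ (by positivity) ?_ _
          linarith [le_max_left a (1 + C), le_max_right a (1 + C : ℝ)]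
      _ = 2 ^ 12 * max a (1 + C) ^ 12 := mul_pow _ _ _
      _ ≤ 2 ^ 12 * (a ^ 12 + (1 + C) ^ 12) := by
          refine mul_le_mul_of_nonneg_left ?_ (by positivity)
          rcases max_cases a (1 + C : ℝ) with ⟨h1, -⟩ | ⟨h1, -⟩ <;> rw [h1]
          · linarith [pow_nonneg (by positivity : (0 : ℝ) ≤ 1 + C) 12]
          · linarith [pow_nonneg h0 12]
  have hbi : Integrable (fun ω => 2 ^ 12 * (‖toL2 (fun s => Z s ω)‖ ^ 12 + (1 + (C : ℝ)) ^ 12)) P :=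
    (hi.add (integrable_const _)).const_mul _
  have hint : Integrable (fun ω => ‖centredPath P Z ω‖ ^ 12) P := by
    refine Integrable.mono' hbi (hm.norm.pow 12) (hle.mono fun ω hω => ?_)
    rw [Real.norm_of_nonneg (by positivity)]
    exact hω
  refine ⟨hm, hint, ?_, ?_⟩
  · refine (integral_mono_ae hint hbi hle).trans ?_
    rw [integral_const_mul, integral_add hi (integrable_const _)]
    simp only [integral_const, probReal_univ, one_smul]
    gcongr
  · rw [integral_congr_ae hZ.centredPath_ae_eq, integral_sub hξ (integrable_const _)]
    simp

end IsSquareField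

end CentredFields

instance : SecondCountableTopology L2I :=
  haveI : Fact ((2 : ℝ≥0∞) ≠ ∞) := ⟨ENNReal.ofNat_ne_top⟩
  Lp.SecondCountableTopology

instance : SecondCountableTopology L2II :=
  haveI : Fact ((2 : ℝ≥0∞) ≠ ∞) := ⟨ENNReal.ofNat_ne_top⟩
  haveI : IsSeparable (volume : Measure (I × I)) :=
    @instIsSeparableOfCountablyGeneratedOfSFinite (I × I) _ volume
      (inferInstanceAs (MeasurableSpace.CountablyGenerated (I × I)))
      (inferInstanceAs (SFinite (volume : Measure (I × I))))
  Lp.SecondCountableTopology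

/-! ### Covariance kernels as expectations of tensors -/

section CovarianceOperators

open scoped RealInnerProductSpace

variable {Ω : Type*} {mΩ : MeasurableSpace Ω} {P : Measure Ω} {Z W : I → Ω → ℝ}

lemma toL2_mul_path (hZ : ∀ᵐ ω ∂P, MemLp (fun s => Z s ω) 2 volume)
    (hW : ∀ᵐ ω ∂P, MemLp (fun s => W s ω) 2 volume) :
    ∀ᵐ ω ∂P, MemLp (fun p : I × I => Z p.1 ω * W p.2 ω) 2 volume ∧
      toL2 (fun p : I × I => Z p.1 ω * W p.2 ω)
        = tensorL2 (toL2 fun s => Z s ω) (toL2 fun s => W s ω) := by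
  filter_upwards [hZ, hW] with ω h1 h2
  exact ⟨memLp_mul_prod h1 h2, (tensorL2_toL2 h1 h2).symm⟩

variable [IsProbabilityMeasure P]

/-- The tensor of two paths has norm equal to the product of their norms, so fourth moments of the
factors make it square integrable. -/
lemma IsSquareField.mul_prod (hZ : IsSquareField P Z) (hW : IsSquareField P W)
    (hZ4 : Integrable (fun ω => ‖toL2 (fun s => Z s ω)‖ ^ 4) P)
    (hW4 : Integrable (fun ω => ‖toL2 (fun s => W s ω)‖ ^ 4) P) :
    IsSquareField P fun (p : I × I) ω => Z p.1 ω * W p.2 ω := by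
  have hp := toL2_mul_path hZ.ae_memLp_path hW.ae_memLp_path
  have hm : ∀ {F : I → Ω → ℝ}, IsSquareField P F →
      AEStronglyMeasurable (fun ω => toL2 fun s => F s ω) P :=
    fun hF => hF.aestronglyMeasurable_path le_rfl hF.measurable_apply
  refine .of_integrable_norm_sq ?_ (hp.mono fun ω h => h.1) ?_
  · exact (hZ.meas.comp (measurable_fst.fst.prodMk measurable_snd)).mul
      (hW.meas.comp (measurable_fst.snd.prodMk measurable_snd))
  · refine Integrable.congr (f := fun ω =>
      (‖toL2 fun s => Z s ω‖ * ‖toL2 fun s => W s ω‖) ^ 2) ?_ ?_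
    · refine Integrable.mono' (hZ4.add hW4) (((hm hZ).norm.mul (hm hW).norm).pow 2)
        (Eventually.of_forall fun ω => ?_)
      rw [Real.norm_of_nonneg (sq_nonneg _)]
      simp only [Pi.add_apply]
      nlinarith [sq_nonneg (‖toL2 fun s => Z s ω‖ ^ 2 - ‖toL2 fun s => W s ω‖ ^ 2),
        pow_nonneg (norm_nonneg (toL2 fun s => Z s ω)) 4,
        pow_nonneg (norm_nonneg (toL2 fun s => W s ω)) 4]
    · filter_upwards [hp] with ω h
      rw [h.2, isTensor_tensorL2.norm_apply]

variable {M : ℝ}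

lemma isSquareField_mul_centre (hZ : IsSquareField P Z) (hW : IsSquareField P W)
    (hZb : IsCentredBounded P M (centredPath P Z)) (hWb : IsCentredBounded P M (centredPath P W)) :
    IsSquareField P fun (p : I × I) ω => centre P Z p.1 ω * centre P W p.2 ω :=
  hZ.centre.mul_prod hW.centre (hZb.int_pow (by norm_num)) (hWb.int_pow (by norm_num))

lemma memLp_covFun (hZ : IsSquareField P Z) (hW : IsSquareField P W)
    (hZb : IsCentredBounded P M (centredPath P Z)) (hWb : IsCentredBounded P M (centredPath P W)) :
    MemLp (covFun P Z W) 2 volume :=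
  (isSquareField_mul_centre hZ hW hZb hWb).memLp_integral

/-- The cross-covariance kernel is the expectation of the tensor product. -/
lemma toL2_covFun (hZ : IsSquareField P Z) (hW : IsSquareField P W)
    (hZb : IsCentredBounded P M (centredPath P Z)) (hWb : IsCentredBounded P M (centredPath P W)) :
    toL2 (covFun P Z W) = ∫ ω, tensorL2 (centredPath P Z ω) (centredPath P W ω) ∂P := by
  refine ((isSquareField_mul_centre hZ hW hZb hWb).integral_path).symm.trans ?_
  refine integral_congr_ae ?_
  filter_upwards [toL2_mul_path hZ.centre.ae_memLp_path hW.centre.ae_memLp_path] with ω h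
  exact h.2

lemma integrable_cov (hZ : IsSquareField P Z) (hW : IsSquareField P W) :
    Integrable (fun τ : I => cov[Z τ, W τ; P]) volume :=
  hZ.centre.integrable_integral_mul hW.centre

lemma integral_cov (hZ : IsSquareField P Z) (hW : IsSquareField P W) :
    ∫ τ : I, cov[Z τ, W τ; P] = ∫ ω, ⟪centredPath P Z ω, centredPath P W ω⟫ ∂P :=
  (hZ.centre.integral_inner_path hW.centre).symm

end CovarianceOperators

/-! ### Mixing and stationarity of functional time series -/

section Series

variable {Ω : Type*} {mΩ : MeasurableSpace Ω} {P : Measure Ω} {Z : ℤ → I → Ω → ℝ}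

lemma sigmaField_le (hZ : ∀ t τ, Measurable (Z t τ)) (S : Set ℤ) : sigmaField Z S ≤ mΩ :=
  iSup_le fun t => iSup_le fun _ => iSup_le fun τ => (hZ t τ).comap_le

lemma measurable_sigmaField {S : Set ℤ} {t : ℤ} (ht : t ∈ S) (τ : I) :
    Measurable[sigmaField Z S] (Z t τ) := by
  refine Measurable.mono (comap_measurable _) ?_ le_rfl
  exact le_iSup_of_le t (le_iSup_of_le ht (le_iSup_of_le τ le_rfl))

lemma mixBound_of_mixingCoef_le {k : ℕ} {δ : ℝ} (hδ : 0 ≤ δ)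
    (h : mixingCoef P Z k ≤ ENNReal.ofReal δ) (s : ℤ) :
    MixBound P (sigmaField Z (Set.Iic s)) (sigmaField Z (Set.Ici (s + k))) δ := by
  intro A B hA hB
  rw [← ENNReal.ofReal_le_ofReal_iff hδ]
  refine le_trans ?_ h
  refine le_iSup_of_le s ?_
  exact le_iSup_of_le A (le_iSup_of_le hA (le_iSup_of_le B (le_iSup_of_le hB le_rfl)))

/-- The past and future σ-fields are generated by pointwise values, whereas the sequence consists of
elements of `L²`; `aestronglyMeasurable_centredPath` bridges the two. -/
theorem isMixingSeq_centredPath [IsProbabilityMeasure P] (hZ : ∀ t, IsSquareField P (Z t))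
    {M β ρ : ℝ}
    (hb : ∀ t, IsCentredBounded P M (centredPath P (Z t)))
    (hmix : ∀ k, mixingCoef P Z k ≤ ENNReal.ofReal ((β * (ρ ^ 9) ^ k) ^ 2)) :
    IsMixingSeq P (fun s => sigmaField Z (Set.Iic s)) (fun s => sigmaField Z (Set.Ici s)) M β ρ
      fun t => centredPath P (Z t) where
  past_le _ := sigmaField_le (fun t => (hZ t).measurable_apply) _
  future_le _ := sigmaField_le (fun t => (hZ t).measurable_apply) _
  meas_past s t h := (hZ t).aestronglyMeasurable_centredPath
    (sigmaField_le (fun t => (hZ t).measurable_apply) _)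
    (measurable_sigmaField (S := Set.Iic s) h)
  meas_future s t h := (hZ t).aestronglyMeasurable_centredPath
    (sigmaField_le (fun t => (hZ t).measurable_apply) _)
    (measurable_sigmaField (S := Set.Ici s) h)
  mix s k := mixBound_of_mixingCoef_le (by positivity) (hmix k) s
  bdd := hb

/-- The moment condition bounds the approximating series at time 0 only; stationarity extends it to
all times. -/
lemma IsStationary.lintegral_eLpNorm_pow (hs : IsStationary P Z)
    (hZ : IsFunctionalTimeSeries P Z) (k : ℕ) (t : ℤ) :
    ∫⁻ ω, eLpNorm (fun τ => Z t τ ω) 2 volume ^ k ∂P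
      = ∫⁻ ω, eLpNorm (fun τ => Z 0 τ ω) 2 volume ^ k ∂P := by
  have h := (hs 1 t (fun _ => 0)).comp (u := fun z : Fin 1 → L2I => ‖z 0‖ₑ ^ k)
    ((measurable_pi_apply 0).enorm.pow_const k)
  have e := h.lintegral_eq
  simp only [Function.comp_def, zero_add] at e
  have hn : ∀ t, ∫⁻ ω, ‖(toL2 (fun τ => Z t τ ω) : L2I)‖ₑ ^ k ∂P
      = ∫⁻ ω, eLpNorm (fun τ => Z t τ ω) 2 volume ^ k ∂P := by
    intro t
    refine lintegral_congr_ae ?_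
    filter_upwards [(hZ t).2] with ω hω
    rw [enorm_toL2 hω]
  rw [← hn, ← hn, e]

variable {K : Type*} [NormedAddCommGroup K] [NormedSpace ℝ K]

lemma IsStationary.integral_comp (hs : IsStationary P Z) {q : ℕ} {u : (Fin q → L2I) → K}
    (hu : Continuous u) [SecondCountableTopology K] (h : ℤ) (t : Fin q → ℤ) :
    ∫ ω, u (fun j => toL2 (fun τ => Z (t j + h) τ ω)) ∂P
      = ∫ ω, u (fun j => toL2 (fun τ => Z (t j) τ ω)) ∂P := by
  let _ : MeasurableSpace K := borel K
  have : BorelSpace K := ⟨rfl⟩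
  exact ((hs q h t).comp hu.measurable).integral_eq

/-- The cross-covariances of a stationary series depend on the lag only. -/
theorem IsStationary.integral_bilin_centredPath [IsProbabilityMeasure P] [SecondCountableTopology K]
    (hs : IsStationary P Z) (hZ : ∀ t, IsSquareField P (Z t)) (V : L2I →L[ℝ] L2I →L[ℝ] K)
    (s t : ℤ) :
    ∫ ω, V (centredPath P (Z s) ω) (centredPath P (Z t) ω) ∂P
      = ∫ ω, V (centredPath P (Z 0) ω) (centredPath P (Z (t - s)) ω) ∂P := by
  set e : L2I := ∫ ω, toL2 (fun τ => Z 0 τ ω) ∂P with he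
  have hmean : ∀ t, ∫ ω, toL2 (fun τ => Z t τ ω) ∂P = e := by
    intro t
    have := hs.integral_comp (u := fun z : Fin 1 → L2I => z 0) (by fun_prop) t (fun _ => 0)
    simpa only [zero_add] using this
  have hpath : ∀ s t, ∫ ω, V (centredPath P (Z s) ω) (centredPath P (Z t) ω) ∂P
      = ∫ ω, V (toL2 (fun τ => Z s τ ω) - e) (toL2 (fun τ => Z t τ ω) - e) ∂P := by
    intro s t
    refine integral_congr_ae ?_
    filter_upwards [(hZ s).centredPath_ae_eq, (hZ t).centredPath_ae_eq] with ω h1 h2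
    rw [h1, h2, hmean, hmean]
  rw [hpath, hpath]
  -- Stationarity shifts the pair of times `(0, t - s)` by `s`; the common mean `e` has been made
  -- explicit for this.
  have := hs.integral_comp (u := fun z : Fin 2 → L2I => V (z 0 - e) (z 1 - e)) (by fun_prop) s
    ![0, t - s]
  simpa using this

end Series

/-! ### Stability of covariances under approximation -/

section Approximation

open scoped RealInnerProductSpace

variable {H K : Type*} [NormedAddCommGroup H] [InnerProductSpace ℝ H]
  [NormedAddCommGroup K] [NormedSpace ℝ K]
  {Ω : Type*} {mΩ : MeasurableSpace Ω} {P : Measure Ω} [IsProbabilityMeasure P]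

lemma IsCentredBounded.integrable_bilin {M : ℝ} {x y : Ω → H} (hx : IsCentredBounded P M x)
    (hy : IsCentredBounded P M y) (hM : 1 ≤ M) {V : H →L[ℝ] H →L[ℝ] K}
    (hV : ∀ x y, ‖V x y‖ ≤ ‖x‖ * ‖y‖) : Integrable (fun ω => V (x ω) (y ω)) P :=
  (hx.integrable_of_norm_le_mul hy ((by fun_prop : Continuous fun z : H × H => V z.1 z.2)
    |>.comp_aestronglyMeasurable (hx.meas.prodMk hy.meas)) (fun _ => hV _ _) hM).1.1

/-- Stability of the cross-covariance under approximation of both random elements. -/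
lemma norm_integral_bilin_sub_le {M D δ δ' : ℝ} {x x' y y' : Ω → H} {U U' : Ω → ℝ}
    (hx : IsCentredBounded P M x) (hx' : IsCentredBounded P M x') (hy : IsCentredBounded P M y)
    (hy' : IsCentredBounded P M y') (hM : 1 ≤ M) {V : H →L[ℝ] H →L[ℝ] K}
    (hV : ∀ x y, ‖V x y‖ ≤ ‖x‖ * ‖y‖)
    (hU : Integrable (fun ω => U ω ^ 2) P) (hU' : Integrable (fun ω => U' ω ^ 2) P)
    (hUD : ∫ ω, U ω ^ 2 ∂P ≤ D) (hUD' : ∫ ω, U' ω ^ 2 ∂P ≤ D) (hδ : 0 ≤ δ) (hδ' : 0 ≤ δ')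
    (h : ∀ᵐ ω ∂P, ‖x ω - y ω‖ ≤ δ * U ω) (h' : ∀ᵐ ω ∂P, ‖x' ω - y' ω‖ ≤ δ' * U' ω) :
    ‖∫ ω, V (x ω) (x' ω) ∂P - ∫ ω, V (y ω) (y' ω) ∂P‖ ≤ (D + 2 * M) * (δ + δ') := by
  rw [← integral_sub (hx.integrable_bilin hx' hM hV) (hy.integrable_bilin hy' hM hV)]
  have hx2 : Integrable (fun ω => ‖x' ω‖ ^ 2) P := hx'.int_pow (by norm_num)
  have hy2 : Integrable (fun ω => ‖y ω‖ ^ 2) P := hy.int_pow (by norm_num)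
  have i1 : Integrable (fun ω => δ * (U ω ^ 2 + ‖x' ω‖ ^ 2)) P := (hU.add hx2).const_mul δ
  have i2 : Integrable (fun ω => δ' * (U' ω ^ 2 + ‖y ω‖ ^ 2)) P := (hU'.add hy2).const_mul δ'
  have hab : ∀ a b : ℝ, a * b ≤ a ^ 2 + b ^ 2 := fun a b => by
    nlinarith [sq_nonneg (a - b), sq_nonneg a, sq_nonneg b]
  calc _ ≤ ∫ ω, (δ * (U ω ^ 2 + ‖x' ω‖ ^ 2) + δ' * (U' ω ^ 2 + ‖y ω‖ ^ 2)) ∂P := by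
        refine norm_integral_le_of_norm_le (i1.add i2) ?_
        filter_upwards [h, h'] with ω h1 h2
        -- Changing one argument at a time makes each term linear in one of the errors.
        have e : V (x ω) (x' ω) - V (y ω) (y' ω)
            = V (x ω - y ω) (x' ω) + V (y ω) (x' ω - y' ω) := by
          simp only [map_sub, sub_apply]
          abel
        rw [e]
        refine (norm_add_le _ _).trans (add_le_add ((hV _ _).trans ?_) ((hV _ _).trans ?_))
        · calc ‖x ω - y ω‖ * ‖x' ω‖ ≤ δ * U ω * ‖x' ω‖ := by gcongr
            _ = δ * (U ω * ‖x' ω‖) := mul_assoc _ _ _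
            _ ≤ _ := mul_le_mul_of_nonneg_left (hab _ _) hδ
        · calc ‖y ω‖ * ‖x' ω - y' ω‖ ≤ ‖y ω‖ * (δ' * U' ω) := by gcongr
            _ = δ' * (U' ω * ‖y ω‖) := by ring
            _ ≤ _ := mul_le_mul_of_nonneg_left (hab _ _) hδ'
    _ = δ * (∫ ω, U ω ^ 2 ∂P + ∫ ω, ‖x' ω‖ ^ 2 ∂P)
        + δ' * (∫ ω, U' ω ^ 2 ∂P + ∫ ω, ‖y ω‖ ^ 2 ∂P) := by
        rw [integral_add i1 i2, integral_const_mul, integral_const_mul, integral_add hU hx2,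
          integral_add hU' hy2]
    _ ≤ δ * (D + 2 * M) + δ' * (D + 2 * M) := by
        have e1 := hx'.mom_pow hM (by norm_num : 2 ≤ 12)
        have e2 := hy.mom_pow hM (by norm_num : 2 ≤ 12)
        gcongr
    _ = _ := by ring

end Approximation

/-! ### Quantitative consequences of the assumptions -/

section LocallyStationary

open scoped RealInnerProductSpace

variable {Ω : Type*} {mΩ : MeasurableSpace Ω} {P : Measure Ω}

/-- The quantitative consequences, for the centred paths, of local stationarity, of the moment
condition and of strong mixing. -/
structure IsRegular (P : Measure Ω) (X : ℕ → ℤ → I → Ω → ℝ) (Y : I → ℤ → I → Ω → ℝ)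
    (M β ρ D : ℝ) : Prop where
  one_le : 1 ≤ M
  beta_pos : 0 < β
  rho_pos : 0 < ρ
  rho_lt : ρ < 1
  field : ∀ T : ℕ, 1 ≤ T → ∀ t, IsSquareField P (X T t)
  field_approx : ∀ w t, IsSquareField P (Y w t)
  stationary : ∀ w, IsStationary P (Y w)
  mixing : ∀ T : ℕ, 1 ≤ T → IsMixingSeq P (fun s => sigmaField (X T) (Set.Iic s))
    (fun s => sigmaField (X T) (Set.Ici s)) M β ρ fun t => centredPath P (X T t)
  mixing_approx : ∀ w, IsMixingSeq P (fun s => sigmaField (Y w) (Set.Iic s))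
    (fun s => sigmaField (Y w) (Set.Ici s)) M β ρ fun t => centredPath P (Y w t)
  approx : ∀ T : ℕ, 1 ≤ T → ∀ t : ℤ, 1 ≤ t → t ≤ T → ∀ w : I, ∃ U : Ω → ℝ,
    Integrable (fun ω => U ω ^ 2) P ∧ ∫ ω, U ω ^ 2 ∂P ≤ D ∧
      ∀ᵐ ω ∂P, ‖centredPath P (X T t) ω - centredPath P (Y w t) ω‖
        ≤ (|(t : ℝ) / T - w| + 1 / T) * U ω

variable {X : ℕ → ℤ → I → Ω → ℝ} {Y : I → ℤ → I → Ω → ℝ}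

/-- Centring changes the difference by its mean, of norm at most `δ E|Q|`. Hence `U = |Q| + E|Q|`
works, and `E U² ≤ 4 E Q² ≤ 4(1 + C)`. -/
lemma exists_approx_centredPath [IsProbabilityMeasure P] {Z W : I → Ω → ℝ}
    (hZ : IsSquareField P Z) (hW : IsSquareField P W) {Q : Ω → ℝ} (hQ : Measurable Q) {C : ℝ≥0}
    (hQC : ∫⁻ ω, ‖Q ω‖ₑ ^ (4 : ℝ) ∂P ≤ C) {δ : ℝ} (hδ : 0 ≤ δ)
    (h : ∀ᵐ ω ∂P, eLpNorm (fun τ => Z τ ω - W τ ω) 2 volume ≤ ENNReal.ofReal (δ * Q ω)) :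
    ∃ U : Ω → ℝ, Integrable (fun ω => U ω ^ 2) P ∧ ∫ ω, U ω ^ 2 ∂P ≤ 4 * (1 + C) ∧
      ∀ᵐ ω ∂P, ‖centredPath P Z ω - centredPath P W ω‖ ≤ δ * U ω := by
  have hQ4m : AEStronglyMeasurable (fun ω => ‖Q ω‖ ^ 4) P :=
    (hQ.norm.pow_const 4).aestronglyMeasurable
  have e : ∫⁻ ω, ‖‖Q ω‖ ^ 4‖ₑ ∂P ≤ C := by
    refine le_trans (le_of_eq (lintegral_congr fun ω => ?_)) hQC
    rw [enorm_pow, enorm_norm]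
    exact_mod_cast (ENNReal.rpow_natCast _ 4).symm
  have hQ4 : Integrable (fun ω => ‖Q ω‖ ^ 4) P := ⟨hQ4m, e.trans_lt ENNReal.coe_lt_top⟩
  have hQ4C : ∫ ω, ‖Q ω‖ ^ 4 ∂P ≤ C := by
    have h1 := integral_norm_eq_lintegral_enorm hQ4m
    simp only [norm_pow, norm_norm] at h1
    rw [h1]
    exact ENNReal.toReal_le_of_le_ofReal C.2 (e.trans (by simp))
  have hQ2 : Integrable (fun ω => ‖Q ω‖ ^ 2) P :=
    integrable_norm_pow_of_le hQ.aestronglyMeasurable (by norm_num) hQ4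
  have hQ1 : Integrable (fun ω => ‖Q ω‖) P :=
    (integrable_of_integrable_norm_pow hQ.aestronglyMeasurable (by norm_num : 1 ≤ 4) hQ4).norm
  set q := ∫ ω, ‖Q ω‖ ∂P with hq
  have hqsq : q ^ 2 ≤ ∫ ω, ‖Q ω‖ ^ 2 ∂P := by
    have h1 := variance_nonneg (fun ω => ‖Q ω‖) P
    rw [variance_eq_sub ((memLp_two_iff_integrable_sq hQ1.1).2 hQ2)] at h1
    exact sub_nonneg.1 h1
  have hQ2C : ∫ ω, ‖Q ω‖ ^ 2 ∂P ≤ 1 + C := by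
    calc ∫ ω, ‖Q ω‖ ^ 2 ∂P ≤ ∫ ω, (1 + ‖Q ω‖ ^ 4) ∂P := by
          refine integral_mono hQ2 ((integrable_const 1).add hQ4) fun ω => ?_
          simp only
          nlinarith [sq_nonneg (‖Q ω‖ ^ 2 - 1), sq_nonneg (‖Q ω‖ ^ 2)]
      _ ≤ 1 + C := by
          rw [integral_add (integrable_const 1) hQ4]
          simp only [integral_const, probReal_univ, one_smul]
          linarith
  have hU : Integrable (fun ω => 2 * ‖Q ω‖ ^ 2 + 2 * q ^ 2) P :=
    (hQ2.const_mul 2).add (integrable_const _)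
  have hle : ∀ ω, (‖Q ω‖ + q) ^ 2 ≤ 2 * ‖Q ω‖ ^ 2 + 2 * q ^ 2 := fun ω => by
    nlinarith [sq_nonneg (‖Q ω‖ - q)]
  have hU2 : Integrable (fun ω => (‖Q ω‖ + q) ^ 2) P := by
    refine Integrable.mono' hU ((hQ.norm.add_const q).pow_const 2).aestronglyMeasurable
      (Eventually.of_forall fun ω => ?_)
    rw [Real.norm_of_nonneg (sq_nonneg _)]
    exact hle ω
  refine ⟨fun ω => ‖Q ω‖ + q, hU2, ?_, ?_⟩
  · refine (integral_mono hU2 hU hle).trans ?_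
    rw [integral_add (hQ2.const_mul 2) (integrable_const _), integral_const_mul]
    simp only [integral_const, probReal_univ, one_smul]
    linarith
  · have hpath : ∀ᵐ ω ∂P, ‖toL2 (fun s => Z s ω) - toL2 (fun s => W s ω)‖ ≤ δ * ‖Q ω‖ := by
      filter_upwards [h, hZ.ae_memLp_path, hW.ae_memLp_path] with ω h1 h2 h3
      rw [← toL2_sub h2 h3, ← toReal_enorm, enorm_toL2 (f := fun s => Z s ω - W s ω) (h2.sub h3)]
      refine ENNReal.toReal_le_of_le_ofReal (by positivity) (h1.trans ?_)
      exact ENNReal.ofReal_le_ofReal (mul_le_mul_of_nonneg_left (le_abs_self _) hδ)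
    have hmean : ‖∫ ω, toL2 (fun s => Z s ω) ∂P - ∫ ω, toL2 (fun s => W s ω) ∂P‖ ≤ δ * q := by
      rw [← integral_sub hZ.integrable_path hW.integrable_path, hq, ← integral_const_mul]
      exact norm_integral_le_of_norm_le (hQ1.const_mul δ) hpath
    filter_upwards [hpath, hZ.centredPath_ae_eq, hW.centredPath_ae_eq] with ω h1 h2 h3
    rw [h2, h3, sub_sub_sub_comm, mul_add]
    exact (norm_sub_le _ _).trans (add_le_add h1 hmean)

theorem exists_isRegular [IsProbabilityMeasure P] (hls : IsLocallyStationary P 4 X Y)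
    (hmom : MomentCondition P X Y) (hmix : IsExpStronglyMixing P X Y) :
    ∃ M β ρ D : ℝ, IsRegular P X Y M β ρ D := by
  obtain ⟨C₂, hX2, hY2⟩ := hmom 2
  obtain ⟨C, hX, hY⟩ := hmom 12
  obtain ⟨c, a, hc, ha0, ha1, hmix⟩ := hmix
  obtain ⟨Q, A, hQ⟩ := hls.approx
  set M : ℝ := 2 ^ 12 * (C + (1 + C) ^ 12) with hM
  -- The exponent `18 = 2 · 9` yields `(√c (ρ⁹)^k)² = c a^k`, the form required of the mixing
  -- coefficients.
  set ρ : ℝ := a ^ (1 / 18 : ℝ) with hρ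
  have hρ18 : ρ ^ 18 = a := by
    rw [hρ, ← Real.rpow_natCast, ← Real.rpow_mul ha0.le]
    norm_num
  have hmix' : ∀ k : ℕ, c * a ^ k = (√c * (ρ ^ 9) ^ k) ^ 2 := by
    intro k
    rw [mul_pow, Real.sq_sqrt hc.le, ← hρ18]
    ring
  have fX : ∀ T : ℕ, 1 ≤ T → ∀ t, IsSquareField P (X T t) := fun T hT t =>
    isSquareField_of_lintegral (hls.series T hT t).1
      ((hX2 T hT t).trans_lt ENNReal.coe_lt_top).ne
  have sY := hls.approx_stationary
  have fY : ∀ w t, IsSquareField P (Y w t) := fun w t => by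
    refine isSquareField_of_lintegral (hls.approx_series w t).1 ?_
    rw [(sY w).lintegral_eLpNorm_pow (hls.approx_series w) 2 t]
    exact ((hY2 w).trans_lt ENNReal.coe_lt_top).ne
  refine ⟨M, √c, ρ, 4 * (1 + A), ?_, Real.sqrt_pos.2 hc, Real.rpow_pos_of_pos ha0 _,
    Real.rpow_lt_one ha0.le ha1 (by norm_num), fX, fY, sY, ?_, ?_, ?_⟩
  · have hC0 : (0 : ℝ) ≤ C := C.2
    have : (1 : ℝ) ≤ (1 + C) ^ 12 := one_le_pow₀ (by linarith)
    rw [hM]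
    linarith
  · intro T hT
    refine isMixingSeq_centredPath (fX T hT) (fun t => (fX T hT t).isCentredBounded (hX T hT t))
      fun k => ?_
    rw [← hmix']
    exact ((le_iSup₂ (f := fun (T : ℕ) (_ : 1 ≤ T) => mixingCoef P (X T) k) T hT).trans
      (le_max_left _ _)).trans (hmix k)
  · intro w
    refine isMixingSeq_centredPath (fY w) (fun t => (fY w t).isCentredBounded ?_) fun k => ?_
    · rw [(sY w).lintegral_eLpNorm_pow (hls.approx_series w) 12 t]
      exact hY w
    · rw [← hmix']
      exact ((le_iSup (fun u : I => mixingCoef P (Y u) k) w).trans (le_max_right _ _)).trans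
        (hmix k)
  · intro T hT t h1 h2 w
    obtain ⟨hm, h4, hle⟩ := hQ T hT t h1 h2 w
    exact exists_approx_centredPath (fX T hT t) (fY w t) hm h4 (by positivity) hle

namespace IsRegular

variable [IsProbabilityMeasure P] {M β ρ D : ℝ}

/-- The bilinear map `V` is left general to cover the tensor product, its transpose and the inner
product. Mixing gives the decay; bilinear stability together with stationarity gives the
approximation. -/
lemma isLocCov {K : Type*} [NormedAddCommGroup K] [NormedSpace ℝ K] [SecondCountableTopology K]
    (h : IsRegular P X Y M β ρ D) {V : L2I →L[ℝ] L2I →L[ℝ] K}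
    (hV : ∀ x y, ‖V x y‖ ≤ ‖x‖ * ‖y‖)
    (hle : ∀ {past future : ℤ → MeasurableSpace Ω} {x : ℤ → Ω → L2I},
      IsMixingSeq P past future M β ρ x → ∀ s t,
        ‖∫ ω, V (x s ω) (x t ω) ∂P‖ ≤ 52 * M * β * ρ ^ (t - s).natAbs) :
    IsLocCov (fun T s t => ∫ ω, V (centredPath P (X T s) ω) (centredPath P (X T t) ω) ∂P)
      (fun w k => ∫ ω, V (centredPath P (Y w 0) ω) (centredPath P (Y w k) ω) ∂P)
      (max (52 * M * β) (D + 2 * M)) ρ where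
  C_nonneg := le_max_of_le_left (by nlinarith [h.one_le, h.beta_pos])
  rho_pos := h.rho_pos
  rho_lt := h.rho_lt
  le T hT s t := (hle (h.mixing T hT) s t).trans
    (mul_le_mul_of_nonneg_right (le_max_left _ _) (pow_nonneg h.rho_pos.le _))
  lim_le w k := by
    have := hle (h.mixing_approx w) 0 k
    rw [sub_zero] at this
    exact this.trans (mul_le_mul_of_nonneg_right (le_max_left _ _) (pow_nonneg h.rho_pos.le _))
  approx T hT s t hs1 hsT ht1 htT w := by
    obtain ⟨U, hU, hUD, hUle⟩ := h.approx T hT s hs1 hsT w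
    obtain ⟨U', hU', hUD', hUle'⟩ := h.approx T hT t ht1 htT w
    have := norm_integral_bilin_sub_le ((h.mixing T hT).bdd s) ((h.mixing T hT).bdd t)
      ((h.mixing_approx w).bdd s) ((h.mixing_approx w).bdd t) h.one_le hV hU hU' hUD hUD'
      (by positivity) (by positivity) hUle hUle'
    rw [(h.stationary w).integral_bilin_centredPath (h.field_approx w) V s t] at this
    refine this.trans ((mul_le_mul_of_nonneg_right (le_max_right (52 * M * β) _)
      (by positivity)).trans_eq ?_)
    ring

end IsRegular

end LocallyStationary

/-! ### The bootstrap estimator as a random element of `L²([0,1]²)` -/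

section FieldAlgebra

variable {S : Type*} [MeasureSpace S] {Ω : Type*} {mΩ : MeasurableSpace Ω} {P : Measure Ω}

lemma IsSquareField.const_mul {F : S → Ω → ℝ} (hF : IsSquareField P F) (c : ℝ) :
    IsSquareField P fun s ω => c * F s ω :=
  ⟨hF.meas.const_mul c, hF.memLp.const_mul c⟩

lemma IsSquareField.sum {ι : Type*} (A : Finset ι) {F : ι → S → Ω → ℝ}
    (hF : ∀ i ∈ A, IsSquareField P (F i)) : IsSquareField P fun s ω => ∑ i ∈ A, F i s ω :=
  ⟨Finset.measurable_fun_sum A fun i hi => (hF i hi).meas,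
    memLp_finsetSum A fun i hi => (hF i hi).memLp⟩

end FieldAlgebra

section Estimator

open scoped RealInnerProductSpace

variable {Ω : Type*} {mΩ : MeasurableSpace Ω} {P : Measure Ω} {X : ℕ → ℤ → I → Ω → ℝ}
  {Y : I → ℤ → I → Ω → ℝ}

lemma blockSum_eq (T m : ℕ) {i : ℕ} (hi : 1 ≤ i) (τ : I) (ω : Ω) :
    blockSum P X T m i τ ω = ∑ t ∈ block T m i, centre P (X T t) τ ω := by
  rw [blockSum, sum_Icc_natCast _ _ fun t : ℤ => X T t τ ω - ∫ ω', X T t τ ω' ∂P, block]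
  refine Finset.sum_congr ?_ fun t _ => rfl
  congr 1
  omega

lemma sigmaTilde_eq (T m : ℕ) (p : I × I) (ω : Ω) :
    sigmaTilde P X T m p ω = 1 / ((T : ℝ) * m) * ∑ i ∈ Finset.Icc 1 (T : ℤ),
      ∑ s ∈ block T m i, ∑ t ∈ block T m i, centre P (X T s) p.1 ω * centre P (X T t) p.2 ω := by
  have e := sum_Icc_natCast 1 T fun i : ℤ => ∑ s ∈ block T m i, ∑ t ∈ block T m i,
    centre P (X T s) p.1 ω * centre P (X T t) p.2 ω
  rw [Nat.cast_one] at e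
  rw [← e, sigmaTilde, ← Finset.mul_sum, ← mul_assoc, one_div_mul_one_div]
  congr 1
  refine Finset.sum_congr rfl fun i hi => ?_
  rw [blockSum_eq T m (Finset.mem_Icc.1 hi).1, blockSum_eq T m (Finset.mem_Icc.1 hi).1,
    Finset.sum_mul_sum]

/-- The sum of the tensor squares of the block sums. -/
noncomputable def blockTensorSum (P : Measure Ω) (X : ℕ → ℤ → I → Ω → ℝ) (T m : ℕ) (ω : Ω) :
    L2II :=
  ∑ i ∈ Finset.Icc 1 (T : ℤ), tensorL2 (∑ s ∈ block T m i, centredPath P (X T s) ω)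
    (∑ s ∈ block T m i, centredPath P (X T s) ω)

lemma blockTensorSum_eq (T m : ℕ) (ω : Ω) :
    blockTensorSum P X T m ω = ∑ i ∈ Finset.Icc 1 (T : ℤ), ∑ s ∈ block T m i,
      ∑ t ∈ block T m i, tensorL2 (centredPath P (X T s) ω) (centredPath P (X T t) ω) := by
  refine Finset.sum_congr rfl fun i _ => ?_
  simp only [map_sum, sum_apply]
  rw [Finset.sum_comm]

namespace IsRegular

variable [IsProbabilityMeasure P] {M β ρ D : ℝ}

lemma isSquareField_mul (h : IsRegular P X Y M β ρ D) {T : ℕ} (hT : 1 ≤ T) (s t : ℤ) :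
    IsSquareField P fun (p : I × I) ω => centre P (X T s) p.1 ω * centre P (X T t) p.2 ω :=
  isSquareField_mul_centre (h.field T hT s) (h.field T hT t) ((h.mixing T hT).bdd s)
    ((h.mixing T hT).bdd t)

lemma isSquareField_sigmaTilde (h : IsRegular P X Y M β ρ D) {T : ℕ} (hT : 1 ≤ T) (m : ℕ) :
    IsSquareField P (sigmaTilde P X T m) := by
  have e : sigmaTilde P X T m = _ := funext fun p => funext fun ω => sigmaTilde_eq T m p ω
  rw [e]
  exact .const_mul (.sum _ fun i _ => .sum _ fun s _ => .sum _ fun t _ =>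
    h.isSquareField_mul hT s t) _

lemma toL2_sigmaTilde (h : IsRegular P X Y M β ρ D) {T : ℕ} (hT : 1 ≤ T) (m : ℕ) :
    ∀ᵐ ω ∂P, toL2 (fun p => sigmaTilde P X T m p ω)
      = (1 / ((T : ℝ) * m)) • blockTensorSum P X T m ω := by
  -- There are countably many pairs of times, so a single null set serves all of them.
  have h1 : ∀ᵐ ω ∂P, ∀ s t : ℤ, _ := ae_all_iff.2 fun s => ae_all_iff.2 fun t =>
    toL2_mul_path (h.field T hT s).centre.ae_memLp_path (h.field T hT t).centre.ae_memLp_path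
  filter_upwards [h1] with ω hω
  simp only [sigmaTilde_eq]
  have hsum : ∀ (i : ℤ) (s : ℤ), MemLp (fun p : I × I => ∑ t ∈ block T m i,
      centre P (X T s) p.1 ω * centre P (X T t) p.2 ω) 2 volume :=
    fun i s => memLp_finsetSum _ fun t _ => (hω s t).1
  have hsum' : ∀ i : ℤ, MemLp (fun p : I × I => ∑ s ∈ block T m i, ∑ t ∈ block T m i,
      centre P (X T s) p.1 ω * centre P (X T t) p.2 ω) 2 volume :=
    fun i => memLp_finsetSum _ fun s _ => hsum i s
  rw [toL2_const_mul _ (memLp_finsetSum _ fun i _ => hsum' i), toL2_sum _ fun i _ => hsum' i,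
    blockTensorSum_eq]
  congr 1
  refine Finset.sum_congr rfl fun i _ => ?_
  rw [toL2_sum _ fun s _ => hsum i s]
  refine Finset.sum_congr rfl fun s _ => ?_
  rw [toL2_sum _ fun t _ => (hω s t).1]
  exact Finset.sum_congr rfl fun t _ => (hω s t).2

lemma integrable_tensor_centredPath (h : IsRegular P X Y M β ρ D) {T : ℕ} (hT : 1 ≤ T) (s t : ℤ) :
    Integrable (fun ω => tensorL2 (centredPath P (X T s) ω) (centredPath P (X T t) ω)) P :=
  ((h.mixing T hT).bdd s).integrable_bilin ((h.mixing T hT).bdd t) h.one_le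
    fun x y => (isTensor_tensorL2.norm_apply x y).le

lemma integral_blockTensorSum (h : IsRegular P X Y M β ρ D) {T : ℕ} (hT : 1 ≤ T) (m : ℕ) :
    ∫ ω, blockTensorSum P X T m ω ∂P = ∑ i ∈ Finset.Icc 1 (T : ℤ), ∑ s ∈ block T m i,
      ∑ t ∈ block T m i,
        ∫ ω, tensorL2 (centredPath P (X T s) ω) (centredPath P (X T t) ω) ∂P := by
  have hi := fun s t => h.integrable_tensor_centredPath hT s t
  simp only [blockTensorSum_eq]
  rw [integral_finsetSum _ fun i _ => integrable_finsetSum _ fun s _ =>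
    integrable_finsetSum _ fun t _ => hi s t]
  refine Finset.sum_congr rfl fun i _ => ?_
  rw [integral_finsetSum _ fun s _ => integrable_finsetSum _ fun t _ => hi s t]
  refine Finset.sum_congr rfl fun s _ => ?_
  rw [integral_finsetSum _ fun t _ => hi s t]

lemma toL2_integral_sigmaTilde (h : IsRegular P X Y M β ρ D) {T : ℕ} (hT : 1 ≤ T) (m : ℕ) :
    toL2 (fun p => ∫ ω, sigmaTilde P X T m p ω ∂P)
      = (1 / ((T : ℝ) * m)) • ∫ ω, blockTensorSum P X T m ω ∂P := by
  rw [← (h.isSquareField_sigmaTilde hT m).integral_path, ← integral_smul]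
  exact integral_congr_ae (h.toL2_sigmaTilde hT m)

lemma bias_ae_eq (h : IsRegular P X Y M β ρ D) {T : ℕ} (hT : 1 ≤ T) (m : ℕ) :
    bias P X Y T m =ᵐ[volume]
      ((1 / ((T : ℝ) * m)) • ∫ ω, blockTensorSum P X T m ω ∂P - longRunCov P Y : L2II) := by
  rw [← h.toL2_integral_sigmaTilde hT m]
  filter_upwards [coeFn_toL2 (h.isSquareField_sigmaTilde hT m).memLp_integral,
    Lp.coeFn_sub (toL2 fun p => ∫ ω, sigmaTilde P X T m p ω ∂P) (longRunCov P Y)] with p h1 h2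
  rw [h2, Pi.sub_apply, h1, bias]

lemma memLp_bias (h : IsRegular P X Y M β ρ D) {T : ℕ} (hT : 1 ≤ T) (m : ℕ) :
    MemLp (bias P X Y T m) 2 volume :=
  (memLp_congr_ae (h.bias_ae_eq hT m)).2 (Lp.memLp _)

lemma integral_bias_sq (h : IsRegular P X Y M β ρ D) {T : ℕ} (hT : 1 ≤ T) (m : ℕ) :
    ∫ p, bias P X Y T m p ^ 2
      = ‖(1 / ((T : ℝ) * m)) • ∫ ω, blockTensorSum P X T m ω ∂P - longRunCov P Y‖ ^ 2 := by
  rw [← toL2_eq_of_ae (h.bias_ae_eq hT m), norm_toL2_sq (h.memLp_bias hT m)]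

lemma variance_sigmaTilde_eq (h : IsRegular P X Y M β ρ D) {T : ℕ} (hT : 1 ≤ T) (m : ℕ)
    (p : I × I) :
    variance (sigmaTilde P X T m p) P
      = ∫ ω, centre P (sigmaTilde P X T m) p ω * centre P (sigmaTilde P X T m) p ω ∂P := by
  rw [variance_eq_integral ((h.isSquareField_sigmaTilde hT m).measurable_apply p).aemeasurable]
  simp only [sq, centre]

lemma integrable_variance (h : IsRegular P X Y M β ρ D) {T : ℕ} (hT : 1 ≤ T) (m : ℕ) :
    Integrable (fun p : I × I => variance (sigmaTilde P X T m p) P) volume := by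
  simp only [h.variance_sigmaTilde_eq hT m]
  exact (h.isSquareField_sigmaTilde hT m).centre.integrable_integral_mul
    (h.isSquareField_sigmaTilde hT m).centre

lemma integral_variance (h : IsRegular P X Y M β ρ D) {T : ℕ} (hT : 1 ≤ T) (m : ℕ) :
    ∫ p : I × I, variance (sigmaTilde P X T m p) P
      = (1 / ((T : ℝ) * m)) ^ 2 * ∫ ω, ‖blockTensorSum P X T m ω
        - ∫ ω', blockTensorSum P X T m ω' ∂P‖ ^ 2 ∂P := by
  have hF := h.isSquareField_sigmaTilde hT m
  simp only [h.variance_sigmaTilde_eq hT m, ← sq]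
  rw [← hF.centre.integral_norm_sq_path, ← integral_const_mul]
  refine integral_congr_ae ?_
  filter_upwards [hF.centredPath_ae_eq, h.toL2_sigmaTilde hT m] with ω h1 h2
  rw [centredPath, h2, hF.integral_path, h.toL2_integral_sigmaTilde hT m, ← smul_sub] at h1
  rw [h1, norm_smul, mul_pow, Real.norm_eq_abs, sq_abs]

/-- Decomposition into variance and squared bias, valid wherever the estimator is square integrable.
-/
lemma mse_ae_eq (h : IsRegular P X Y M β ρ D) {T : ℕ} (hT : 1 ≤ T) (m : ℕ) :
    mse P X Y T m =ᵐ[volume]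
      fun p => variance (sigmaTilde P X T m p) P + bias P X Y T m p ^ 2 := by
  filter_upwards [(h.isSquareField_sigmaTilde hT m).ae_memLp_apply] with p hp
  have h1 := variance_eq_sub (hp.sub (memLp_const (longRunCov P Y p)))
  have h2 : variance (sigmaTilde P X T m p - fun _ => longRunCov P Y p) P
      = variance (sigmaTilde P X T m p) P := variance_sub_const hp.1 _
  have h3 : ∫ ω, (sigmaTilde P X T m p - fun _ : Ω => longRunCov P Y p) ω ∂P
      = bias P X Y T m p := by
    simp only [Pi.sub_apply]
    rw [integral_sub (hp.integrable one_le_two) (integrable_const _)]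
    simp [bias]
  rw [h2, h3] at h1
  rw [h1, mse]
  simp

end IsRegular

end Estimator

/-! ### Limits of the scaled integrated bias and variance -/

section Limits

open scoped RealInnerProductSpace

variable {Ω : Type*} {mΩ : MeasurableSpace Ω} {P : Measure Ω} {X : ℕ → ℤ → I → Ω → ℝ}
  {Y : I → ℤ → I → Ω → ℝ}

namespace IsRegular

variable [IsProbabilityMeasure P] {M β ρ D : ℝ}

lemma memLp_covFun (h : IsRegular P X Y M β ρ D) (w : I) (k : ℤ) :
    MemLp (covFun P (Y w 0) (Y w k)) 2 volume :=
  BlockBootstrap.memLp_covFun (h.field_approx w 0) (h.field_approx w k)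
    ((h.mixing_approx w).bdd 0) ((h.mixing_approx w).bdd k)

lemma acovKernel_eq (h : IsRegular P X Y M β ρ D) (w : I) (k : ℤ) :
    acovKernel P Y w k
      = ∫ ω, tensorL2 (centredPath P (Y w 0) ω) (centredPath P (Y w k) ω) ∂P :=
  toL2_covFun (h.field_approx w 0) (h.field_approx w k)
    ((h.mixing_approx w).bdd 0) ((h.mixing_approx w).bdd k)

lemma acovTrace_eq (h : IsRegular P X Y M β ρ D) (w : I) (k : ℤ) :
    acovTrace P Y w k = ∫ ω, ⟪centredPath P (Y w 0) ω, centredPath P (Y w k) ω⟫ ∂P :=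
  integral_cov (h.field_approx w 0) (h.field_approx w k)

lemma isLocCov_acovKernel (h : IsRegular P X Y M β ρ D) :
    IsLocCov (fun T s t => ∫ ω, tensorL2 (centredPath P (X T s) ω) (centredPath P (X T t) ω) ∂P)
      (acovKernel P Y) (max (52 * M * β) (D + 2 * M)) ρ := by
  have := h.isLocCov (V := tensorL2) (fun x y => (isTensor_tensorL2.norm_apply x y).le)
    fun hx s t => hx.norm_integral_tensor_le isTensor_tensorL2 h.one_le h.beta_pos h.rho_pos
      h.rho_lt s t
  convert this using 3 with w k
  exact h.acovKernel_eq w k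

/-- One pairing in the variance contains a kernel with its two times exchanged. By stationarity this
exchange reverses the lag of the limit. -/
lemma isLocCov_acovKernel_neg (h : IsRegular P X Y M β ρ D) :
    IsLocCov (fun T s t => ∫ ω, tensorL2 (centredPath P (X T t) ω) (centredPath P (X T s) ω) ∂P)
      (fun w k => acovKernel P Y w (-k)) (max (52 * M * β) (D + 2 * M)) ρ := by
  have := h.isLocCov (V := tensorL2.flip)
    (fun x y => by
      rw [ContinuousLinearMap.flip_apply, isTensor_tensorL2.norm_apply, mul_comm])
    fun hx s t => by
      have := hx.norm_integral_tensor_le isTensor_tensorL2 h.one_le h.beta_pos h.rho_pos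
        h.rho_lt t s
      rw [← Int.natAbs_neg, neg_sub] at this
      exact this
  simp only [ContinuousLinearMap.flip_apply] at this
  convert this using 3 with w k
  rw [(h.stationary w).integral_bilin_centredPath (h.field_approx w) tensorL2 k 0, zero_sub,
    h.acovKernel_eq w (-k)]

lemma isLocCov_acovTrace (h : IsRegular P X Y M β ρ D) :
    IsLocCov (fun T s t => ∫ ω, ⟪centredPath P (X T s) ω, centredPath P (X T t) ω⟫ ∂P)
      (acovTrace P Y) (max (52 * M * β) (D + 2 * M)) ρ := by
  have := h.isLocCov (V := innerSL ℝ) (fun x y => norm_inner_le_norm x y)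
    fun hx s t => hx.abs_integral_inner_le h.one_le h.beta_pos h.rho_pos h.rho_lt s t
  have e : acovTrace P Y = _ := funext fun w => funext fun k => h.acovTrace_eq w k
  rw [e]
  exact this

lemma integrable_gammaIntegrand (h : IsRegular P X Y M β ρ D) :
    Integrable (gammaIntegrand P Y) volume :=
  ((h.isLocCov_acovTrace.continuous_tsum_lim.pow 2).add
    (h.isLocCov_acovKernel.continuous_tsum_lim.norm.pow 2)).integrable_of_hasCompactSupport
    (HasCompactSupport.of_compactSpace _)

lemma longRunCov_eq (P : Measure Ω) (Y : I → ℤ → I → Ω → ℝ) :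
    longRunCov P Y = ∑' k, ∫ w, acovKernel P Y w k := by
  have e : Set.Iic (min 1 1 : I) = Set.univ := by
    rw [min_self]
    exact Set.eq_univ_of_forall fun w => unitInterval.le_one'
  simp only [longRunCov, limitCovKernel, e, setIntegral_univ]

variable {m : ℕ → ℕ}

lemma tendsto_div_sqrt (hmT : Tendsto (fun T : ℕ => (m T : ℝ) ^ 2 / (T : ℝ)) atTop (𝓝 0)) :
    Tendsto (fun T : ℕ => (m T : ℝ) / √(T : ℝ)) atTop (𝓝 0) := by
  have := hmT.sqrt
  simpa [Real.sqrt_div, Real.sqrt_sq] using this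

lemma tendsto_div (hm : Tendsto m atTop atTop)
    (hmT : Tendsto (fun T : ℕ => (m T : ℝ) ^ 2 / (T : ℝ)) atTop (𝓝 0)) :
    Tendsto (fun T : ℕ => (m T : ℝ) / (T : ℝ)) atTop (𝓝 0) := by
  refine squeeze_zero' (Eventually.of_forall fun T => by positivity) ?_ hmT
  filter_upwards [hm.eventually_ge_atTop 1] with T hT
  have : (1 : ℝ) ≤ m T := by exact_mod_cast hT
  gcongr
  nlinarith

lemma tendsto_one_div (hm : Tendsto m atTop atTop) :
    Tendsto (fun T : ℕ => 1 / (m T : ℝ)) atTop (𝓝 0) :=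
  tendsto_one_div_atTop_nhds_zero_nat.comp hm

lemma tendsto_sq_mul_integral_bias_sq (h : IsRegular P X Y M β ρ D) (hm : Tendsto m atTop atTop)
    (hmT : Tendsto (fun T : ℕ => (m T : ℝ) ^ 2 / (T : ℝ)) atTop (𝓝 0)) :
    Tendsto (fun T : ℕ => (m T : ℝ) ^ 2 * ∫ p, bias P X Y T (m T) p ^ 2) atTop
      (𝓝 (Delta P Y)) := by
  have hL := h.isLocCov_acovKernel
  set C := max (52 * M * β) (D + 2 * M)
  set b : ℕ → L2II := fun T => (m T : ℝ) • ((1 / ((T : ℝ) * m T)) •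
    ∫ ω, blockTensorSum P X T (m T) ω ∂P - longRunCov P Y) with hb
  -- The bias itself converges in `L²([0,1]²)` after multiplication by `m`; the claim is the
  -- convergence of the squared norms.
  have hlim : Tendsto b atTop (𝓝 (-∑' k : ℤ, |(k : ℝ)| • intAcov P Y k)) := by
    rw [tendsto_iff_norm_sub_tendsto_zero]
    have h0 : Tendsto (fun T : ℕ => 4 * C * lagWeightSum ρ * ((m T : ℝ) / √(T : ℝ)
        + (m T : ℝ) ^ 2 / T + 1 / m T)) atTop (𝓝 0) := by
      have := (((tendsto_div_sqrt hmT).add hmT).add (tendsto_one_div hm)).const_mul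
        (4 * C * lagWeightSum ρ)
      simpa using this
    refine squeeze_zero' (Eventually.of_forall fun T => norm_nonneg _) ?_ h0
    filter_upwards [hm.eventually_ge_atTop 1, eventually_ge_atTop 1] with T hmT1 hT
    refine le_trans (le_of_eq ?_) (hL.norm_sum_blocks_sub_le hT hmT1)
    have hm0 : (m T : ℝ) ≠ 0 := by
      have : (1 : ℝ) ≤ m T := by exact_mod_cast hmT1
      positivity
    rw [← h.integral_blockTensorSum hT, ← longRunCov_eq P Y, hb]
    simp only [intAcov, smul_sub, smul_smul]
    congr 1
    rw [show (m T : ℝ) * (1 / ((T : ℝ) * m T)) = 1 / (T : ℝ) by field_simp]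
    abel
  have := (hlim.norm).pow 2
  rw [norm_neg] at this
  refine Tendsto.congr' ?_ this
  filter_upwards [eventually_ge_atTop 1] with T hT
  rw [h.integral_bias_sq hT, hb]
  simp only [norm_smul, Real.norm_natCast, mul_pow]

/-- The series over `ℤ` is invariant under `k ↦ -k`, so the transposed kernel sum gives a squared
norm. -/
lemma Gamma_eq (h : IsRegular P X Y M β ρ D) :
    Gamma P Y = 2 / 3 * (∫ w, ⟪∑' k, acovTrace P Y w k, ∑' k, acovTrace P Y w k⟫)
      + 2 / 3 * ∫ w, ⟪∑' k, acovKernel P Y w k, ∑' k, acovKernel P Y w (-k)⟫ := by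
  have e : ∀ w, ∑' k, acovKernel P Y w (-k) = ∑' k, acovKernel P Y w k := fun w =>
    (Equiv.neg ℤ).tsum_eq fun k => acovKernel P Y w k
  simp only [e, real_inner_self_eq_norm_sq, Real.norm_eq_abs, sq_abs]
  rw [← mul_add, ← integral_add]
  · rfl
  · exact (h.isLocCov_acovTrace.continuous_tsum_lim.pow 2).integrable_of_hasCompactSupport
      (HasCompactSupport.of_compactSpace _)
  · exact (h.isLocCov_acovKernel.continuous_tsum_lim.norm.pow 2).integrable_of_hasCompactSupport
      (HasCompactSupport.of_compactSpace _)

lemma tendsto_mul_integral_variance (h : IsRegular P X Y M β ρ D) (hm : Tendsto m atTop atTop)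
    (hmT : Tendsto (fun T : ℕ => (m T : ℝ) ^ 2 / (T : ℝ)) atTop (𝓝 0)) :
    Tendsto (fun T : ℕ => (T : ℝ) / m T * ∫ p : I × I, variance (sigmaTilde P X T (m T) p) P)
      atTop (𝓝 (Gamma P Y)) := by
  set C := max (52 * M * β) (D + 2 * M)
  set S := lagWeightSum ρ
  rw [tendsto_iff_norm_sub_tendsto_zero]
  have hmT' := tendsto_div hm hmT
  have h0 : Tendsto (fun T : ℕ => 700 * M ^ 2 * β * S ^ 3 * (1 / m T)
      + 2 * (8 * (C * S) ^ 2 * (√(5 * m T / T) + 1 / m T + m T / T + 1 / √T))) atTop (𝓝 0) := by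
    have h5 : Tendsto (fun T : ℕ => √(5 * m T / T)) atTop (𝓝 0) := by
      have := (hmT'.const_mul 5).sqrt
      simpa [mul_div_assoc] using this
    have hT : Tendsto (fun T : ℕ => 1 / √(T : ℝ)) atTop (𝓝 0) := by
      have := (tendsto_one_div_atTop_nhds_zero_nat (𝕜 := ℝ)).sqrt
      simpa using this
    have := ((tendsto_one_div hm).const_mul (700 * M ^ 2 * β * S ^ 3)).add
      ((((((h5.add (tendsto_one_div hm)).add hmT').add hT).const_mul
        (8 * (C * S) ^ 2))).const_mul 2)
    simpa using this
  refine squeeze_zero' (Eventually.of_forall fun T => norm_nonneg _) ?_ h0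
  filter_upwards [hm.eventually_ge_atTop 1, eventually_ge_atTop 1] with T hmT1 hT
  have hm0 : (0 : ℝ) < m T := by exact_mod_cast hmT1
  have hT0 : (0 : ℝ) < T := by exact_mod_cast hT
  have e1 := h.isLocCov_acovTrace.abs_sum_inner_blockCov_sub_le h.isLocCov_acovTrace hT hmT1
  have e2 := h.isLocCov_acovKernel.abs_sum_inner_blockCov_sub_le h.isLocCov_acovKernel_neg hT hmT1
  have e3 := (h.mixing T hT).abs_variance_sub_le isTensor_tensorL2 h.one_le h.beta_pos h.rho_pos
    h.rho_lt T (m T)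
  rw [h.integral_variance hT, h.Gamma_eq, Real.norm_eq_abs]
  simp only [blockCov, Finset.sum_add_distrib] at e1 e2 e3
  simp only [blockTensorSum]
  set N := 1 / ((T : ℝ) * (m T : ℝ) ^ 3) with hN
  have hN0 : 0 ≤ N := by positivity
  -- The scaling of the variance is exactly `1/(T m³)`, the normalisation of the pairing sums; on
  -- the cumulant bound, of order `T m²`, it leaves `1/m`.
  rw [← mul_assoc, show (T : ℝ) / m T * (1 / ((T : ℝ) * m T)) ^ 2 = N by rw [hN]; field_simp]
  have e4 : N * (700 * M ^ 2 * β * (S ^ 3 * (T * (m T : ℝ) ^ 2)))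
      = 700 * M ^ 2 * β * S ^ 3 * (1 / m T) := by
    rw [hN]; field_simp
  have e5 := mul_le_mul_of_nonneg_left e3 hN0
  rw [e4, ← abs_of_nonneg hN0, ← abs_mul, mul_sub, mul_add] at e5
  rw [abs_le] at e1 e2 e5 ⊢
  constructor <;> linarith [e1.1, e1.2, e2.1, e2.2, e5.1, e5.2]

end IsRegular

end Limits

/-! ### The estimator as a conditional covariance -/

section ConditionalCovariance

variable {Ω : Type*} {𝓕 𝓖 : MeasurableSpace Ω} {mΩ : MeasurableSpace Ω} {P : Measure Ω}

lemma integrable_mul_of_indep (h : Indep 𝓖 𝓕 P) {f g : Ω → ℝ}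
    (hf : Measurable[𝓕] f) (hg : Measurable[𝓖] g) (hfi : Integrable f P) (hgi : Integrable g P) :
    Integrable (fun ω => g ω * f ω) P := by
  have hi : IndepFun g f P := by
    rw [IndepFun_iff_Indep]
    exact indep_of_indep_of_le h hg.comap_le hf.comap_le
  exact hi.integrable_mul hgi hfi

variable {X : ℕ → ℤ → I → Ω → ℝ} {Y : I → ℤ → I → Ω → ℝ}

lemma IsMultiplierSequence.memLp {R : ℕ → Ω → ℝ} (hR : IsMultiplierSequence P X R) (i : ℕ) :
    MemLp (R i) 2 P := by
  have h := memLp_id_gaussianReal' (μ := 0) (v := 1) 2 ENNReal.ofNat_ne_top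
  rw [← (hR.law i).map_eq, memLp_map_measure_iff aestronglyMeasurable_id
    (hR.measurable i).aemeasurable] at h
  exact h

lemma IsMultiplierSequence.integral {R : ℕ → Ω → ℝ} (hR : IsMultiplierSequence P X R) (i : ℕ) :
    ∫ ω, R i ω ∂P = 0 := by
  rw [(hR.law i).integral_eq, integral_id_gaussianReal]

lemma measurable_blockSum (T m : ℕ) {i : ℕ} (hi : 1 ≤ i) (τ : I) :
    Measurable[obsField X T] (blockSum P X T m i τ) := by
  refine Finset.measurable_fun_sum _ fun t ht => ?_
  rw [Finset.mem_Icc] at ht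
  refine Measurable.sub_const (measurable_sigmaField ?_ τ) _
  rw [Set.mem_Icc]
  omega

lemma multiplierProcess_one (R : ℕ → Ω → ℝ) (T m : ℕ) (τ : I) :
    multiplierProcess P X R T m 1 τ
      = fun ω => ∑ i ∈ Finset.Icc 1 T, R i ω *
        (1 / √(T : ℝ) * (1 / √(m : ℝ)) * blockSum P X T m i τ ω) := by
  funext ω
  rw [multiplierProcess, Set.Icc.coe_one, one_mul, Nat.floor_natCast, Finset.mul_sum]
  exact Finset.sum_congr rfl fun i _ => by ring

variable [IsProbabilityMeasure P]

/-- The factors `f k` are known given `𝓕`, and the conditional means of the independent `g k` are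
their means. -/
lemma condExp_sum_mul (h𝓕 : 𝓕 ≤ mΩ) (h𝓖 : 𝓖 ≤ mΩ) (h : Indep 𝓖 𝓕 P) {ι : Type*} (A : Finset ι)
    {f g : ι → Ω → ℝ} (hf : ∀ k ∈ A, Measurable[𝓕] (f k)) (hg : ∀ k ∈ A, Measurable[𝓖] (g k))
    (hfi : ∀ k ∈ A, Integrable (f k) P) (hgi : ∀ k ∈ A, Integrable (g k) P) :
    P[fun ω => ∑ k ∈ A, g k ω * f k ω | 𝓕] =ᵐ[P] fun ω => ∑ k ∈ A, (∫ ω', g k ω' ∂P) * f k ω := by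
  have hi : ∀ k ∈ A, Integrable (g k * f k) P := fun k hk =>
    integrable_mul_of_indep h (hf k hk) (hg k hk) (hfi k hk) (hgi k hk)
  have e : (fun ω => ∑ k ∈ A, g k ω * f k ω) = ∑ k ∈ A, g k * f k := by
    funext ω
    simp
  rw [e]
  refine (condExp_finsetSum hi 𝓕).trans ?_
  have hk : ∀ k ∈ A, P[g k * f k | 𝓕] =ᵐ[P] fun ω => (∫ ω', g k ω' ∂P) * f k ω := by
    intro k hk
    refine (condExp_mul_of_stronglyMeasurable_right (hf k hk).stronglyMeasurable (hi k hk)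
      (hgi k hk)).trans ?_
    filter_upwards [condExp_indep_eq h𝓖 h𝓕 (hg k hk).stronglyMeasurable h] with ω hω
    rw [Pi.mul_apply, hω]
  have hall : ∀ᵐ ω ∂P, ∀ k ∈ A, (P[g k * f k | 𝓕]) ω = (∫ ω', g k ω' ∂P) * f k ω :=
    (eventually_all_finset A).2 hk
  filter_upwards [hall] with ω hω
  rw [Finset.sum_apply]
  exact Finset.sum_congr rfl hω

/-- The conditional covariance of two linear combinations of independent standardised multipliers
with coefficients that are measurable with respect to the conditioning σ-field. -/
theorem condCov_sum_mul (h𝓕 : 𝓕 ≤ mΩ) (h𝓖 : 𝓖 ≤ mΩ) (h : Indep 𝓖 𝓕 P) {R : ℕ → Ω → ℝ}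
    (hR : ∀ i, Measurable[𝓖] (R i)) (hR2 : ∀ i, MemLp (R i) 2 P) (hR0 : ∀ i, ∫ ω, R i ω ∂P = 0)
    (hRR : ∀ i j, ∫ ω, R i ω * R j ω ∂P = if i = j then 1 else 0) (A : Finset ℕ)
    {f f' : ℕ → Ω → ℝ} (hf : ∀ i ∈ A, Measurable[𝓕] (f i)) (hf' : ∀ i ∈ A, Measurable[𝓕] (f' i))
    (hf2 : ∀ i ∈ A, MemLp (f i) 2 P) (hf2' : ∀ i ∈ A, MemLp (f' i) 2 P) :
    condCov P 𝓕 (fun ω => ∑ i ∈ A, R i ω * f i ω) (fun ω => ∑ i ∈ A, R i ω * f' i ω)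
      =ᵐ[P] fun ω => ∑ i ∈ A, f i ω * f' i ω := by
  have h0 : ∀ {f : ℕ → Ω → ℝ}, (∀ i ∈ A, Measurable[𝓕] (f i)) → (∀ i ∈ A, MemLp (f i) 2 P) →
      P[fun ω => ∑ i ∈ A, R i ω * f i ω | 𝓕] =ᵐ[P] fun _ => 0 := by
    intro f hf hf2
    refine (condExp_sum_mul h𝓕 h𝓖 h A hf (fun i _ => hR i)
      (fun i hi => (hf2 i hi).integrable one_le_two)
      fun i _ => (hR2 i).integrable one_le_two).trans (Eventually.of_forall fun ω => ?_)
    simp [hR0]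
  -- The conditional means vanish, so only the product of the sums remains; its off-diagonal terms
  -- disappear because the multipliers are orthonormal.
  have hprod : (fun ω => ((∑ i ∈ A, R i ω * f i ω)
        - (P[fun ω => ∑ i ∈ A, R i ω * f i ω | 𝓕]) ω)
        * ((∑ i ∈ A, R i ω * f' i ω) - (P[fun ω => ∑ i ∈ A, R i ω * f' i ω | 𝓕]) ω))
      =ᵐ[P] fun ω => ∑ k ∈ A ×ˢ A, (R k.1 ω * R k.2 ω) * (f k.1 ω * f' k.2 ω) := by
    filter_upwards [h0 hf hf2, h0 hf' hf2'] with ω h1 h2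
    rw [h1, h2, sub_zero, sub_zero, Finset.sum_mul_sum, Finset.sum_product]
    exact Finset.sum_congr rfl fun i _ => Finset.sum_congr rfl fun j _ => by ring
  refine (condExp_congr_ae hprod).trans ?_
  refine (condExp_sum_mul h𝓕 h𝓖 h (A ×ˢ A) (f := fun k ω => f k.1 ω * f' k.2 ω)
    (g := fun k ω => R k.1 ω * R k.2 ω)
    (fun k hk => (hf k.1 (Finset.mem_product.1 hk).1).mul (hf' k.2 (Finset.mem_product.1 hk).2))
    (fun k _ => (hR k.1).mul (hR k.2))
    (fun k hk => (hf2 k.1 (Finset.mem_product.1 hk).1).integrable_mul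
      (hf2' k.2 (Finset.mem_product.1 hk).2))
    fun k _ => (hR2 k.1).integrable_mul (hR2 k.2)).trans (Eventually.of_forall fun ω => ?_)
  simp only [hRR]
  rw [Finset.sum_product]
  refine Finset.sum_congr rfl fun i hi => ?_
  simp [hi]

lemma IsMultiplierSequence.integral_mul {R : ℕ → Ω → ℝ} (hR : IsMultiplierSequence P X R)
    (i j : ℕ) : ∫ ω, R i ω * R j ω ∂P = if i = j then 1 else 0 := by
  split_ifs with hij
  · subst hij
    have h := variance_eq_sub (hR.memLp i)
    rw [(hR.law i).variance_eq, variance_id_gaussianReal, hR.integral] at h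
    simp only [Pi.pow_apply, sq] at h
    simpa using h.symm
  · have h := (hR.indep.indepFun hij).integral_mul_eq_mul_integral (hR.memLp i).1 (hR.memLp j).1
    rw [hR.integral, hR.integral, mul_zero] at h
    exact h

theorem IsRegular.condCov_ae_eq_sigmaTilde {M β ρ D : ℝ} (h : IsRegular P X Y M β ρ D)
    {R : ℕ → Ω → ℝ} (hR : IsMultiplierSequence P X R) {T : ℕ} (hT : 1 ≤ T) (m : ℕ) :
    ∀ᵐ p : I × I, condCov P (obsField X T) (multiplierProcess P X R T m 1 p.1)
      (multiplierProcess P X R T m 1 p.2) =ᵐ[P] sigmaTilde P X T m p := by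
  have hX : ∀ t τ, Measurable (X T t τ) := fun t => (h.field T hT t).measurable_apply
  -- Pointwise second moments are finite for almost every `τ` only; the exceptional set is pulled
  -- back along both projections of the square.
  have hmem : ∀ᵐ τ : I, ∀ i ∈ Finset.Icc 1 T, MemLp (blockSum P X T m i τ) 2 P := by
    have h1 : ∀ᵐ τ : I, ∀ t : ℤ, MemLp (centre P (X T t) τ) 2 P :=
      ae_all_iff.2 fun t => (h.field T hT t).centre.ae_memLp_apply
    filter_upwards [h1] with τ hτ i hi
    have e : blockSum P X T m i τ = _ :=
      funext fun ω => blockSum_eq T m (Finset.mem_Icc.1 hi).1 τ ω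
    rw [e]
    exact memLp_finsetSum _ fun t _ => hτ t
  filter_upwards [Measure.quasiMeasurePreserving_fst.ae hmem,
    Measure.quasiMeasurePreserving_snd.ae hmem] with p h1 h2
  simp only [multiplierProcess_one]
  refine (condCov_sum_mul (sigmaField_le hX _) (iSup_le fun i => (hR.measurable i).comap_le)
    (indep_of_indep_of_le_right hR.indep_process ?_)
    (fun i => Measurable.mono (comap_measurable (R i)) (le_iSup_of_le i le_rfl) le_rfl) hR.memLp
    hR.integral hR.integral_mul (Finset.Icc 1 T)
    (fun i hi => (measurable_blockSum T m (Finset.mem_Icc.1 hi).1 p.1).const_mul _)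
    (fun i hi => (measurable_blockSum T m (Finset.mem_Icc.1 hi).1 p.2).const_mul _)
    (fun i hi => (h1 i hi).const_mul _) fun i hi => (h2 i hi).const_mul _).trans
    (Eventually.of_forall fun ω => ?_)
  · refine le_trans ?_ (le_iSup₂ (f := fun (T : ℕ) (_ : 1 ≤ T) => sigmaField (X T) Set.univ) T hT)
    exact iSup_mono fun t => iSup_le fun _ => le_iSup_of_le (Set.mem_univ t) le_rfl
  · have e : ∀ a : ℕ, 1 / √(a : ℝ) * (1 / √(a : ℝ)) = 1 / a := fun a => by
      rw [one_div_mul_one_div, Real.mul_self_sqrt (Nat.cast_nonneg a)]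
    simp only [sigmaTilde, Finset.mul_sum]
    refine Finset.sum_congr rfl fun i _ => ?_
    rw [← e T, ← e m]
    ring

end ConditionalCovariance

/-! ### Minimisation of the leading term -/

section Minimiser

/-- The leading term of the integrated mean squared error has a unique minimiser. -/
theorem exists_unique_min_leadingIMSE {Γ Δ : ℝ} (hΔ : 0 < Δ) (hΓ : 0 < Γ) {T : ℕ} (hT : 1 ≤ T) :
    ∃ x₀ : ℝ, x₀ = (2 * Δ * T / Γ) ^ (1 / 3 : ℝ) ∧ 0 < x₀ ∧ ∀ x : ℝ, 0 < x → x ≠ x₀ →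
      leadingIMSE Γ Δ T x₀ < leadingIMSE Γ Δ T x := by
  have hT0 : (0 : ℝ) < T := by exact_mod_cast hT
  have hb : 0 < 2 * Δ * T / Γ := by positivity
  refine ⟨_, rfl, Real.rpow_pos_of_pos hb _, fun x hx hne => ?_⟩
  set y := (2 * Δ * T / Γ) ^ (1 / 3 : ℝ) with hy
  have hy0 : 0 < y := Real.rpow_pos_of_pos hb _
  have hy3 : y ^ 3 = 2 * Δ * T / Γ := by
    rw [hy, ← Real.rpow_natCast, ← Real.rpow_mul hb.le]
    norm_num
  have hΓT : Γ / T = 2 * Δ / y ^ 3 := by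
    rw [hy3]
    field_simp
  -- Once `Γ/T` is expressed through `y³`, the difference has the double root `x = y` and otherwise
  -- positive factors, so no derivative is needed.
  have e : leadingIMSE Γ Δ T x - leadingIMSE Γ Δ T y
      = Δ * (x - y) ^ 2 * (2 * x + y) / (y ^ 3 * x ^ 2) := by
    have h1 : ∀ z, leadingIMSE Γ Δ T z = z * (2 * Δ / y ^ 3) + Δ / z ^ 2 := fun z => by
      rw [← hΓT, leadingIMSE]
      ring
    rw [h1, h1]
    field_simp
    ring
  have hpos : 0 < (x - y) ^ 2 := by
    have : x - y ≠ 0 := sub_ne_zero.2 hne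
    positivity
  have : 0 < leadingIMSE Γ Δ T x - leadingIMSE Γ Δ T y := by
    rw [e]
    positivity
  linarith

end Minimiser

/-! ### Assembly of the expansions -/

section LittleO

variable {m : ℕ → ℕ}

lemma isLittleO_sub_mul {b r : ℕ → ℝ} {L : ℝ} (hr : ∀ᶠ T in atTop, r T ≠ 0)
    (h : Tendsto (fun T => (r T)⁻¹ * b T) atTop (𝓝 L)) :
    (fun T => b T - r T * L) =o[atTop] r := by
  rw [isLittleO_iff_tendsto' (hr.mono fun T hT h0 => absurd h0 hT)]
  have := h.sub_const L
  rw [sub_self] at this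
  refine this.congr' (hr.mono fun T hT => ?_)
  field_simp

end LittleO

end BlockBootstrap

theorem lemma3p8 {Ω : Type*} [MeasurableSpace Ω] (P : Measure Ω) [IsProbabilityMeasure P]
    (X : ℕ → ℤ → I → Ω → ℝ) (Y : I → ℤ → I → Ω → ℝ) (m : ℕ → ℕ)
    (hls : BlockBootstrap.IsLocallyStationary P 4 X Y)
    (hmom : BlockBootstrap.MomentCondition P X Y)
    (hmix : BlockBootstrap.IsExpStronglyMixing P X Y)
    (hm : Tendsto m atTop atTop)
    (hmT : Tendsto (fun T : ℕ => (m T : ℝ) ^ 2 / (T : ℝ)) atTop (𝓝 0)) :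
    -- all kernels, series and integrals that define `σ_c`, `Δ` and `Γ` exist
    ((∀ (w : I) (k : ℤ), MemLp (BlockBootstrap.covFun P (Y w 0) (Y w k)) 2 volume) ∧
      (∀ k : ℤ, Integrable (fun w : I => BlockBootstrap.acovKernel P Y w k) volume) ∧
      (∀ (w : I) (k : ℤ), Integrable (fun τ : I => cov[Y w 0 τ, Y w k τ; P]) volume) ∧
      (Summable fun k : ℤ => BlockBootstrap.intAcov P Y k) ∧
      (Summable fun k : ℤ => |(k : ℝ)| • BlockBootstrap.intAcov P Y k) ∧
      (∀ w : I, Summable fun k : ℤ => BlockBootstrap.acovTrace P Y w k) ∧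
      (∀ w : I, Summable fun k : ℤ => BlockBootstrap.acovKernel P Y w k) ∧
      Integrable (BlockBootstrap.gammaIntegrand P Y) volume) ∧
    -- the bias, the variance and the mean squared error of `σ̃_T` exist and can be integrated
    (∀ T : ℕ, 1 ≤ T →
      (∀ᵐ p : I × I, MemLp (BlockBootstrap.sigmaTilde P X T (m T) p) 2 P) ∧
      Integrable (fun p : I × I => BlockBootstrap.bias P X Y T (m T) p ^ 2) volume ∧
      Integrable (fun p : I × I => variance (BlockBootstrap.sigmaTilde P X T (m T) p) P) volume ∧
      Integrable (fun p : I × I => BlockBootstrap.mse P X Y T (m T) p) volume) ∧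
    -- `σ̃_T` is the conditional covariance of the multiplier process given the observations
    (∀ R : ℕ → Ω → ℝ, BlockBootstrap.IsMultiplierSequence P X R → ∀ T : ℕ, 1 ≤ T →
      ∀ᵐ p : I × I,
        BlockBootstrap.condCov P (BlockBootstrap.obsField X T)
            (BlockBootstrap.multiplierProcess P X R T (m T) 1 p.1)
            (BlockBootstrap.multiplierProcess P X R T (m T) 1 p.2)
          =ᵐ[P] BlockBootstrap.sigmaTilde P X T (m T) p) ∧
    -- integrated squared bias
    ((fun T : ℕ => (∫ p : I × I, BlockBootstrap.bias P X Y T (m T) p ^ 2)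
        - 1 / (m T : ℝ) ^ 2 * BlockBootstrap.Delta P Y)
      =o[atTop] fun T : ℕ => 1 / (m T : ℝ) ^ 2) ∧
    -- integrated variance
    ((fun T : ℕ => (∫ p : I × I, variance (BlockBootstrap.sigmaTilde P X T (m T) p) P)
        - (m T : ℝ) / (T : ℝ) * BlockBootstrap.Gamma P Y)
      =o[atTop] fun T : ℕ => (m T : ℝ) / (T : ℝ)) ∧
    -- integrated mean squared error
    ((fun T : ℕ => (∫ p : I × I, BlockBootstrap.mse P X Y T (m T) p)
        - BlockBootstrap.leadingIMSE (BlockBootstrap.Gamma P Y) (BlockBootstrap.Delta P Y) T (m T))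
      =o[atTop] fun T : ℕ => 1 / (m T : ℝ) ^ 2 + (m T : ℝ) / (T : ℝ)) ∧
    -- the unique minimiser of its leading term
    (0 < BlockBootstrap.Delta P Y → 0 < BlockBootstrap.Gamma P Y → ∀ T : ℕ, 1 ≤ T →
      ∃ x₀ : ℝ, x₀ = (2 * BlockBootstrap.Delta P Y * T / BlockBootstrap.Gamma P Y) ^ (1 / 3 : ℝ) ∧
        0 < x₀ ∧ ∀ x : ℝ, 0 < x → x ≠ x₀ →
          BlockBootstrap.leadingIMSE (BlockBootstrap.Gamma P Y) (BlockBootstrap.Delta P Y) T x₀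
            < BlockBootstrap.leadingIMSE (BlockBootstrap.Gamma P Y) (BlockBootstrap.Delta P Y) T x)

    := by
  obtain ⟨M, β, ρ, D, h⟩ := BlockBootstrap.exists_isRegular hls hmom hmix
  -- The block length may vanish for small `T`; the rates `1/m²` and `m/T` are nonzero only
  -- eventually.
  have hm1 : ∀ᶠ T in atTop, 1 ≤ m T ∧ 1 ≤ T :=
    (hm.eventually_ge_atTop 1).and (eventually_ge_atTop 1)
  have hbias : (fun T : ℕ => (∫ p : I × I, BlockBootstrap.bias P X Y T (m T) p ^ 2)
      - 1 / (m T : ℝ) ^ 2 * BlockBootstrap.Delta P Y) =o[atTop] fun T : ℕ => 1 / (m T : ℝ) ^ 2 := by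
    refine BlockBootstrap.isLittleO_sub_mul (hm1.mono fun T hT => ?_) ?_
    · have : (0 : ℝ) < m T := by exact_mod_cast hT.1
      positivity
    · simpa only [one_div, inv_inv] using h.tendsto_sq_mul_integral_bias_sq hm hmT
  have hvar : (fun T : ℕ => (∫ p : I × I, variance (BlockBootstrap.sigmaTilde P X T (m T) p) P)
      - (m T : ℝ) / (T : ℝ) * BlockBootstrap.Gamma P Y)
      =o[atTop] fun T : ℕ => (m T : ℝ) / (T : ℝ) := by
    refine BlockBootstrap.isLittleO_sub_mul (hm1.mono fun T hT => ?_) ?_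
    · have : (0 : ℝ) < m T := by exact_mod_cast hT.1
      have : (0 : ℝ) < T := by exact_mod_cast hT.2
      positivity
    · simpa only [inv_div] using h.tendsto_mul_integral_variance hm hmT
  refine ⟨⟨h.memLp_covFun, h.isLocCov_acovKernel.integrable_lim,
    fun w k => BlockBootstrap.integrable_cov (h.field_approx w 0) (h.field_approx w k),
    h.isLocCov_acovKernel.summable_integral, h.isLocCov_acovKernel.summable_abs_smul_integral,
    h.isLocCov_acovTrace.summable_lim, h.isLocCov_acovKernel.summable_lim,
    h.integrable_gammaIntegrand⟩, fun T hT => ⟨(h.isSquareField_sigmaTilde hT _).ae_memLp_apply,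
    (h.memLp_bias hT _).integrable_sq, h.integrable_variance hT _,
    ((h.integrable_variance hT _).add (h.memLp_bias hT _).integrable_sq).congr
      (h.mse_ae_eq hT _).symm⟩,
    fun R hR T hT => h.condCov_ae_eq_sigmaTilde hR hT _, hbias, hvar, ?_,
    fun hΔ hΓ T hT => BlockBootstrap.exists_unique_min_leadingIMSE hΔ hΓ hT⟩
  have h1 : (fun T : ℕ => 1 / (m T : ℝ) ^ 2)
      =O[atTop] fun T : ℕ => 1 / (m T : ℝ) ^ 2 + (m T : ℝ) / (T : ℝ) :=
    IsBigO.of_norm_le fun T => by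
      rw [Real.norm_of_nonneg (by positivity)]
      linarith [show (0 : ℝ) ≤ (m T : ℝ) / T by positivity]
  have h2 : (fun T : ℕ => (m T : ℝ) / (T : ℝ))
      =O[atTop] fun T : ℕ => 1 / (m T : ℝ) ^ 2 + (m T : ℝ) / (T : ℝ) :=
    IsBigO.of_norm_le fun T => by
      rw [Real.norm_of_nonneg (by positivity)]
      linarith [show (0 : ℝ) ≤ 1 / (m T : ℝ) ^ 2 by positivity]
  -- Both error terms are of smaller order than the sum of the two nonnegative rates, and the
  -- decomposition of the mean squared error is integrated.
  refine ((hbias.trans_isBigO h1).add (hvar.trans_isBigO h2)).congr' ?_ EventuallyEq.rfl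
  filter_upwards [eventually_ge_atTop 1] with T hT
  rw [integral_congr_ae (h.mse_ae_eq hT _), integral_add (h.integrable_variance hT _)
    (h.memLp_bias hT _).integrable_sq, BlockBootstrap.leadingIMSE]
  ring
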